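/- Let $k$ be an algebraically closed field of characteristic $0$ and $n\ge 1$. The $0$-Hecke algebra $H_n(0)$ is generated by $T_1,\dots,T_{n-1}$ with $T_i^2=-T_i$, $T_iT_j=T_jT_i$ for $|i-j|>1$, and $T_iT_{i+1}T_i=T_{i+1}T_iT_{i+1}$. The $0$-Hecke-Clifford superalgebra $HCl_n(0)$ is generated by such (even) $T_i$ together with odd $c_1,\dots,c_n$ satisfying $c_j^2=-1$, $c_ic_j=-c_jc_i$ for $i\ne j$, $T_ic_j=c_jT_i$ for $j\neq i,i+1$, $T_ic_i=c_{i+1}T_i$ and $(T_i+1)c_{i+1}=c_i(T_i+1)$. For $D=\{i_1<\dots<i_r\}\subseteq[n]$ put $c_D=c_{i_1}\cdots c_{i_r}$. It has even involutive automorphisms $\varphi,\varphi'$ with $\varphi(T_i)=T_{n-i}+c_{n-i}c_{n+1-i}$, $\varphi'(T_i)=-(T_{n-i}+1)$, $\varphi(c_j)=\varphi'(c_j)=-c_{n+1-j}$, and even unsigned anti-involutions $\psi,\psi'$ (i.e. $\nu(ab)=\nu(b)\nu(a)$) with $\psi(T_i)=T_i+c_ic_{i+1}$, $\psi'(T_i)=-(T_i+1)$,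 $\psi(c_j)=\psi'(c_j)=-c_j$. For a supermodule $M$, ${}^{\nu}M$ ($\nu=\varphi,\varphi'$) is $M$ with the action $a\cdot_\nu m=\nu(a)m$, and ${}^{\nu}(M^*)$ ($\nu=\psi,\psi'$) is $\mathrm{Hom}_k(M,k)$ with the action $(a\cdot_\nu f)(m)=f(\nu(a)m)$; a functional has degree $i$ if it vanishes on $M_{i+1}$. A morphism of supermodules of degree $d\in\mathbb Z/2$ is a linear map $f$ with $f(M_j)\subseteq N_{d+j}$ and $f(am)=(-1)^{d|a|}af(m)$; an isomorphism (written $\cong$) is a bijective morphism of degree $0$ or $1$. For a composition $\alpha=(\alpha_1,\dots,\alpha_r)\vDash n$ let $D(\alpha)=\{\alpha_1,\alpha_1+\alpha_2,\dots,\alpha_1+\dots+\alpha_{r-1}\}$, let $P(\alpha)=\{x\in[2,n-1]: x-1\notin D(\alpha),\,x\in D(\alpha)\}$, and let $\alpha^*\vDash n$ be the composition whose descent set is the complement in $[n-1]$ of the descent set of the reversed composition $(\alpha_r,\dots,\alpha_1)$. Let $S_\alpha=k\eta_\alpha$ be the $H_n(0)$-module with $T_i\eta_\alpha=-\eta_\alpha$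 if $i\in D(\alpha)$ and $T_i\eta_\alpha=0$ otherwise, and let $\tilde S_\alpha=HCl_n(0)\otimes_{H_n(0)}S_\alpha$, with $\eta_\alpha$ even. A peak set in $[n]$ is a subset $P\subseteq[2,n-1]$ such that $i\in P$ implies $i-1\notin P$. For such $P$, $HClS_P$ denotes a simple supermodule which is isomorphic to a super submodule of $\tilde S_\alpha$ for some $\alpha\vDash n$ with $P(\alpha)=P$; it exists and is unique up to isomorphism (of degree $0$ or $1$). Then for every $\alpha\vDash n$: (1) There is a supermodule isomorphism $\tilde S_{\alpha^*}\to{}^{\varphi}(\tilde S_\alpha)$ of degree $\bar n$ sending $c_D\eta_{\alpha^*}$ to $(-1)^{n|D|}\varphi(c_D)c_{[n]}\eta_\alpha$ for all $D\subseteq[n]$. In particular ${}^{\varphi}(HClS_{P(\alpha)})\cong HClS_{P(\alpha^*)}$. (2) There is an even supermodule isomorphism $\tilde S_{\alpha^*}\to{}^{\varphi'}(\tilde S_\alpha)$ sending $c_D\eta_{\alpha^*}$ to $\varphi'(c_D)\eta_\alpha$ for all $D\subseteq[n]$. In particular ${}^{\varphi'}(HClS_{P(\alpha)})\cong HClS_{P(\alpha^*)}$.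 (3) The elements $c_D\eta_\alpha$ $(D\subseteq[n])$ form a basis of $\tilde S_\alpha$. Let $\zeta_\alpha$ be the element of the dual basis dual to $\eta_\alpha$. There is an even supermodule isomorphism $\tilde S_\alpha\to{}^{\psi}(\tilde S_\alpha^*)$ sending $c_D\eta_\alpha$ to $c_D\cdot_\psi\zeta_\alpha$ for all $D\subseteq[n]$. In particular ${}^{\psi}(HClS_P^*)\cong HClS_P$ for every peak set $P$ in $[n]$. (4) Let $\xi_\alpha$ be the element of the dual basis dual to $c_{[n]}\eta_\alpha$. There is a supermodule isomorphism $\tilde S_\alpha\to{}^{\psi'}(\tilde S_\alpha^*)$ of degree $\bar n$ sending $c_D\eta_\alpha$ to $(-1)^{n|D|}c_D\cdot_{\psi'}\xi_\alpha$ for all $D\subseteq[n]$. In particular ${}^{\psi'}(HClS_P^*)\cong HClS_P$ for every peak set $P$ in $[n]$. -/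

import Mathlib

open scoped TensorProduct

universe u

noncomputable section

namespace HCl

/-! ### Compositions, descent sets, peak sets -/

section Compositions

variable {n : ℕ}

/-- The descent set `D(α) = {α₁, α₁ + α₂, …, α₁ + ⋯ + α_{r-1}} ⊆ {1, …, n-1}`. -/
def descentSet (α : Composition n) : Finset ℕ :=
  (Finset.Ico 1 α.length).image α.sizeUpTo

theorem descentSet_subset (α : Composition n) : descentSet α ⊆ Finset.Icc 1 (n - 1) := by
  intro x hx
  simp only [descentSet, Finset.mem_image, Finset.mem_Ico] at hx
  obtain ⟨j, ⟨h1, h2⟩, rfl⟩ := hx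
  have a := α.sizeUpTo_strict_mono (i := 0) (by omega)
  have b := α.monotone_sizeUpTo (show 0 + 1 ≤ j from h1)
  have c := α.sizeUpTo_strict_mono h2
  have d := α.sizeUpTo_le (j + 1)
  simp only [Finset.mem_Icc]
  omega

/-- The composition of `n` whose descent set is `{i + 1 : i ∈ s}`. -/
def ofDescents (s : Finset (Fin (n - 1))) : Composition n :=
  (compositionEquiv n).symm ((compositionAsSetEquiv n).symm s)

/-- The complement `α^c`, with `D(α^c) = {1, …, n-1} \ D(α)`. -/
def complement (α : Composition n) : Composition n :=
  ofDescents (Finset.univ.filter fun i : Fin (n - 1) => (i : ℕ) + 1 ∉ descentSet α)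

/-- The conjugate `α^*`: the complement of the reverse. -/
def conj (α : Composition n) : Composition n := complement α.reverse

/-- The peak set `P(α) = {x ∈ {2, …, n-1} : x - 1 ∉ D(α), x ∈ D(α)}`. -/
def peakSet (α : Composition n) : Finset ℕ :=
  (Finset.Icc 2 (n - 1)).filter fun x => x - 1 ∉ descentSet α ∧ x ∈ descentSet α

/-- Peak sets in `{1, …, n}`. -/
def IsPeakSet (n : ℕ) (P : Finset ℕ) : Prop :=
  P ⊆ Finset.Icc 2 (n - 1) ∧ ∀ i ∈ P, i - 1 ∉ P

theorem mem_descentSet_ofDescents (s : Finset (Fin (n - 1))) (i : Fin (n - 1)) :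
    (i : ℕ) + 1 ∈ descentSet (ofDescents s) ↔ i ∈ s := by
  have h1 : (compositionAsSetEquiv n) ((compositionEquiv n) (ofDescents s)) = s := by
    simp [ofDescents]
  have hi := i.2
  have h2 : i ∈ (compositionAsSetEquiv n) ((compositionEquiv n) (ofDescents s)) ↔
      (⟨1 + (i : ℕ), by omega⟩ : Fin n.succ) ∈ (ofDescents s).boundaries := by
    simp [compositionAsSetEquiv, compositionEquiv, Composition.toCompositionAsSet]
  rw [h1] at h2
  rw [h2]
  simp only [descentSet, Finset.mem_image, Finset.mem_Ico, Composition.boundaries,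
    Finset.mem_map, Finset.mem_univ, true_and]
  constructor
  · rintro ⟨j, ⟨-, hj'⟩, hj⟩
    refine ⟨⟨j, by omega⟩, ?_⟩
    ext
    simp [Composition.boundary, hj, add_comm]
  · rintro ⟨j, hj⟩
    have hj1 := congrArg Fin.val hj
    simp only [Composition.boundary, OrderEmbedding.coe_ofStrictMono,
      RelEmbedding.coe_toEmbedding] at hj1
    refine ⟨j, ⟨?_, ?_⟩, by omega⟩
    · by_contra h0
      have : (j : ℕ) = 0 := by omega
      rw [this, Composition.sizeUpTo_zero] at hj1
      omega
    · by_contra h0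
      rw [Composition.sizeUpTo_ofLength_le _ _ (by omega)] at hj1
      omega

theorem mem_descentSet_complement (α : Composition n) (x : ℕ) :
    x ∈ descentSet (complement α) ↔ x ∈ Finset.Icc 1 (n - 1) ∧ x ∉ descentSet α := by
  constructor
  · intro h
    have hx : x ∈ Finset.Icc 1 (n - 1) := descentSet_subset _ h
    refine ⟨hx, ?_⟩
    rw [Finset.mem_Icc] at hx
    have := mem_descentSet_ofDescents
      (Finset.univ.filter fun i : Fin (n - 1) => (i : ℕ) + 1 ∉ descentSet α) ⟨x - 1, by omega⟩
    simp only [Finset.mem_filter, Finset.mem_univ, true_and] at this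
    rw [Nat.sub_add_cancel hx.1] at this
    exact this.mp h
  · rintro ⟨hx, h⟩
    rw [Finset.mem_Icc] at hx
    have := mem_descentSet_ofDescents
      (Finset.univ.filter fun i : Fin (n - 1) => (i : ℕ) + 1 ∉ descentSet α) ⟨x - 1, by omega⟩
    simp only [Finset.mem_filter, Finset.mem_univ, true_and] at this
    rw [Nat.sub_add_cancel hx.1] at this
    exact this.mpr h

end Compositions

/-! ### Supermodules over a superalgebra

A superalgebra is an algebra `A` with a `ZMod 2`-grading `𝒜`; a supermodule is a `ZMod 2`-graded
vector space with an action of `A`, given as an algebra homomorphism to its endomorphisms. -/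

section Super

variable {k : Type u} [Field k] {A : Type u} [Ring A] [Algebra k A]

/-- `𝒜` makes `A` a superalgebra. -/
structure IsSuperalgebra (𝒜 : ZMod 2 → Submodule k A) : Prop where
  one_mem : (1 : A) ∈ 𝒜 0
  mul_mem : ∀ {i j : ZMod 2} {a b : A}, a ∈ 𝒜 i → b ∈ 𝒜 j → a * b ∈ 𝒜 (i + j)
  isCompl : IsCompl (𝒜 0) (𝒜 1)

/-- Left supermodules over `(A, 𝒜)`. -/
structure SuperModule (𝒜 : ZMod 2 → Submodule k A) where
  V : Type u
  [addCommGroup : AddCommGroup V]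
  [module : Module k V]
  ρ : A →ₐ[k] Module.End k V
  gr : ZMod 2 → Submodule k V
  isCompl : IsCompl (gr 0) (gr 1)
  act_mem : ∀ {i j : ZMod 2} {a : A} {v : V}, a ∈ 𝒜 i → v ∈ gr j → ρ a v ∈ gr (i + j)

attribute [instance] SuperModule.addCommGroup SuperModule.module

namespace SuperModule

variable {𝒜 : ZMod 2 → Submodule k A}

/-- `f` is a (homogeneous) morphism of supermodules of degree `d`. -/
structure IsMor (M N : SuperModule 𝒜) (d : ZMod 2) (f : M.V →ₗ[k] N.V) : Prop where
  map_gr : ∀ (j : ZMod 2) (v : M.V), v ∈ M.gr j → f v ∈ N.gr (d + j)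
  map_act : ∀ (i : ZMod 2) (a : A), a ∈ 𝒜 i → ∀ v : M.V,
    f (M.ρ a v) = (-1 : k) ^ (d.val * i.val) • N.ρ a (f v)

/-- `M` and `N` are isomorphic through an isomorphism of some degree, even or odd. -/
def Iso (M N : SuperModule 𝒜) : Prop :=
  ∃ (d : ZMod 2) (f : M.V ≃ₗ[k] N.V), IsMor M N d f.toLinearMap

/-- Super submodules: graded subspaces stable under the action. -/
structure IsSub (M : SuperModule 𝒜) (W : Submodule k M.V) : Prop where
  act_mem : ∀ (a : A) (w : M.V), w ∈ W → M.ρ a w ∈ W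
  graded : W ≤ (W ⊓ M.gr 0) ⊔ (W ⊓ M.gr 1)

/-- Irreducible supermodules. -/
def IsSimple (M : SuperModule 𝒜) : Prop :=
  Nontrivial M.V ∧ ∀ W : Submodule k M.V, M.IsSub W → W = ⊥ ∨ W = ⊤

/-- The twist `^ν M` by an even automorphism `ν`: `a ._ν m = ν(a) m`. -/
def twist (M : SuperModule 𝒜) (ν : A ≃ₐ[k] A) (hν : ∀ i, ∀ a ∈ 𝒜 i, ν a ∈ 𝒜 i) :
    SuperModule 𝒜 where
  V := M.V
  ρ := M.ρ.comp ν.toAlgHom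
  gr := M.gr
  isCompl := M.isCompl
  act_mem ha hv := M.act_mem (hν _ _ ha) hv

/-- The twisted dual `^ν(M^*)` for an even unsigned anti-automorphism `ν` of `A` (an isomorphism
onto the opposite algebra): `(a ._ν f)(m) = f(ν(a) m)`. A functional has degree `i` if it
vanishes on the component of degree `i + 1`. -/
def dualTwist (M : SuperModule 𝒜) (ν : A ≃ₐ[k] Aᵐᵒᵖ)
    (hν : ∀ i, ∀ a ∈ 𝒜 i, (ν a).unop ∈ 𝒜 i) : SuperModule 𝒜 where
  V := Module.Dual k M.V
  ρ := AlgHom.ofLinearMap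
    { toFun := fun a => (M.ρ (ν a).unop).dualMap
      map_add' := fun a b => by ext; simp
      map_smul' := fun r a => by ext; simp }
    (by ext; simp) (fun a b => by ext; simp)
  gr i := (M.gr (i + 1)).dualAnnihilator
  isCompl := (Subspace.isCompl_dualAnnihilator M.isCompl).symm
  act_mem := by
    intro i j a f ha hf
    rw [Submodule.mem_dualAnnihilator] at hf ⊢
    intro v hv
    have h := M.act_mem (hν _ _ ha) hv
    have e : i + (i + j + 1) = j + 1 := by
      have : i + i = 0 := by clear * -; revert i; decide
      linear_combination this
    rw [e] at h
    exact hf _ h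

theorem dualTwist_apply (M : SuperModule 𝒜) (ν : A ≃ₐ[k] Aᵐᵒᵖ)
    (hν : ∀ i, ∀ a ∈ 𝒜 i, (ν a).unop ∈ 𝒜 i) (a : A) (f : Module.Dual k M.V) (m : M.V) :
    DFunLike.coe (F := Module.Dual k M.V) ((M.dualTwist ν hν).ρ a f) m = f (M.ρ (ν a).unop m) := rfl

end SuperModule

/-! ### Induction along an algebra homomorphism -/

section Induction

variable {B : Type u} [Ring B] [Algebra k B] {M : Type u} [AddCommGroup M] [Module k M]

/-- The relations `a f(b) ⊗ m = a ⊗ b m` which define `A ⊗_B M` as a quotient of `A ⊗_k M`. -/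
def balancing (f : B →ₐ[k] A) (σ : B →ₐ[k] Module.End k M) : Submodule k (A ⊗[k] M) :=
  Submodule.span k {x | ∃ a b m, x = (a * f b) ⊗ₜ[k] m - a ⊗ₜ[k] (σ b m)}

/-- The induced module `A ⊗_B M`. -/
abbrev Ind (f : B →ₐ[k] A) (σ : B →ₐ[k] Module.End k M) : Type u :=
  (A ⊗[k] M) ⧸ balancing f σ

/-- The class of `a ⊗ m` in `A ⊗_B M`. -/
def Ind.mk (f : B →ₐ[k] A) (σ : B →ₐ[k] Module.End k M) (a : A) (m : M) : Ind f σ :=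
  Submodule.Quotient.mk (a ⊗ₜ[k] m)

theorem Ind.mk_add (f : B →ₐ[k] A) (σ : B →ₐ[k] Module.End k M) (a b : A) (m : M) :
    Ind.mk f σ (a + b) m = Ind.mk f σ a m + Ind.mk f σ b m := by
  simp [Ind.mk, TensorProduct.add_tmul]

theorem Ind.mk_smul (f : B →ₐ[k] A) (σ : B →ₐ[k] Module.End k M) (r : k) (a : A) (m : M) :
    Ind.mk f σ (r • a) m = r • Ind.mk f σ a m := by
  simp [Ind.mk, ← TensorProduct.smul_tmul']

/-- A map `g : A → A` commuting with right multiplication by `f(B)` acts on `A ⊗_B M`. -/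
def Ind.map (f : B →ₐ[k] A) (σ : B →ₐ[k] Module.End k M) (g : A →ₗ[k] A)
    (hg : ∀ a b, g (a * f b) = g a * f b) : Ind f σ →ₗ[k] Ind f σ :=
  Submodule.mapQ _ _ (g.rTensor M) (by
    rw [balancing, Submodule.span_le]
    rintro _ ⟨a, b, m, rfl⟩
    refine Submodule.subset_span ⟨g a, b, m, ?_⟩
    simp [hg])

@[simp] theorem Ind.map_mk (f : B →ₐ[k] A) (σ : B →ₐ[k] Module.End k M) (g : A →ₗ[k] A)
    (hg : ∀ a b, g (a * f b) = g a * f b) (a : A) (m : M) :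
    Ind.map f σ g hg (Ind.mk f σ a m) = Ind.mk f σ (g a) m := rfl

theorem Ind.hom_ext {f : B →ₐ[k] A} {σ : B →ₐ[k] Module.End k M} {N : Type*} [AddCommGroup N]
    [Module k N] {g h : Ind f σ →ₗ[k] N}
    (H : ∀ a m, g (Ind.mk f σ a m) = h (Ind.mk f σ a m)) : g = h := by
  apply Submodule.linearMap_qext
  apply TensorProduct.ext'
  exact H

/-- The action `a (a' ⊗ m) = a a' ⊗ m` of `A` on `A ⊗_B M`. -/
def Ind.act (f : B →ₐ[k] A) (σ : B →ₐ[k] Module.End k M) : A →ₐ[k] Module.End k (Ind f σ) :=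
  AlgHom.ofLinearMap
    { toFun := fun a => Ind.map f σ (LinearMap.mulLeft k a) (fun _ _ => by simp [mul_assoc])
      map_add' := fun a b => Ind.hom_ext fun x m => by
        change Ind.mk f σ ((a + b) * x) m = Ind.mk f σ (a * x) m + Ind.mk f σ (b * x) m
        rw [add_mul, Ind.mk_add]
      map_smul' := fun r a => Ind.hom_ext fun x m => by
        change Ind.mk f σ (r • a * x) m = r • Ind.mk f σ (a * x) m
        rw [smul_mul_assoc, Ind.mk_smul] }
    (Ind.hom_ext fun x m => by simp)
    (fun a b => Ind.hom_ext fun x m => by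
      change Ind.mk f σ (a * b * x) m = Ind.mk f σ (a * (b * x)) m
      rw [mul_assoc])

@[simp] theorem Ind.act_mk (f : B →ₐ[k] A) (σ : B →ₐ[k] Module.End k M) (a x : A) (m : M) :
    Ind.act f σ a (Ind.mk f σ x m) = Ind.mk f σ (a * x) m := rfl

end Induction

theorem isCompl_of_involution [CharZero k] {V : Type*} [AddCommGroup V] [Module k V]
    {U₀ U₁ : Submodule k V} (s : V →ₗ[k] V) (h₀ : ∀ v ∈ U₀, s v = v) (h₁ : ∀ v ∈ U₁, s v = -v)
    (h : U₀ ⊔ U₁ = ⊤) : IsCompl U₀ U₁ := by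
  refine ⟨?_, codisjoint_iff.mpr h⟩
  rw [Submodule.disjoint_def]
  intro v hv₀ hv₁
  have e : v = -v := (h₀ v hv₀).symm.trans (h₁ v hv₁)
  have e2 : (2 : k) • v = 0 := by
    rw [two_smul]
    nth_rewrite 1 [e]
    simp
  exact (smul_eq_zero.mp e2).resolve_left two_ne_zero

end Super

/-! ### The 0-Hecke algebra and the 0-Hecke-Clifford algebra

Indices are shifted by one: `T i` for `i : Fin (n - 1)` is `T_{i+1}`, and `c j` for `j : Fin n` is
`c_{j+1}`. Then `lo i` and `hi i` are the positions of `c_{i+1}` and `c_{i+2}`. -/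

section Algebras

/-- The position of `c_i`, seen from `T_i`. -/
def lo {n : ℕ} (i : Fin (n - 1)) : Fin n := ⟨i, by omega⟩

/-- The position of `c_{i+1}`, seen from `T_i`. -/
def hi {n : ℕ} (i : Fin (n - 1)) : Fin n := ⟨i + 1, by omega⟩

/-- The relations of the 0-Hecke algebra, for elements `t i` of a ring. -/
structure HeckeRels {n : ℕ} {R : Type*} [Ring R] (t : Fin (n - 1) → R) : Prop where
  sq : ∀ i, t i * t i = -t i
  comm : ∀ i j : Fin (n - 1), (i : ℕ) + 1 < j → t i * t j = t j * t i
  braid : ∀ i j : Fin (n - 1), (j : ℕ) = i + 1 → t i * t j * t i = t j * t i * t j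

/-- The relations of the 0-Hecke-Clifford algebra, for elements `t i`, `c j` of a ring; `l i`, `h i`
are the two positions moved by `t i`. -/
structure HCRels {n : ℕ} {R : Type*} [Ring R] (l h : Fin (n - 1) → Fin n)
    (t : Fin (n - 1) → R) (c : Fin n → R) : Prop extends HeckeRels t where
  c_sq : ∀ j, c j * c j = -1
  c_anti : ∀ i j, i ≠ j → c i * c j = -(c j * c i)
  t_c : ∀ i j, j ≠ l i → j ≠ h i → t i * c j = c j * t i
  t_l : ∀ i, t i * c (l i) = c (h i) * t i
  t_h : ∀ i, (t i + 1) * c (h i) = c (l i) * (t i + 1)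

variable (k : Type u) [Field k] (n : ℕ)

/-- The defining relations of the 0-Hecke algebra. -/
inductive HeckeRel : FreeAlgebra k (Fin (n - 1)) → FreeAlgebra k (Fin (n - 1)) → Prop
  | sq (i) : HeckeRel (FreeAlgebra.ι k i * FreeAlgebra.ι k i) (-FreeAlgebra.ι k i)
  | comm (i j : Fin (n - 1)) (hij : (i : ℕ) + 1 < j) :
      HeckeRel (FreeAlgebra.ι k i * FreeAlgebra.ι k j) (FreeAlgebra.ι k j * FreeAlgebra.ι k i)
  | braid (i j : Fin (n - 1)) (hij : (j : ℕ) = i + 1) :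
      HeckeRel (FreeAlgebra.ι k i * FreeAlgebra.ι k j * FreeAlgebra.ι k i)
        (FreeAlgebra.ι k j * FreeAlgebra.ι k i * FreeAlgebra.ι k j)

/-- The 0-Hecke algebra `H_n(0)`. -/
def Hecke : Type u := RingQuot (HeckeRel k n)

instance : Ring (Hecke k n) := inferInstanceAs (Ring (RingQuot (HeckeRel k n)))

instance : Algebra k (Hecke k n) := inferInstanceAs (Algebra k (RingQuot (HeckeRel k n)))

/-- The quotient map from the free algebra. -/
def Hecke.mk : FreeAlgebra k (Fin (n - 1)) →ₐ[k] Hecke k n := RingQuot.mkAlgHom k _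

/-- The generator `T i` of the free algebra. -/
abbrev freeT (i : Fin (n - 1)) : FreeAlgebra k (Fin (n - 1) ⊕ Fin n) :=
  FreeAlgebra.ι k (Sum.inl i)

/-- The generator `c j` of the free algebra. -/
abbrev freeC (j : Fin n) : FreeAlgebra k (Fin (n - 1) ⊕ Fin n) :=
  FreeAlgebra.ι k (Sum.inr j)

/-- The defining relations of the 0-Hecke-Clifford algebra. -/
inductive HCRel : FreeAlgebra k (Fin (n - 1) ⊕ Fin n) →
    FreeAlgebra k (Fin (n - 1) ⊕ Fin n) → Prop
  | sq (i) : HCRel (freeT k n i * freeT k n i) (-freeT k n i)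
  | comm (i j : Fin (n - 1)) (hij : (i : ℕ) + 1 < j) :
      HCRel (freeT k n i * freeT k n j) (freeT k n j * freeT k n i)
  | braid (i j : Fin (n - 1)) (hij : (j : ℕ) = i + 1) :
      HCRel (freeT k n i * freeT k n j * freeT k n i) (freeT k n j * freeT k n i * freeT k n j)
  | c_sq (j) : HCRel (freeC k n j * freeC k n j) (-1)
  | c_anti (i j) (hij : i ≠ j) :
      HCRel (freeC k n i * freeC k n j) (-(freeC k n j * freeC k n i))
  | t_c (i : Fin (n - 1)) (j : Fin n) (hl : j ≠ lo i) (hh : j ≠ hi i) :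
      HCRel (freeT k n i * freeC k n j) (freeC k n j * freeT k n i)
  | t_lo (i : Fin (n - 1)) :
      HCRel (freeT k n i * freeC k n (lo i)) (freeC k n (hi i) * freeT k n i)
  | t_hi (i : Fin (n - 1)) :
      HCRel ((freeT k n i + 1) * freeC k n (hi i)) (freeC k n (lo i) * (freeT k n i + 1))

/-- The 0-Hecke-Clifford algebra `HCl_n(0)`. -/
def HC : Type u := RingQuot (HCRel k n)

instance : Ring (HC k n) := inferInstanceAs (Ring (RingQuot (HCRel k n)))

instance : Algebra k (HC k n) := inferInstanceAs (Algebra k (RingQuot (HCRel k n)))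

/-- The quotient map from the free algebra. -/
def HC.mk : FreeAlgebra k (Fin (n - 1) ⊕ Fin n) →ₐ[k] HC k n := RingQuot.mkAlgHom k _

variable {n}

/-- The generators of `H_n(0)`. -/
def Hecke.T (i : Fin (n - 1)) : Hecke k n := Hecke.mk k n (FreeAlgebra.ι k i)

/-- The generators `T i` of `HCl_n(0)`. -/
def T (i : Fin (n - 1)) : HC k n := HC.mk k n (freeT k n i)

/-- The generators `c j` of `HCl_n(0)`. -/
def c (j : Fin n) : HC k n := HC.mk k n (freeC k n j)

theorem HC.mk_rel {x y : FreeAlgebra k (Fin (n - 1) ⊕ Fin n)} (h : HCRel k n x y) :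
    HC.mk k n x = HC.mk k n y := RingQuot.mkAlgHom_rel k h

theorem hcRels : HCRels lo hi (T k (n := n)) (c k) where
  sq i := by simpa [T] using HC.mk_rel k (HCRel.sq (k := k) i)
  comm i j hij := by simpa [T] using HC.mk_rel k (HCRel.comm (k := k) i j hij)
  braid i j hij := by simpa [T] using HC.mk_rel k (HCRel.braid (k := k) i j hij)
  c_sq j := by simpa [c] using HC.mk_rel k (HCRel.c_sq (k := k) j)
  c_anti i j hij := by simpa [c] using HC.mk_rel k (HCRel.c_anti (k := k) i j hij)
  t_c i j hl hh := by simpa [T, c] using HC.mk_rel k (HCRel.t_c (k := k) i j hl hh)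
  t_l i := by simpa [T, c] using HC.mk_rel k (HCRel.t_lo (k := k) i)
  t_h i := by simpa [T, c] using HC.mk_rel k (HCRel.t_hi (k := k) i)

variable {k} {R : Type*} [Ring R] [Algebra k R]

/-- The universal property of `H_n(0)`. -/
def Hecke.lift {t : Fin (n - 1) → R} (H : HeckeRels t) : Hecke k n →ₐ[k] R :=
  RingQuot.liftAlgHom k ⟨FreeAlgebra.lift k t, by
    intro x y h
    cases h with
    | sq i => simpa using H.sq i
    | comm i j hij => simpa using H.comm i j hij
    | braid i j hij => simpa using H.braid i j hij⟩

@[simp] theorem Hecke.lift_T {t : Fin (n - 1) → R} (H : HeckeRels t) (i : Fin (n - 1)) :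
    Hecke.lift (k := k) H (Hecke.T k i) = t i := by
  change RingQuot.liftAlgHom k _ (RingQuot.mkAlgHom k _ _) = _
  rw [RingQuot.liftAlgHom_mkAlgHom_apply, FreeAlgebra.lift_ι_apply]

/-- The universal property of `HCl_n(0)`. -/
def lift {t : Fin (n - 1) → R} {d : Fin n → R} (H : HCRels lo hi t d) : HC k n →ₐ[k] R :=
  RingQuot.liftAlgHom k ⟨FreeAlgebra.lift k (Sum.elim t d), by
    intro x y h
    cases h with
    | sq i => simpa using H.sq i
    | comm i j hij => simpa using H.comm i j hij
    | braid i j hij => simpa using H.braid i j hij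
    | c_sq j => simpa using H.c_sq j
    | c_anti i j hij => simpa using H.c_anti i j hij
    | t_c i j hl hh => simpa using H.t_c i j hl hh
    | t_lo i => simpa using H.t_l i
    | t_hi i => simpa using H.t_h i⟩

@[simp] theorem lift_T {t : Fin (n - 1) → R} {d : Fin n → R} (H : HCRels lo hi t d)
    (i : Fin (n - 1)) : lift (k := k) H (T k i) = t i := by
  change RingQuot.liftAlgHom k _ (RingQuot.mkAlgHom k _ _) = _
  rw [RingQuot.liftAlgHom_mkAlgHom_apply, FreeAlgebra.lift_ι_apply]
  rfl

@[simp] theorem lift_c {t : Fin (n - 1) → R} {d : Fin n → R} (H : HCRels lo hi t d)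
    (j : Fin n) : lift (k := k) H (c k j) = d j := by
  change RingQuot.liftAlgHom k _ (RingQuot.mkAlgHom k _ _) = _
  rw [RingQuot.liftAlgHom_mkAlgHom_apply, FreeAlgebra.lift_ι_apply]
  rfl

theorem hom_ext {f g : HC k n →ₐ[k] R} (hT : ∀ i, f (T k i) = g (T k i))
    (hc : ∀ j, f (c k j) = g (c k j)) : f = g := by
  apply RingQuot.ringQuot_ext'
  apply FreeAlgebra.hom_ext
  funext x
  cases x with
  | inl i => exact hT i
  | inr j => exact hc j

variable (k n)

/-- The natural map `H_n(0) → HCl_n(0)`. -/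
def incl : Hecke k n →ₐ[k] HC k n := Hecke.lift (hcRels k).toHeckeRels

/-- The `ZMod 2`-grading of `HCl_n(0)` with `T i` of degree `0` and `c j` of degree `1`: the
component of degree `p` is spanned by the words in the generators in which the number of letters
`c j` is congruent to `p`. -/
def grading (p : ZMod 2) : Submodule k (HC k n) :=
  Submodule.span k {x | ∃ w : List (Fin (n - 1) ⊕ Fin n),
    ((w.countP Sum.isRight : ℕ) : ZMod 2) = p ∧ x = (w.map (Sum.elim (T k) (c k))).prod}

variable {k n}

theorem word_mem (w : List (Fin (n - 1) ⊕ Fin n)) :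
    (w.map (Sum.elim (T k) (c k))).prod ∈
      grading k n ((w.countP Sum.isRight : ℕ) : ZMod 2) :=
  Submodule.subset_span ⟨w, rfl, rfl⟩

theorem T_mem (i : Fin (n - 1)) : T k i ∈ grading k n 0 := by
  simpa using word_mem (k := k) [Sum.inl i]

theorem c_mem (j : Fin n) : c k j ∈ grading k n 1 := by
  simpa using word_mem (k := k) [Sum.inr j]

theorem one_mem_grading : (1 : HC k n) ∈ grading k n 0 := by
  simpa using word_mem (k := k) (n := n) []

theorem mul_mem_grading {p q : ZMod 2} {a b : HC k n} (ha : a ∈ grading k n p)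
    (hb : b ∈ grading k n q) : a * b ∈ grading k n (p + q) := by
  induction ha using Submodule.span_induction with
  | mem x hx =>
    obtain ⟨w, rfl, rfl⟩ := hx
    induction hb using Submodule.span_induction with
    | mem y hy =>
      obtain ⟨v, rfl, rfl⟩ := hy
      simpa using word_mem (k := k) (w ++ v)
    | zero => simp
    | add y z _ _ hy hz => rw [mul_add]; exact add_mem hy hz
    | smul r y _ hy => rw [mul_smul_comm]; exact Submodule.smul_mem _ _ hy
  | zero => simp
  | add y z _ _ hy hz => rw [add_mul]; exact add_mem hy hz
  | smul r y _ hy => rw [smul_mul_assoc]; exact Submodule.smul_mem _ _ hy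

theorem parityRels {l h : Fin (n - 1) → Fin n} {t : Fin (n - 1) → R} {d : Fin n → R}
    (H : HCRels l h t d) : HCRels l h t (fun j => -d j) where
  toHeckeRels := H.toHeckeRels
  c_sq j := by simp [H.c_sq j]
  c_anti i j hij := by simp [H.c_anti i j hij]
  t_c i j hl hh := by simp [H.t_c i j hl hh]
  t_l i := by simp [H.t_l i]
  t_h i := by simp [H.t_h i]

variable (k n) in
/-- The parity automorphism of `HCl_n(0)`. -/
def parity : HC k n →ₐ[k] HC k n := lift (parityRels (hcRels k))

@[simp] theorem parity_T (i : Fin (n - 1)) : parity k n (T k i) = T k i := lift_T _ _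

@[simp] theorem parity_c (j : Fin n) : parity k n (c k j) = -c k j := lift_c _ _

theorem parity_of_mem {p : ZMod 2} {a : HC k n} (ha : a ∈ grading k n p) :
    parity k n a = (-1 : k) ^ p.val • a := by
  induction ha using Submodule.span_induction with
  | mem x hx =>
    obtain ⟨w, rfl, rfl⟩ := hx
    have : (-1 : k) ^ ((w.countP Sum.isRight : ℕ) : ZMod 2).val =
        (-1) ^ (w.countP Sum.isRight) := by
      rw [ZMod.val_natCast, ← neg_one_pow_eq_pow_mod_two]
    rw [this]
    clear this
    induction w with
    | nil => simp
    | cons x w ih =>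
      cases x with
      | inl i => simp [ih]
      | inr j => simp [ih, List.countP_cons, pow_succ, neg_smul]
  | zero => simp
  | add y z _ _ hy hz => simp [hy, hz]
  | smul r y _ hy => rw [map_smul, hy, smul_comm]

theorem grading_sup : grading k n 0 ⊔ grading k n 1 = ⊤ := by
  have h01 : ∀ p, grading k n p ≤ grading k n 0 ⊔ grading k n 1 := by
    intro p
    fin_cases p
    · exact le_sup_left
    · exact le_sup_right
  let S : Subalgebra k (HC k n) :=
    { carrier := (grading k n 0 ⊔ grading k n 1 : Submodule k (HC k n))
      mul_mem' := by
        intro a b ha hb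
        obtain ⟨a0, h0, a1, h1, rfl⟩ := Submodule.mem_sup.mp ha
        obtain ⟨b0, g0, b1, g1, rfl⟩ := Submodule.mem_sup.mp hb
        rw [add_mul, mul_add, mul_add]
        exact add_mem (add_mem (h01 _ (mul_mem_grading h0 g0)) (h01 _ (mul_mem_grading h0 g1)))
          (add_mem (h01 _ (mul_mem_grading h1 g0)) (h01 _ (mul_mem_grading h1 g1)))
      add_mem' := fun ha hb => add_mem ha hb
      algebraMap_mem' := fun r => by
        rw [Algebra.algebraMap_eq_smul_one]
        exact Submodule.smul_mem _ _ (h01 _ one_mem_grading) }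
  have hT : ∀ i, T k i ∈ S := fun i => h01 _ (T_mem i)
  have hc : ∀ j, c k j ∈ S := fun j => h01 _ (c_mem j)
  have hw : ∀ x : FreeAlgebra k (Fin (n - 1) ⊕ Fin n),
      HC.mk k n x ∈ S := by
    intro x
    induction x using FreeAlgebra.induction with
    | grade0 r => rw [AlgHom.commutes]; exact S.algebraMap_mem r
    | grade1 x =>
      cases x with
      | inl i => exact hT i
      | inr j => exact hc j
    | mul a b ha hb => rw [map_mul]; exact S.mul_mem ha hb
    | add a b ha hb => rw [map_add]; exact S.add_mem ha hb
  rw [eq_top_iff]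
  intro x _
  obtain ⟨y, rfl⟩ := RingQuot.mkAlgHom_surjective k (HCRel k n) x
  exact hw y

theorem isSuperalgebra [CharZero k] : IsSuperalgebra (grading k n) where
  one_mem := one_mem_grading
  mul_mem := mul_mem_grading
  isCompl := isCompl_of_involution (parity k n).toLinearMap
    (fun v hv => by simpa using parity_of_mem hv)
    (fun v hv => by simpa [show (1 : ZMod 2).val = 1 from rfl] using parity_of_mem hv) grading_sup

/-- A linear map is even if it is multiplicative (or antimultiplicative) with even values on the
`T i` and odd values on the `c j`. -/
theorem even_of_gens {f : HC k n →ₗ[k] HC k n} (h1 : f 1 = 1)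
    (hm : (∀ a b, f (a * b) = f a * f b) ∨ ∀ a b, f (a * b) = f b * f a)
    (hT : ∀ i, f (T k i) ∈ grading k n 0) (hc : ∀ j, f (c k j) ∈ grading k n 1)
    (p : ZMod 2) (a : HC k n) (ha : a ∈ grading k n p) : f a ∈ grading k n p := by
  induction ha using Submodule.span_induction with
  | mem x hx =>
    obtain ⟨w, rfl, rfl⟩ := hx
    induction w with
    | nil => simpa [h1] using one_mem_grading
    | cons x w ih =>
      have key : ∀ q, Sum.elim (T k) (c k) x ∈ grading k n q → f (Sum.elim (T k) (c k) x) ∈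
          grading k n q →
          f (Sum.elim (T k) (c k) x * (w.map (Sum.elim (T k) (c k))).prod) ∈
            grading k n (((w.countP Sum.isRight : ℕ) : ZMod 2) + q) := by
        intro q _ hq
        rcases hm with hm | hm
        · rw [hm, add_comm]; exact mul_mem_grading hq ih
        · rw [hm]; exact mul_mem_grading ih hq
      cases x with
      | inl i => simpa using key 0 (T_mem i) (hT i)
      | inr j => simpa [List.countP_cons] using key 1 (c_mem j) (hc j)
  | zero => simp
  | add y z _ _ hy hz => rw [map_add]; exact add_mem hy hz
  | smul r y _ hy => rw [map_smul]; exact Submodule.smul_mem _ _ hy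

/-! ### The involutions and anti-involutions -/

theorem braid_aux {t s a b c : R}
    (ha : a * a = -1) (hb : b * b = -1) (hc : c * c = -1)
    (hba : b * a = -(a * b)) (hca : c * a = -(a * c)) (hcb : c * b = -(b * c))
    (htt : t * t = -t) (hss : s * s = -s) (hts : s * (t * s) = t * (s * t))
    (hta : t * a = b * t) (htb : t * b = a * t + a - b) (htc : t * c = c * t)
    (hsb : s * b = c * s) (hsc : s * c = b * s + b - c) (hsa : s * a = a * s) :
    (t + a * b) * (s + b * c) * (t + a * b) = (s + b * c) * (t + a * b) * (s + b * c) := by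
  have ext : ∀ {x y z : R}, x * y = z → ∀ w, x * (y * w) = z * w := by
    intro x y z h w; rw [← mul_assoc, h]
  simp only [mul_add, add_mul, mul_sub, sub_mul, mul_assoc, hb, hc, hba, hcb, htb, htc, hsb, hsc,
    ext ha, ext hb, ext hc, ext hba, ext hca, ext hcb, ext hta, ext htb, ext htc, ext hsb, ext hsc,
    ext hsa, htt, hss, hts, neg_mul, mul_neg, one_mul, mul_one, neg_neg]
  abel

theorem HCRels.t_h' {l h : Fin (n - 1) → Fin n} {t : Fin (n - 1) → R} {d : Fin n → R}
    (H : HCRels l h t d) (i : Fin (n - 1)) :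
    t i * d (h i) = d (l i) * t i + d (l i) - d (h i) := by
  have := H.t_h i
  rw [add_mul, mul_add, one_mul, mul_one] at this
  rw [← this]
  abel

theorem lo_ne_hi (i : Fin (n - 1)) : lo i ≠ hi i := by simp [lo, hi, Fin.ext_iff]

/-- The elements `t i + c_i c_{i+1}`, `c j` satisfy the relations with `c_i`, `c_{i+1}`
interchanged. -/
theorem revRels₁ {t : Fin (n - 1) → R} {d : Fin n → R} (H : HCRels lo hi t d) :
    HCRels hi lo (fun i => t i + d (lo i) * d (hi i)) d where
  sq i := by
    have e := H.t_h' i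
    have e1 := H.t_l i
    have e2 := H.c_anti _ _ (lo_ne_hi i).symm
    have ext : ∀ {x y z : R}, x * y = z → ∀ w, x * (y * w) = z * w := by
      intro x y z h w; rw [← mul_assoc, h]
    simp only [mul_add, add_mul, mul_sub, mul_assoc, H.sq, e, ext e1, e2, ext e2, H.c_sq,
      mul_neg, neg_mul, mul_one, neg_neg]
    abel
  comm i j hij := by
    have q1 : lo j ≠ lo i := by simp [lo, Fin.ext_iff]; omega
    have q2 : lo j ≠ hi i := by simp [lo, hi, Fin.ext_iff]; omega
    have q3 : hi j ≠ lo i := by simp [lo, hi, Fin.ext_iff]; omega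
    have q4 : hi j ≠ hi i := by simp [hi, Fin.ext_iff]; omega
    have a1 : Commute (t i) (t j) := H.comm i j hij
    have a2 : Commute (t i) (d (lo j) * d (hi j)) :=
      Commute.mul_right (H.t_c i _ q1 q2) (H.t_c i _ q3 q4)
    have a3 : Commute (t j) (d (lo i) * d (hi i)) :=
      Commute.mul_right (H.t_c j _ q1.symm q3.symm) (H.t_c j _ q2.symm q4.symm)
    have a4 : ∀ x, x ≠ lo i → x ≠ hi i → Commute (d (lo i) * d (hi i)) (d x) := by
      intro x h1 h2
      change _ = _
      rw [mul_assoc, H.c_anti _ _ h2.symm, mul_neg, ← mul_assoc, H.c_anti _ _ h1.symm]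
      simp [mul_assoc]
    exact Commute.add_left (Commute.add_right a1 a2)
      (Commute.add_right a3.symm (Commute.mul_right (a4 _ q1 q2) (a4 _ q3 q4)))
  braid i j hij := by
    have e : lo j = hi i := by simp [lo, hi, Fin.ext_iff]; omega
    have q1 : hi j ≠ lo i := by simp [lo, hi, Fin.ext_iff]; omega
    have q2 : hi j ≠ hi i := by simp [hi, Fin.ext_iff]; omega
    have b1 := H.t_h' j
    have b2 := H.t_l j
    rw [e] at b1 b2
    simp only [e]
    refine braid_aux (H.c_sq _) (H.c_sq _) (H.c_sq _) (H.c_anti _ _ (lo_ne_hi i).symm)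
      (H.c_anti _ _ q1) (H.c_anti _ _ q2) (H.sq i) (H.sq j) ?_ (H.t_l i) (H.t_h' i)
      (H.t_c i _ q1 q2) b2 b1 (H.t_c j _ (by rw [e]; exact lo_ne_hi i) q1.symm)
    rw [← mul_assoc, ← mul_assoc, H.braid i j hij]
  c_sq := H.c_sq
  c_anti := H.c_anti
  t_c i j hh hl := by
    have e := H.t_c i j hl hh
    rw [add_mul, mul_add, e, mul_assoc, H.c_anti _ _ hh.symm, mul_neg, ← mul_assoc,
      H.c_anti _ _ hl.symm]
    simp [mul_assoc]
  t_l i := by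
    rw [add_mul, mul_add, H.t_h', mul_assoc, H.c_sq, ← mul_assoc, H.c_sq]
    simp only [mul_neg, neg_mul, mul_one, one_mul]
    abel
  t_h i := by
    have e2 := H.c_anti _ _ (lo_ne_hi i)
    simp only [add_mul, mul_add, H.t_l, one_mul, mul_one]
    rw [e2, mul_neg, ← mul_assoc, H.c_sq, neg_mul, mul_assoc, H.c_sq]
    simp only [mul_neg, neg_mul, mul_one, one_mul, neg_neg]
    abel

/-- The elements `-(t i + 1)`, `c j` satisfy the relations with `c_i`, `c_{i+1}` interchanged. -/
theorem revRels₂ {t : Fin (n - 1) → R} {d : Fin n → R} (H : HCRels lo hi t d) :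
    HCRels hi lo (fun i => -(t i + 1)) d where
  sq i := by
    have := H.sq i
    simp [mul_add, add_mul, this]
  comm i j hij := by
    have : Commute (t i) (t j) := H.comm i j hij
    exact ((this.add_left (Commute.one_left _)).add_right (Commute.one_right _)).neg_left.neg_right
  braid i j hij := by
    have h1 := H.braid i j hij
    have h2 := H.sq i
    have h3 := H.sq j
    simp only [mul_assoc] at h1
    simp only [neg_mul, mul_neg, mul_add, add_mul, mul_assoc, h1, h2, h3, mul_one, one_mul]
    abel
  c_sq := H.c_sq
  c_anti := H.c_anti
  t_c i j hh hl := by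
    have e := H.t_c i j hl hh
    simp [add_mul, mul_add, e]
  t_l i := by
    have := H.t_h i
    rw [neg_mul, mul_neg, this]
  t_h i := by
    have := H.t_l i
    simp [this]

theorem flipRels {t : Fin (n - 1) → R} {d : Fin n → R} (H : HCRels hi lo t d) :
    HCRels lo hi (fun i => t i.rev) (fun j => -d j.rev) := by
  have e1 : ∀ i : Fin (n - 1), (lo i).rev = hi i.rev := by
    intro i; have := i.2; simp [lo, hi, Fin.ext_iff]; omega
  have e2 : ∀ i : Fin (n - 1), (hi i).rev = lo i.rev := by
    intro i; have := i.2; simp [lo, hi, Fin.ext_iff]; omega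
  refine parityRels (d := fun j => d j.rev) ?_
  constructor
  · constructor
    · exact fun i => H.sq _
    · intro i j hij
      exact (H.comm j.rev i.rev (by have := i.2; have := j.2; simp; omega)).symm
    · intro i j hij
      exact (H.braid j.rev i.rev (by have := i.2; have := j.2; simp; omega)).symm
  · exact fun i => H.c_sq _
  · exact fun i j hij => H.c_anti _ _ (by simpa using hij)
  · intro i j hl hh
    refine H.t_c _ _ ?_ ?_
    · rw [← e1]; simpa using hl
    · rw [← e2]; simpa using hh
  · intro i; simpa only [e1, e2] using H.t_l i.rev
  · intro i; simpa only [e1, e2] using H.t_h i.rev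

theorem oppRels {t : Fin (n - 1) → R} {d : Fin n → R} (H : HCRels hi lo t d) :
    HCRels lo hi (fun i => MulOpposite.op (t i)) (fun j => MulOpposite.op (-d j)) := by
  have H' := parityRels H
  constructor
  · constructor
    · intro i; simpa using congrArg MulOpposite.op (H.sq i)
    · intro i j hij; simpa using congrArg MulOpposite.op (H.comm i j hij).symm
    · intro i j hij
      simpa [mul_assoc] using congrArg MulOpposite.op (H.braid i j hij)
  · intro j; simpa using congrArg MulOpposite.op (H.c_sq j)
  · intro i j hij; simpa using congrArg MulOpposite.op (H.c_anti j i hij.symm)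
  · intro i j hl hh; simpa using congrArg MulOpposite.op (H.t_c i j hh hl).symm
  · intro i; simpa using congrArg MulOpposite.op (H.t_l i).symm
  · intro i; simpa using congrArg MulOpposite.op (H.t_h i).symm

variable (k n)

/-- The endomorphism of `HCl_n(0)` underlying `φ`. -/
def phiHom : HC k n →ₐ[k] HC k n := lift (flipRels (revRels₁ (hcRels k)))

/-- The endomorphism of `HCl_n(0)` underlying `φ'`. -/
def phiHom' : HC k n →ₐ[k] HC k n := lift (flipRels (revRels₂ (hcRels k)))

/-- The homomorphism to the opposite algebra underlying `ψ`. -/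
def psiHom : HC k n →ₐ[k] (HC k n)ᵐᵒᵖ := lift (oppRels (revRels₁ (hcRels k)))

/-- The homomorphism to the opposite algebra underlying `ψ'`. -/
def psiHom' : HC k n →ₐ[k] (HC k n)ᵐᵒᵖ := lift (oppRels (revRels₂ (hcRels k)))

variable {k n}

theorem lo_rev (i : Fin (n - 1)) : (lo i).rev = hi i.rev := by
  have := i.2; simp [lo, hi, Fin.ext_iff]; omega

theorem hi_rev (i : Fin (n - 1)) : (hi i).rev = lo i.rev := by
  have := i.2; simp [lo, hi, Fin.ext_iff]; omega

theorem phiHom_T (i : Fin (n - 1)) :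
    phiHom k n (T k i) = T k i.rev + c k (lo i.rev) * c k (hi i.rev) := lift_T _ _

theorem phiHom_c (j : Fin n) : phiHom k n (c k j) = -c k j.rev := lift_c _ _

theorem phiHom'_T (i : Fin (n - 1)) : phiHom' k n (T k i) = -(T k i.rev + 1) := lift_T _ _

theorem phiHom'_c (j : Fin n) : phiHom' k n (c k j) = -c k j.rev := lift_c _ _

theorem psiHom_T (i : Fin (n - 1)) :
    psiHom k n (T k i) = MulOpposite.op (T k i + c k (lo i) * c k (hi i)) := lift_T _ _

theorem psiHom_c (j : Fin n) : psiHom k n (c k j) = MulOpposite.op (-c k j) := lift_c _ _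

theorem psiHom'_T (i : Fin (n - 1)) :
    psiHom' k n (T k i) = MulOpposite.op (-(T k i + 1)) := lift_T _ _

theorem psiHom'_c (j : Fin n) : psiHom' k n (c k j) = MulOpposite.op (-c k j) := lift_c _ _

theorem phiHom_invol : (phiHom k n).comp (phiHom k n) = AlgHom.id k _ := by
  refine hom_ext (fun i => ?_) (fun j => ?_)
  · simp only [AlgHom.comp_apply, AlgHom.id_apply, phiHom_T, map_add, map_mul, phiHom_c, lo_rev,
      hi_rev, Fin.rev_rev, neg_mul_neg]
    rw [(hcRels k).c_anti _ _ (lo_ne_hi i)]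
    abel
  · simp [phiHom_c]

theorem phiHom'_invol : (phiHom' k n).comp (phiHom' k n) = AlgHom.id k _ := by
  refine hom_ext (fun i => ?_) (fun j => ?_)
  · simp [phiHom'_T]
  · simp [phiHom'_c]

/-- An antihomomorphism that squares to the identity, as an isomorphism to the opposite algebra. -/
def antiInvol {A : Type*} [Ring A] [Algebra k A] (g : A →ₐ[k] Aᵐᵒᵖ)
    (hg : ∀ x, (g (g x).unop).unop = x) : A ≃ₐ[k] Aᵐᵒᵖ :=
  AlgEquiv.ofBijective g
    ⟨fun x y h => by rw [← hg x, ← hg y, h],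
      fun y => ⟨(g y.unop).unop, MulOpposite.unop_injective (hg y.unop)⟩⟩

theorem anti_hom_ext {g : HC k n →ₐ[k] (HC k n)ᵐᵒᵖ}
    (hT : ∀ i, (g (g (T k i)).unop).unop = T k i) (hc : ∀ j, (g (g (c k j)).unop).unop = c k j)
    (x : HC k n) : (g (g x).unop).unop = x := by
  let f : HC k n →ₐ[k] HC k n := AlgHom.ofLinearMap
    { toFun := fun x => (g (g x).unop).unop
      map_add' := by simp
      map_smul' := by simp } (by simp) (by simp)
  exact DFunLike.congr_fun (hom_ext (f := f) (g := AlgHom.id k _) hT hc) x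

theorem psiHom_invol (x : HC k n) : (psiHom k n (psiHom k n x).unop).unop = x := by
  refine anti_hom_ext (fun i => ?_) (fun j => ?_) x
  · simp only [psiHom_T, MulOpposite.unop_op, map_add, map_mul, psiHom_c, MulOpposite.unop_add,
      MulOpposite.unop_mul, neg_mul_neg]
    rw [(hcRels k).c_anti _ _ (lo_ne_hi i)]
    abel
  · simp [psiHom_c]

theorem psiHom'_invol (x : HC k n) : (psiHom' k n (psiHom' k n x).unop).unop = x := by
  refine anti_hom_ext (fun i => ?_) (fun j => ?_) x
  · simp [psiHom'_T]
  · simp [psiHom'_c]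

variable (k n)

/-- The involution `φ`: `φ(T_i) = T_{n-i} + c_{n-i} c_{n+1-i}`, `φ(c_j) = -c_{n+1-j}`. -/
def phi : HC k n ≃ₐ[k] HC k n :=
  AlgEquiv.ofAlgHom (phiHom k n) (phiHom k n) phiHom_invol phiHom_invol

/-- The involution `φ'`: `φ'(T_i) = -(T_{n-i} + 1)`, `φ'(c_j) = -c_{n+1-j}`. -/
def phi' : HC k n ≃ₐ[k] HC k n :=
  AlgEquiv.ofAlgHom (phiHom' k n) (phiHom' k n) phiHom'_invol phiHom'_invol

/-- The unsigned anti-involution `ψ`: `ψ(T_i) = T_i + c_i c_{i+1}`, `ψ(c_j) = -c_j`. -/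
def psi : HC k n ≃ₐ[k] (HC k n)ᵐᵒᵖ := antiInvol (psiHom k n) psiHom_invol

/-- The unsigned anti-involution `ψ'`: `ψ'(T_i) = -(T_i + 1)`, `ψ'(c_j) = -c_j`. -/
def psi' : HC k n ≃ₐ[k] (HC k n)ᵐᵒᵖ := antiInvol (psiHom' k n) psiHom'_invol

theorem cc_mem (i j : Fin n) : c k i * c k j ∈ grading k n 0 := by
  have h := mul_mem_grading (c_mem (k := k) i) (c_mem j)
  rwa [show (1 : ZMod 2) + 1 = 0 by decide] at h

theorem phi_even : ∀ p, ∀ a ∈ grading k n p, phi k n a ∈ grading k n p :=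
  even_of_gens (f := (phiHom k n).toLinearMap) (by simp) (Or.inl (by simp))
    (fun i => by
      rw [AlgHom.toLinearMap_apply, phiHom_T]
      exact add_mem (T_mem _) (cc_mem k n _ _))
    (fun j => by
      rw [AlgHom.toLinearMap_apply, phiHom_c]
      exact neg_mem (c_mem _))

theorem phi'_even : ∀ p, ∀ a ∈ grading k n p, phi' k n a ∈ grading k n p :=
  even_of_gens (f := (phiHom' k n).toLinearMap) (by simp) (Or.inl (by simp))
    (fun i => by
      rw [AlgHom.toLinearMap_apply, phiHom'_T]
      exact neg_mem (add_mem (T_mem _) one_mem_grading))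
    (fun j => by
      rw [AlgHom.toLinearMap_apply, phiHom'_c]
      exact neg_mem (c_mem _))

theorem psi_even : ∀ p, ∀ a ∈ grading k n p, (psi k n a).unop ∈ grading k n p :=
  even_of_gens
    (f := (MulOpposite.opLinearEquiv k).symm.toLinearMap ∘ₗ (psiHom k n).toLinearMap)
    (by simp) (Or.inr (by simp))
    (fun i => by
      change (psiHom k n (T k i)).unop ∈ _
      rw [psiHom_T]
      exact add_mem (T_mem _) (cc_mem k n _ _))
    (fun j => by
      change (psiHom k n (c k j)).unop ∈ _
      rw [psiHom_c]
      exact neg_mem (c_mem _))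

theorem psi'_even : ∀ p, ∀ a ∈ grading k n p, (psi' k n a).unop ∈ grading k n p :=
  even_of_gens
    (f := (MulOpposite.opLinearEquiv k).symm.toLinearMap ∘ₗ (psiHom' k n).toLinearMap)
    (by simp) (Or.inr (by simp))
    (fun i => by
      change (psiHom' k n (T k i)).unop ∈ _
      rw [psiHom'_T]
      exact neg_mem (add_mem (T_mem _) one_mem_grading))
    (fun j => by
      change (psiHom' k n (c k j)).unop ∈ _
      rw [psiHom'_c]
      exact neg_mem (c_mem _))

variable {n}

/-- `c_D`, the product of the `c j`, `j ∈ D`, in increasing order. -/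
def cD (D : Finset (Fin n)) : HC k n := ((D.sort (· ≤ ·)).map (c k)).prod

/-! ### The supermodules `S̃_α` and the simple supermodules -/

/-- The scalar by which `T_i` acts on `S_α`: `-1` if `i ∈ D(α)`, and `0` otherwise. -/
def weight (α : Composition n) (i : Fin (n - 1)) : k :=
  if (i : ℕ) + 1 ∈ descentSet α then -1 else 0

/-- The simple `H_n(0)`-module `S_α = k η_α`, on the vector space `k` with `η_α = 1`. -/
def S (α : Composition n) : Hecke k n →ₐ[k] Module.End k k :=
  Hecke.lift (t := fun i => algebraMap k (Module.End k k) (weight k α i))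
    { sq := fun i => by
        rw [← map_mul, ← map_neg]
        congr 1
        unfold weight
        split_ifs <;> simp
      comm := fun i j _ => by rw [← map_mul, ← map_mul, mul_comm]
      braid := fun i j _ => by
        simp only [← map_mul]
        congr 1
        unfold weight
        split_ifs <;> simp }

theorem S_T (α : Composition n) (i : Fin (n - 1)) (x : k) :
    S k α (Hecke.T k i) x = if (i : ℕ) + 1 ∈ descentSet α then -x else 0 := by
  rw [S, Hecke.lift_T, Module.algebraMap_end_apply, weight]
  split_ifs <;> simp

theorem incl_parity (b : Hecke k n) : parity k n (incl k n b) = incl k n b := by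
  have : (parity k n).comp (incl k n) = incl k n := by
    apply RingQuot.ringQuot_ext'
    apply FreeAlgebra.hom_ext
    funext i
    have h : incl k n (Hecke.T k i) = T k i := Hecke.lift_T _ _
    change parity k n (incl k n (Hecke.T k i)) = incl k n (Hecke.T k i)
    rw [h, parity_T]
  exact DFunLike.congr_fun this b

/-- The supermodule `S̃_α = HCl_n(0) ⊗_{H_n(0)} S_α`, in which `a ⊗ m` has the degree of `a`. -/
def Stilde [CharZero k] (α : Composition n) : SuperModule (grading k n) where
  V := Ind (incl k n) (S k α)
  ρ := Ind.act (incl k n) (S k α)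
  gr p := Submodule.span k {v | ∃ a ∈ grading k n p, ∃ m : k, v = Ind.mk (incl k n) (S k α) a m}
  isCompl := by
    refine isCompl_of_involution
      (Ind.map (incl k n) (S k α) (parity k n).toLinearMap
        (fun a b => by
          rw [AlgHom.toLinearMap_apply, map_mul, incl_parity, AlgHom.toLinearMap_apply])) ?_ ?_ ?_
    · intro v hv
      induction hv using Submodule.span_induction with
      | mem x hx =>
        obtain ⟨a, ha, m, rfl⟩ := hx
        rw [Ind.map_mk, AlgHom.toLinearMap_apply, parity_of_mem ha]
        simp
      | zero => simp
      | add y z _ _ hy hz => rw [map_add, hy, hz]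
      | smul r y _ hy => rw [map_smul, hy]
    · intro v hv
      induction hv using Submodule.span_induction with
      | mem x hx =>
        obtain ⟨a, ha, m, rfl⟩ := hx
        rw [Ind.map_mk, AlgHom.toLinearMap_apply, parity_of_mem ha, Ind.mk_smul]
        simp [show (1 : ZMod 2).val = 1 from rfl]
      | zero => simp
      | add y z _ _ hy hz => rw [map_add, hy, hz, neg_add]
      | smul r y _ hy => rw [map_smul, hy, smul_neg]
    · rw [eq_top_iff]
      intro v _
      clear * -
      obtain ⟨x, rfl⟩ := Submodule.Quotient.mk_surjective _ v
      induction x using TensorProduct.induction_on with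
      | zero => exact zero_mem _
      | tmul a m =>
        have ha : a ∈ grading k n 0 ⊔ grading k n 1 := by rw [grading_sup]; trivial
        obtain ⟨a0, h0, a1, h1, rfl⟩ := Submodule.mem_sup.mp ha
        change Ind.mk (incl k n) (S k α) (a0 + a1) m ∈ _
        rw [Ind.mk_add]
        exact Submodule.add_mem_sup (Submodule.subset_span ⟨a0, h0, m, rfl⟩)
          (Submodule.subset_span ⟨a1, h1, m, rfl⟩)
      | add x y hx hy => exact add_mem hx hy
  act_mem := by
    intro p q a v ha hv
    induction hv using Submodule.span_induction with
    | mem x hx =>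
      obtain ⟨b, hb, m, rfl⟩ := hx
      exact Submodule.subset_span ⟨a * b, mul_mem_grading ha hb, m, rfl⟩
    | zero => simp
    | add y z _ _ hy hz => rw [map_add]; exact add_mem hy hz
    | smul r y _ hy => rw [map_smul]; exact Submodule.smul_mem _ _ hy

/-- The generator `η_α = 1 ⊗ η_α` of `S̃_α`. -/
def eta [CharZero k] (α : Composition n) : (Stilde k α).V := Ind.mk (incl k n) (S k α) 1 1

variable {k}

/-- `L` is the simple supermodule `HClS_P` labelled by the peak set `P`: it is irreducible and is
isomorphic, through a map of degree `0` or `1`, to a super submodule of `S̃_α` for a composition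
`α` of `n` with `P(α) = P`. -/
def IsHClS [CharZero k] (P : Finset ℕ) (L : SuperModule (grading k n)) : Prop :=
  L.IsSimple ∧ ∃ α : Composition n, peakSet α = P ∧
    ∃ (d : ZMod 2) (f : L.V →ₗ[k] (Stilde k α).V), SuperModule.IsMor L (Stilde k α) d f ∧
      Function.Injective f

end Algebras

end HCl

end

open HCl

noncomputable section

namespace HCl

section FermiAlgebra

variable {n : ℕ} {R : Type*} [Ring R]

/-! ### Clifford generators of both signs -/

/-- Clifford generators `a j`, `b j` with squares `-1` and `1`, together with `s j = -a j * b j`,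
presented through `b` and `s`. -/
structure FermiRels (b s : Fin n → R) : Prop where
  b_sq : ∀ i, b i * b i = 1
  s_sq : ∀ i, s i * s i = 1
  b_anti : ∀ i j, i ≠ j → b i * b j = -(b j * b i)
  s_comm : ∀ i j, s i * s j = s j * s i
  s_b_self : ∀ i, s i * b i = -(b i * s i)
  s_b : ∀ i j, i ≠ j → s i * b j = b j * s i

/-- The generators `a j = -(s j * b j)`. -/
def fermiA (b s : Fin n → R) (j : Fin n) : R := -(s j * b j)

/-- The elements `T_i` built from the `a j` and `s j`. -/
def fermiT (k : Type*) [Field k] [Algebra k R] (b s : Fin n → R) (d : Finset (Fin (n - 1)))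
    (i : Fin (n - 1)) : R :=
  if i ∈ d then
    -1 + (2⁻¹ : k) • ((1 - fermiA b s (lo i) * fermiA b s (hi i)) * (1 - s (lo i)))
  else -((2⁻¹ : k) • ((1 + fermiA b s (lo i) * fermiA b s (hi i)) * (1 - s (hi i))))

theorem ext_mul {x y z : R} (h : x * y = z) (w : R) : x * (y * w) = z * w := by
  rw [← mul_assoc, h]

theorem commute_mul_of_anti {x y z : R} (h1 : x * y = -(y * x))
    (h2 : x * z = -(z * x)) : Commute x (y * z) := by
  change _ = _
  rw [← mul_assoc, h1, neg_mul, mul_assoc, h2, mul_neg, neg_neg, mul_assoc]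

theorem ascent_relations {a c s : R} (ha : a * a = -1) (hc : c * c = -1) (hca : c * a = -(a * c))
    (hs : s * s = 1) (hsa : s * a = a * s) (hsc : s * c = -(c * s)) :
    ((1 + a * c) * (1 - s)) * ((1 + a * c) * (1 - s)) =
      (1 + a * c) * (1 - s) + (1 + a * c) * (1 - s) ∧
    ((1 + a * c) * (1 - s)) * a = c * ((1 + a * c) * (1 - s)) ∧
    ((1 + a * c) * (1 - s)) * c = a * ((1 + a * c) * (1 - s)) + (c - a) + (c - a) := by
  refine ⟨?_, ?_, ?_⟩ <;>
  · simp only [mul_add, add_mul, mul_sub, sub_mul, mul_assoc, hs, hsa, hsc, ha, hc, hca, ext_mul ha,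
      ext_mul hc, ext_mul hca, ext_mul hsa, ext_mul hsc, neg_mul, mul_neg, one_mul,
      mul_one, neg_neg]
    abel

theorem descent_relations {a c s : R} (ha : a * a = -1) (hc : c * c = -1) (hca : c * a = -(a * c))
    (hs : s * s = 1) (hsa : s * a = -(a * s)) (hsc : s * c = c * s) :
    ((1 - a * c) * (1 - s)) * ((1 - a * c) * (1 - s)) =
      (1 - a * c) * (1 - s) + (1 - a * c) * (1 - s) ∧
    ((1 - a * c) * (1 - s)) * a = c * ((1 - a * c) * (1 - s)) + (a - c) + (a - c) ∧
    ((1 - a * c) * (1 - s)) * c = a * ((1 - a * c) * (1 - s)) := by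
  refine ⟨?_, ?_, ?_⟩ <;>
  · simp only [mul_sub, sub_mul, mul_assoc, hs, hsa, hsc, ha, hc, hca, ext_mul ha,
      ext_mul hc, ext_mul hca, ext_mul hsa, ext_mul hsc, neg_mul, mul_neg, one_mul,
      mul_one, neg_neg]
    abel

theorem braid_defect_mul {t s a b c : R} (htt : t * t = -t) (hss : s * s = -s)
    (hta : t * a = b * t) (htb : t * b = a * t + a - b) (htc : t * c = c * t)
    (hsb : s * b = c * s) (hsc : s * c = b * s + b - c) (hsa : s * a = a * s) :
    (t * s * t - s * t * s) * a = c * (t * s * t - s * t * s) ∧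
    (t * s * t - s * t * s) * b = b * (t * s * t - s * t * s) ∧
    (t * s * t - s * t * s) * c = a * (t * s * t - s * t * s) := by
  refine ⟨?_, ?_, ?_⟩
  · simp only [mul_sub, sub_mul, mul_assoc, hta, hsa, ext_mul hta, ext_mul htc, ext_mul hsb]
  all_goals
    simp only [mul_add, add_mul, mul_sub, sub_mul, mul_assoc, htt, hss, htb, htc, hsb, hsc,
      hsa, ext_mul hta, ext_mul htb, ext_mul htc, ext_mul hsb, ext_mul hsc, ext_mul hsa, mul_neg]
    abel

variable {b s : Fin n → R}

namespace FermiRels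

theorem a_sq (H : FermiRels b s) (i : Fin n) : fermiA b s i * fermiA b s i = -1 := by
  rw [fermiA, neg_mul_neg]
  nth_rewrite 2 [H.s_b_self]
  rw [mul_neg, mul_assoc, ← mul_assoc (b i), H.b_sq, one_mul, H.s_sq]

theorem a_anti (H : FermiRels b s) {i j : Fin n} (hij : i ≠ j) :
    fermiA b s i * fermiA b s j = -(fermiA b s j * fermiA b s i) := by
  rw [fermiA, fermiA, neg_mul_neg, neg_mul_neg, mul_assoc, ← mul_assoc (b i),
    ← H.s_b j i hij.symm, mul_assoc (s j), H.b_anti i j hij, mul_neg, mul_neg, mul_assoc (s j),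
    ← mul_assoc (b j), ← H.s_b i j hij, mul_assoc (s i), ← mul_assoc, ← mul_assoc (s j),
    H.s_comm i j]

theorem s_a_self (H : FermiRels b s) (i : Fin n) : s i * fermiA b s i = -(fermiA b s i * s i) := by
  rw [fermiA, mul_neg, neg_mul, neg_neg, mul_assoc, ← neg_eq_iff_eq_neg.mpr (H.s_b_self i), mul_neg]

theorem s_a (H : FermiRels b s) {i j : Fin n} (hij : i ≠ j) :
    s i * fermiA b s j = fermiA b s j * s i := by
  rw [fermiA, mul_neg, neg_mul, mul_assoc, ← H.s_b i j hij, ← mul_assoc, ← mul_assoc, H.s_comm i j]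

theorem b_a (H : FermiRels b s) (i j : Fin n) : b i * fermiA b s j = -(fermiA b s j * b i) := by
  by_cases hij : i = j
  · subst hij
    rw [fermiA, mul_neg, neg_mul, neg_neg, ← mul_assoc, ← neg_eq_iff_eq_neg.mpr (H.s_b_self i),
      neg_mul, neg_neg]
  · rw [fermiA, mul_neg, neg_mul, neg_neg, ← mul_assoc, ← H.s_b j i (Ne.symm hij), mul_assoc,
      mul_assoc, H.b_anti i j hij, mul_neg, neg_neg]

variable {k : Type*} [Field k] [Algebra k R] {d : Finset (Fin (n - 1))}

theorem t_sq [CharZero k] (H : FermiRels b s) (i : Fin (n - 1)) :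
    fermiT k b s d i * fermiT k b s d i = -fermiT k b s d i := by
  have q := lo_ne_hi i
  by_cases h : i ∈ d
  · have := (descent_relations (H.a_sq (lo i)) (H.a_sq (hi i)) (H.a_anti q.symm) (H.s_sq (lo i))
      (H.s_a_self _) (H.s_a q)).1
    simp only [fermiT, if_pos h, mul_add, add_mul, smul_mul_assoc, mul_smul_comm, this]
    generalize (1 - fermiA b s (lo i) * fermiA b s (hi i)) * (1 - s (lo i)) = X
    simp only [neg_mul, one_mul, mul_neg, mul_one]
    module
  · have := (ascent_relations (H.a_sq (lo i)) (H.a_sq (hi i)) (H.a_anti q.symm) (H.s_sq (hi i))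
      (H.s_a q.symm) (H.s_a_self _)).1
    simp only [fermiT, if_neg h, neg_mul_neg, smul_mul_assoc, mul_smul_comm, this]
    module

theorem t_lo [CharZero k] (H : FermiRels b s) (i : Fin (n - 1)) :
    fermiT k b s d i * fermiA b s (lo i) = fermiA b s (hi i) * fermiT k b s d i := by
  have q := lo_ne_hi i
  by_cases h : i ∈ d
  · have := (descent_relations (H.a_sq (lo i)) (H.a_sq (hi i)) (H.a_anti q.symm) (H.s_sq (lo i))
      (H.s_a_self _) (H.s_a q)).2.1
    simp only [fermiT, if_pos h, mul_add, add_mul, smul_mul_assoc, mul_smul_comm, this]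
    simp only [neg_mul, one_mul, mul_neg, mul_one]
    module
  · have := (ascent_relations (H.a_sq (lo i)) (H.a_sq (hi i)) (H.a_anti q.symm) (H.s_sq (hi i))
      (H.s_a q.symm) (H.s_a_self _)).2.1
    simp only [fermiT, if_neg h, neg_mul, mul_neg, smul_mul_assoc, mul_smul_comm, this]

theorem t_hi [CharZero k] (H : FermiRels b s) (i : Fin (n - 1)) :
    (fermiT k b s d i + 1) * fermiA b s (hi i) = fermiA b s (lo i) * (fermiT k b s d i + 1) := by
  have q := lo_ne_hi i
  by_cases h : i ∈ d
  · have := (descent_relations (H.a_sq (lo i)) (H.a_sq (hi i)) (H.a_anti q.symm) (H.s_sq (lo i))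
      (H.s_a_self _) (H.s_a q)).2.2
    simp only [fermiT, if_pos h, neg_add_cancel_comm, smul_mul_assoc, mul_smul_comm, this]
  · have := (ascent_relations (H.a_sq (lo i)) (H.a_sq (hi i)) (H.a_anti q.symm) (H.s_sq (hi i))
      (H.s_a q.symm) (H.s_a_self _)).2.2
    rw [fermiT, if_neg h]
    generalize (1 + fermiA b s (lo i) * fermiA b s (hi i)) * (1 - s (hi i)) = X at *
    simp only [mul_add, add_mul, smul_mul_assoc, mul_smul_comm, this, neg_mul, mul_neg,
      one_mul, mul_one]
    module

/-- An element commuting with `a_i a_{i+1}`, `s_i` and `s_{i+1}` commutes with `T_i`. -/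
theorem commute_t {X : R} {i : Fin (n - 1)}
    (h : Commute X (fermiA b s (lo i) * fermiA b s (hi i))) (h1 : i ∈ d → Commute X (s (lo i)))
    (h2 : i ∉ d → Commute X (s (hi i))) : Commute X (fermiT k b s d i) := by
  unfold fermiT
  split_ifs with hd
  · exact (Commute.one_right _).neg_right.add_right ((((Commute.one_right _).sub_right h).mul_right
      ((Commute.one_right _).sub_right (h1 hd))).smul_right _)
  · exact ((((Commute.one_right _).add_right h).mul_right
      ((Commute.one_right _).sub_right (h2 hd))).smul_right _).neg_right

theorem t_a (H : FermiRels b s) (i : Fin (n - 1)) (j : Fin n) (hl : j ≠ lo i) (hh : j ≠ hi i) :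
    fermiT k b s d i * fermiA b s j = fermiA b s j * fermiT k b s d i :=
  (commute_t (commute_mul_of_anti (H.a_anti hl) (H.a_anti hh))
    (fun _ => (H.s_a hl.symm).symm) (fun _ => (H.s_a hh.symm).symm)).symm

theorem t_s (H : FermiRels b s) (i : Fin (n - 1)) (j : Fin n) (hl : j ≠ lo i) (hh : j ≠ hi i) :
    fermiT k b s d i * s j = s j * fermiT k b s d i :=
  (commute_t (Commute.mul_right (show Commute _ _ from H.s_a hl) (H.s_a hh))
    (fun _ => H.s_comm _ _) (fun _ => H.s_comm _ _)).symm

theorem t_b (H : FermiRels b s) (i : Fin (n - 1)) (j : Fin n) (hl : i ∈ d → lo i ≠ j)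
    (hh : i ∉ d → hi i ≠ j) : fermiT k b s d i * b j = b j * fermiT k b s d i :=
  (commute_t (commute_mul_of_anti (H.b_a _ _) (H.b_a _ _))
    (fun h => (H.s_b _ _ (hl h)).symm) (fun h => (H.s_b _ _ (hh h)).symm)).symm

theorem t_comm (H : FermiRels b s) (i j : Fin (n - 1)) (hij : (i : ℕ) + 1 < j) :
    fermiT k b s d i * fermiT k b s d j = fermiT k b s d j * fermiT k b s d i := by
  have q1 : lo j ≠ lo i := by simp [lo, Fin.ext_iff]; omega
  have q2 : lo j ≠ hi i := by simp [lo, hi, Fin.ext_iff]; omega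
  have q3 : hi j ≠ lo i := by simp [lo, hi, Fin.ext_iff]; omega
  have q4 : hi j ≠ hi i := by simp [hi, Fin.ext_iff]; omega
  exact commute_t (Commute.mul_right (show Commute _ _ from H.t_a _ _ q1 q2) (H.t_a _ _ q3 q4))
    (fun _ => H.t_s _ _ q1 q2) (fun _ => H.t_s _ _ q3 q4)

/-- The defect of the braid relation commutes with the `a j` up to a permutation of the indices. -/
theorem braid_defect [CharZero k] (H : FermiRels b s) (i j : Fin (n - 1)) (hij : (j : ℕ) = i + 1)
    (m : Fin n) : ∃ m', (fermiT k b s d i * fermiT k b s d j * fermiT k b s d i -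
      fermiT k b s d j * fermiT k b s d i * fermiT k b s d j) * fermiA b s m =
      fermiA b s m' * (fermiT k b s d i * fermiT k b s d j * fermiT k b s d i -
      fermiT k b s d j * fermiT k b s d i * fermiT k b s d j) := by
  have e : lo j = hi i := by simp [lo, hi, Fin.ext_iff]; omega
  have q1 : hi j ≠ lo i := by simp [lo, hi, Fin.ext_iff]; omega
  have q2 : hi j ≠ hi i := by simp [hi, Fin.ext_iff]; omega
  have thi : ∀ i, fermiT k b s d i * fermiA b s (hi i) =
      fermiA b s (lo i) * fermiT k b s d i + fermiA b s (lo i) - fermiA b s (hi i) := by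
    intro i
    have := H.t_hi (k := k) (d := d) i
    rw [add_mul, mul_add, one_mul, mul_one] at this
    rw [← this]; abel
  have b1 := thi j
  have b2 := H.t_lo (k := k) (d := d) j
  rw [e] at b1 b2
  obtain ⟨r1, r2, r3⟩ := braid_defect_mul (H.t_sq (k := k) (d := d) i) (H.t_sq j) (H.t_lo i)
    (thi i) (H.t_a i _ q1 q2) b2 b1 (H.t_a j _ (by rw [e]; exact lo_ne_hi i) q1.symm)
  by_cases m1 : m = lo i
  · exact ⟨_, m1 ▸ r1⟩
  by_cases m2 : m = hi i
  · exact ⟨_, m2 ▸ r2⟩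
  by_cases m3 : m = hi j
  · exact ⟨_, m3 ▸ r3⟩
  have c1 : Commute (fermiT k b s d i) (fermiA b s m) := H.t_a _ _ m1 m2
  have c2 : Commute (fermiT k b s d j) (fermiA b s m) := H.t_a _ _ (e ▸ m2) m3
  exact ⟨m, ((c1.mul_left c2).mul_left c1).sub_left ((c2.mul_left c1).mul_left c2)⟩

end FermiRels

end FermiAlgebra

/-! ### Operators on functions on the subsets of `Fin n` -/

section Fock

open scoped symmDiff

variable (k : Type u) [Field k] {n : ℕ}

/-- The space with basis indexed by the subsets of `Fin n`. -/
abbrev Fock (n : ℕ) : Type u := Finset (Fin n) → k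

/-- The sign `(-1)^{#{i ∈ E : i < j}}`. -/
def jwSign (j : Fin n) (E : Finset (Fin n)) : k := ∏ i, if i < j ∧ i ∈ E then -1 else 1

/-- The sign `-1` if `j ∈ E`, and `1` otherwise. -/
def occSign (j : Fin n) (E : Finset (Fin n)) : k := if j ∈ E then -1 else 1

theorem jwSign_toggle {i j : Fin n} (E : Finset (Fin n)) :
    jwSign k j (E ∆ {i}) = if i < j then -jwSign k j E else jwSign k j E := by
  have key : ∀ x, (if x < j ∧ x ∈ E ∆ {i} then (-1 : k) else 1) =
      (if x < j ∧ x ∈ E then (-1 : k) else 1) * (if x = i then (if i < j then -1 else 1) else 1) := by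
    intro x
    by_cases hx : x = i
    · subst hx
      by_cases h1 : x < j <;> by_cases h2 : x ∈ E <;> simp [h1, h2, Finset.mem_symmDiff]
    · simp [hx, Finset.mem_symmDiff]
  rw [jwSign, Finset.prod_congr rfl (fun x _ => key x), Finset.prod_mul_distrib,
    Finset.prod_ite_eq' Finset.univ i]
  simp only [Finset.mem_univ, if_true, jwSign]
  split_ifs <;> simp

theorem occSign_toggle {i j : Fin n} (E : Finset (Fin n)) :
    occSign k j (E ∆ {i}) = if i = j then -occSign k j E else occSign k j E := by
  by_cases hx : i = j
  · subst hx
    by_cases h2 : i ∈ E <;> simp [occSign, h2, Finset.mem_symmDiff]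
  · simp [hx, occSign, Finset.mem_symmDiff, Ne.symm hx]

theorem jwSign_mul_self (j : Fin n) (E : Finset (Fin n)) : jwSign k j E * jwSign k j E = 1 := by
  rw [jwSign, ← Finset.prod_mul_distrib]
  refine Finset.prod_eq_one fun i _ => ?_
  split_ifs <;> simp

theorem occSign_mul_self (j : Fin n) (E : Finset (Fin n)) : occSign k j E * occSign k j E = 1 := by
  unfold occSign
  split_ifs <;> simp

/-- The operator `x ↦ (-1)^{|x|} x c_j`. -/
def bOp (j : Fin n) : Module.End k (Fock k n) where
  toFun f E := jwSign k j E * f (E ∆ {j})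
  map_add' f g := by ext E; simp [mul_add]
  map_smul' r f := by ext E; simp [mul_left_comm]

/-- The operator with `x ↦ x` and `x c_j ↦ -x c_j` for the `x` that do not involve `c_j`. -/
def sOp (j : Fin n) : Module.End k (Fock k n) where
  toFun f E := occSign k j E * f E
  map_add' f g := by ext E; simp [mul_add]
  map_smul' r f := by ext E; simp [mul_left_comm]

/-- The operator `x ↦ c_j x`. -/
def aOp (j : Fin n) : Module.End k (Fock k n) := fermiA (bOp k) (sOp k) j

theorem sOp_apply (j : Fin n) (f : Fock k n) (E : Finset (Fin n)) :
    sOp k j f E = occSign k j E * f E := rfl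

theorem aOp_apply (j : Fin n) (f : Fock k n) (E : Finset (Fin n)) :
    aOp k j f E = -(occSign k j E * (jwSign k j E * f (E ∆ {j}))) := rfl

theorem symmDiff_toggle_comm (E : Finset (Fin n)) (i j : Fin n) :
    E ∆ {i} ∆ {j} = E ∆ {j} ∆ {i} := by
  rw [symmDiff_assoc, symmDiff_comm ({i} : Finset (Fin n)), ← symmDiff_assoc]

theorem fermiRels : FermiRels (bOp k (n := n)) (sOp k) where
  b_sq i := by
    refine LinearMap.ext fun f => funext fun E => ?_
    change jwSign k i E * (jwSign k i (E ∆ {i}) * f (E ∆ {i} ∆ {i})) = f E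
    rw [symmDiff_assoc, symmDiff_self, symmDiff_bot, jwSign_toggle, if_neg (lt_irrefl _),
      ← mul_assoc, jwSign_mul_self, one_mul]
  s_sq i := by
    refine LinearMap.ext fun f => funext fun E => ?_
    change occSign k i E * (occSign k i E * f E) = f E
    rw [← mul_assoc, occSign_mul_self, one_mul]
  b_anti i j hij := by
    refine LinearMap.ext fun f => funext fun E => ?_
    change jwSign k i E * (jwSign k j (E ∆ {i}) * f (E ∆ {i} ∆ {j})) =
      -(jwSign k j E * (jwSign k i (E ∆ {j}) * f (E ∆ {j} ∆ {i})))
    rw [jwSign_toggle, jwSign_toggle, symmDiff_toggle_comm]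
    rcases lt_or_gt_of_ne hij with h | h
    · rw [if_pos h, if_neg h.not_gt]; ring
    · rw [if_pos h, if_neg h.not_gt]; ring
  s_comm i j := by
    refine LinearMap.ext fun f => funext fun E => ?_
    change occSign k i E * (occSign k j E * f E) = occSign k j E * (occSign k i E * f E)
    ring
  s_b_self i := by
    refine LinearMap.ext fun f => funext fun E => ?_
    change occSign k i E * (jwSign k i E * f (E ∆ {i})) =
      -(jwSign k i E * (occSign k i (E ∆ {i}) * f (E ∆ {i})))
    rw [occSign_toggle, if_pos rfl]; ring
  s_b i j hij := by
    refine LinearMap.ext fun f => funext fun E => ?_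
    change occSign k i E * (jwSign k j E * f (E ∆ {j})) =
      jwSign k j E * (occSign k i (E ∆ {j}) * f (E ∆ {j}))
    rw [occSign_toggle, if_neg hij.symm]; ring

end Fock

section Model

variable {k : Type u} [Field k] {n : ℕ} {d : Finset (Fin (n - 1))}

variable (k) in
/-- The operator of `T_i` on the Fock space, for the module on which the `T_i` with `i ∈ d` act on
the vacuum by `-1`, and the others by `0`. -/
def tOp (d : Finset (Fin (n - 1))) (i : Fin (n - 1)) : Module.End k (Fock k n) :=
  fermiT k (bOp k) (sOp k) d i

theorem tOp_apply_of_mem {i : Fin (n - 1)} (h : i ∈ d) (f : Fock k n) : tOp k d i f = -f +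
    (2⁻¹ : k) • ((f - sOp k (lo i) f) - aOp k (lo i) (aOp k (hi i) (f - sOp k (lo i) f))) := by
  rw [tOp, fermiT, if_pos h]; rfl

theorem tOp_apply_of_notMem {i : Fin (n - 1)} (h : i ∉ d) (f : Fock k n) : tOp k d i f =
    -((2⁻¹ : k) • ((f - sOp k (hi i) f) + aOp k (lo i) (aOp k (hi i) (f - sOp k (hi i) f)))) := by
  rw [tOp, fermiT, if_neg h]; rfl

/-- The vacuum vector. -/
def vac (k : Type u) [Field k] (n : ℕ) : Fock k n := Pi.single ∅ 1

theorem sOp_vac (j : Fin n) : sOp k j (vac k n) = vac k n := by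
  funext E
  rw [sOp_apply, vac]
  by_cases h : E = ∅
  · subst h; simp [occSign]
  · simp [h]

theorem tOp_vac (i : Fin (n - 1)) : tOp k d i (vac k n) = if i ∈ d then -vac k n else 0 := by
  split_ifs with h
  · simp [tOp_apply_of_mem h, sOp_vac]
  · simp [tOp_apply_of_notMem h, sOp_vac]

theorem aOp_single {j : Fin n} {E : Finset (Fin n)} (h : ∀ i ∈ E, j < i) :
    aOp k j (Pi.single E 1) = Pi.single (insert j E) 1 := by
  have hj : j ∉ E := fun hj => lt_irrefl _ (h j hj)
  funext F
  rw [aOp_apply]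
  by_cases hF : F = insert j E
  · subst hF
    have e : symmDiff (insert j E) {j} = E := by
      ext x
      simp only [Finset.mem_symmDiff, Finset.mem_insert, Finset.mem_singleton]
      by_cases hx : x = j
      · subst hx; simp [hj]
      · simp [hx]
    have e2 : jwSign k j (insert j E) = 1 := by
      refine Finset.prod_eq_one fun i _ => if_neg ?_
      rintro ⟨h1, h2⟩
      rcases Finset.mem_insert.mp h2 with rfl | h2
      · exact lt_irrefl _ h1
      · exact lt_asymm h1 (h i h2)
    rw [e, e2]
    simp [occSign]
  · have : symmDiff F {j} ≠ E := by
      rintro rfl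
      apply hF
      have hj' : j ∈ F := by
        by_contra hj'
        exact hj (by simp [Finset.mem_symmDiff, hj'])
      ext x
      simp only [Finset.mem_symmDiff, Finset.mem_insert, Finset.mem_singleton]
      by_cases hx : x = j
      · subst hx; simp [hj']
      · simp [hx]
    simp [hF, this]

theorem list_aOp_vac (l : List (Fin n)) (hl : l.Pairwise (· < ·)) :
    (l.map (aOp k)).prod (vac k n) = Pi.single l.toFinset 1 := by
  induction l with
  | nil => rfl
  | cons j l ih =>
    rw [List.pairwise_cons] at hl
    rw [List.map_cons, List.prod_cons, Module.End.mul_apply, ih hl.2, aOp_single, List.toFinset_cons]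
    intro i hi
    exact hl.1 i (List.mem_toFinset.mp hi)

theorem sort_aOp_vac (D : Finset (Fin n)) :
    ((D.sort (· ≤ ·)).map (aOp k)).prod (vac k n) = Pi.single D 1 := by
  rw [list_aOp_vac _ D.sortedLT_sort.pairwise, Finset.sort_toFinset]

theorem Fock.hom_ext {N : Type*} [AddCommGroup N] [Module k N] {g h : Fock k n →ₗ[k] N}
    (H : ∀ l : List (Fin n), g ((l.map (aOp k)).prod (vac k n)) = h ((l.map (aOp k)).prod (vac k n))) :
    g = h := by
  refine (Pi.basisFun k (Finset (Fin n))).ext fun D => ?_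
  rw [Pi.basisFun_apply, ← sort_aOp_vac]
  exact H _

variable [CharZero k]

theorem tOp_braid (i j : Fin (n - 1)) (hij : (j : ℕ) = i + 1) :
    tOp k d i * tOp k d j * tOp k d i = tOp k d j * tOp k d i * tOp k d j := by
  rw [← sub_eq_zero]
  refine Fock.hom_ext fun l => ?_
  induction l with
  | nil =>
    change tOp k d i (tOp k d j (tOp k d i (vac k n))) -
      tOp k d j (tOp k d i (tOp k d j (vac k n))) = 0
    rw [tOp_vac, tOp_vac]
    by_cases h1 : i ∈ d <;> by_cases h2 : j ∈ d <;> simp [h1, h2, tOp_vac]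
  | cons m l ih =>
    obtain ⟨m', hm⟩ := (fermiRels k).braid_defect (k := k) (d := d) i j hij m
    refine (LinearMap.congr_fun hm ((l.map (aOp k)).prod (vac k n))).trans ?_
    refine (congrArg (aOp k m') ih).trans ?_
    exact map_zero _

theorem modelRels (d : Finset (Fin (n - 1))) : HCRels lo hi (tOp k d) (aOp k) where
  sq := (fermiRels k).t_sq
  comm := (fermiRels k).t_comm
  braid := tOp_braid
  c_sq := (fermiRels k).a_sq
  c_anti _ _ h := (fermiRels k).a_anti h
  t_c := (fermiRels k).t_a
  t_l := (fermiRels k).t_lo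
  t_h := (fermiRels k).t_hi

variable (k) in
/-- The representation of `HCl_n(0)` on the Fock space. -/
def model (d : Finset (Fin (n - 1))) : HC k n →ₐ[k] Module.End k (Fock k n) := lift (modelRels d)

@[simp] theorem model_T (i : Fin (n - 1)) : model k d (T k i) = tOp k d i := lift_T _ _

@[simp] theorem model_c (j : Fin n) : model k d (c k j) = aOp k j := lift_c _ _

theorem model_cD_vac (D : Finset (Fin n)) : model k d (cD k D) (vac k n) = Pi.single D 1 := by
  rw [cD, map_list_prod, List.map_map, ← sort_aOp_vac]
  congr 3
  funext j
  simp

end Model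

section Structure

variable {k : Type u} [Field k] {n : ℕ}

theorem incl_T (i : Fin (n - 1)) : incl k n (Hecke.T k i) = T k i := Hecke.lift_T _ _

/-- The set of the `i` for which `T_i` acts on `S_α` by `-1`. -/
def desc (α : Composition n) : Finset (Fin (n - 1)) :=
  Finset.univ.filter fun i => (i : ℕ) + 1 ∈ descentSet α

theorem weight_eq (α : Composition n) (i : Fin (n - 1)) :
    weight k α i = if i ∈ desc α then -1 else 0 := by
  simp [weight, desc]

/-- A subspace stable under the generators is stable under `HCl_n(0)`. -/
theorem stable_of_gens {N : Type*} [AddCommGroup N] [Module k N] (τ : HC k n →ₐ[k] Module.End k N)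
    {W : Submodule k N} (hT : ∀ i, ∀ w ∈ W, τ (T k i) w ∈ W) (hc : ∀ j, ∀ w ∈ W, τ (c k j) w ∈ W)
    (a : HC k n) : ∀ w ∈ W, τ a w ∈ W := by
  obtain ⟨y, rfl⟩ := RingQuot.mkAlgHom_surjective k (HCRel k n) a
  change ∀ w ∈ W, τ (HC.mk k n y) w ∈ W
  induction y using FreeAlgebra.induction with
  | grade0 r =>
    intro w hw
    rw [AlgHom.commutes, AlgHom.commutes]
    exact W.smul_mem r hw
  | grade1 x =>
    cases x with
    | inl i => exact hT i
    | inr j => exact hc j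
  | mul a b ha hb =>
    intro w hw
    rw [map_mul, map_mul]
    exact ha _ (hb _ hw)
  | add a b ha hb =>
    intro w hw
    rw [map_add, map_add]
    exact W.add_mem (ha _ hw) (hb _ hw)

section Lift

variable {N : Type*} [AddCommGroup N] [Module k N] (τ : HC k n →ₐ[k] Module.End k N)
  {α : Composition n} (u : N)

theorem incl_act_eq_smul (h : ∀ i, τ (T k i) u = weight k α i • u) (b : Hecke k n) :
    τ (incl k n b) u = (S k α b 1) • u := by
  obtain ⟨y, rfl⟩ := RingQuot.mkAlgHom_surjective k (HeckeRel k n) b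
  change τ (incl k n (Hecke.mk k n y)) u = S k α (Hecke.mk k n y) 1 • u
  induction y using FreeAlgebra.induction with
  | grade0 r =>
    simp [AlgHom.commutes, Module.algebraMap_end_apply]
  | grade1 i =>
    change τ (incl k n (Hecke.T k i)) u = S k α (Hecke.T k i) 1 • u
    rw [incl_T, h, S_T, weight]
  | mul a b ha hb =>
    simp only [map_mul, Module.End.mul_apply]
    rw [hb, map_smul, ha, smul_smul]
    congr 1
    generalize S k α (Hecke.mk k n b) 1 = x
    rw [← smul_eq_mul, ← map_smul, smul_eq_mul, mul_one]
  | add a b ha hb =>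
    simp only [map_add, LinearMap.add_apply, ha, hb, add_smul]

/-- The linear map `a ⊗ m ↦ m τ(a) u` on `HCl_n(0) ⊗_{H_n(0)} S_α`, for a vector `u` of weight
`α`. -/
def indLift (h : ∀ i, τ (T k i) u = weight k α i • u) : Ind (incl k n) (S k α) →ₗ[k] N :=
  Submodule.liftQ _ (TensorProduct.lift (LinearMap.mk₂ k (fun a m => m • τ a u)
    (fun a b m => by simp) (fun r a m => by simp [smul_comm r m]) (fun a m m' => add_smul _ _ _)
    (fun r a m => by rw [smul_assoc]))) (by
      rw [balancing, Submodule.span_le]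
      rintro _ ⟨a, b, m, rfl⟩
      rw [SetLike.mem_coe, LinearMap.mem_ker, map_sub, TensorProduct.lift.tmul,
        TensorProduct.lift.tmul, LinearMap.mk₂_apply, LinearMap.mk₂_apply, map_mul,
        Module.End.mul_apply, incl_act_eq_smul τ u h, map_smul, smul_smul, sub_eq_zero]
      congr 1
      rw [← smul_eq_mul, ← map_smul, smul_eq_mul, mul_one])

theorem indLift_mk (h : ∀ i, τ (T k i) u = weight k α i • u) (a : HC k n) (m : k) :
    indLift τ u h (Ind.mk (incl k n) (S k α) a m) = m • τ a u := rfl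

end Lift

theorem c_mul_sorted (j : Fin n) (l : List (Fin n)) (hl : l.Pairwise (· < ·)) :
    ∃ l' : List (Fin n), l'.Pairwise (· < ·) ∧ (∀ x ∈ l', x = j ∨ x ∈ l) ∧
      ∃ r : k, c k j * (l.map (c k)).prod = r • (l'.map (c k)).prod := by
  induction l with
  | nil => exact ⟨[j], by simp, by simp, 1, by simp⟩
  | cons m l ih =>
    rw [List.pairwise_cons] at hl
    rcases lt_trichotomy j m with h | h | h
    · refine ⟨j :: m :: l, ?_, by simp, 1, by simp⟩
      refine List.pairwise_cons.mpr ⟨?_, List.pairwise_cons.mpr hl⟩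
      intro x hx
      rcases List.mem_cons.mp hx with rfl | hx
      · exact h
      · exact h.trans (hl.1 x hx)
    · subst h
      refine ⟨l, hl.2, fun x hx => Or.inr (List.mem_cons_of_mem _ hx), -1, ?_⟩
      rw [List.map_cons, List.prod_cons, ← mul_assoc, (hcRels k).c_sq]
      simp
    · obtain ⟨l', h1, h2, r, h3⟩ := ih hl.2
      refine ⟨m :: l', List.pairwise_cons.mpr ⟨?_, h1⟩, ?_, -r, ?_⟩
      · intro x hx
        rcases h2 x hx with rfl | hx
        · exact h
        · exact hl.1 x hx
      · intro x hx
        rcases List.mem_cons.mp hx with rfl | hx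
        · simp
        · rcases h2 x hx with rfl | hx <;> simp [*]
      · rw [List.map_cons, List.prod_cons, ← mul_assoc, (hcRels k).c_anti _ _ h.ne', neg_mul,
          mul_assoc, h3, List.map_cons, List.prod_cons, mul_smul_comm, neg_smul]

theorem c_mul_cD (j : Fin n) (D : Finset (Fin n)) : ∃ (D' : Finset (Fin n)) (r : k),
    c k j * cD k D = r • cD k D' := by
  obtain ⟨l', h1, -, r, h3⟩ := c_mul_sorted (k := k) j (D.sort (· ≤ ·)) D.sortedLT_sort.pairwise
  refine ⟨l'.toFinset, r, ?_⟩
  rw [cD, cD, h3, (List.toFinset_sort (· ≤ ·) (h1.imp ne_of_lt)).mpr (h1.imp le_of_lt)]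

theorem isUnit_c (j : Fin n) : IsUnit (c k j) :=
  ⟨⟨c k j, -c k j, by simp [(hcRels k).c_sq], by simp [(hcRels k).c_sq]⟩, rfl⟩

theorem isUnit_cD (D : Finset (Fin n)) : IsUnit (cD k D) := by
  rw [cD]
  generalize D.sort (· ≤ ·) = l
  induction l with
  | nil => simp
  | cons m l ih =>
    rw [List.map_cons, List.prod_cons]
    exact (isUnit_c m).mul ih

theorem cD_mem (D : Finset (Fin n)) : cD k D ∈ grading k n (D.card : ZMod 2) := by
  rw [cD, ← Finset.length_sort (· ≤ ·) (s := D)]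
  generalize D.sort (· ≤ ·) = l
  induction l with
  | nil => simpa using one_mem_grading
  | cons m l ih =>
    rw [List.map_cons, List.prod_cons, List.length_cons, Nat.cast_succ, add_comm]
    exact mul_mem_grading (c_mem m) ih

variable [CharZero k]

theorem mk_eq_smul (α : Composition n) (a : HC k n) (m : k) :
    Ind.mk (incl k n) (S k α) a m = m • (Stilde k α).ρ a (eta k α) := by
  change Ind.mk (incl k n) (S k α) a m = m • Ind.mk (incl k n) (S k α) (a * 1) 1
  rw [mul_one, Ind.mk, Ind.mk, ← Submodule.Quotient.mk_smul, ← TensorProduct.tmul_smul,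
    smul_eq_mul, mul_one]

theorem T_eta (α : Composition n) (i : Fin (n - 1)) :
    (Stilde k α).ρ (T k i) (eta k α) = weight k α i • eta k α := by
  change Ind.mk (incl k n) (S k α) (T k i * 1) 1 = weight k α i • Ind.mk (incl k n) (S k α) 1 1
  have h : Ind.mk (incl k n) (S k α) (1 * incl k n (Hecke.T k i)) 1 =
      Ind.mk (incl k n) (S k α) 1 (S k α (Hecke.T k i) 1) :=
    (Submodule.Quotient.eq _).mpr (Submodule.subset_span ⟨1, Hecke.T k i, 1, rfl⟩)
  rw [incl_T, one_mul] at h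
  rw [mul_one, h, S_T, mk_eq_smul, map_one, weight]
  rfl

theorem Stilde.hom_ext {α : Composition n} {N : Type*} [AddCommGroup N] [Module k N]
    {g h : (Stilde k α).V →ₗ[k] N}
    (H : ∀ a, g ((Stilde k α).ρ a (eta k α)) = h ((Stilde k α).ρ a (eta k α))) : g = h := by
  refine Ind.hom_ext fun a m => ?_
  rw [mk_eq_smul]
  exact (map_smul g _ _).trans ((congrArg _ (H a)).trans (map_smul h _ _).symm)

theorem T_cD_eta_mem (α : Composition n) {W : Submodule k (Stilde k α).V}
    (hη : eta k α ∈ W) (hc : ∀ j, ∀ w ∈ W, (Stilde k α).ρ (c k j) w ∈ W) (i : Fin (n - 1))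
    (l : List (Fin n)) : (Stilde k α).ρ (T k i * (l.map (c k)).prod) (eta k α) ∈ W := by
  have hw : ∀ l : List (Fin n), (Stilde k α).ρ ((l.map (c k)).prod) (eta k α) ∈ W := by
    intro l
    induction l with
    | nil => simpa using hη
    | cons m l ih =>
      rw [List.map_cons, List.prod_cons, map_mul]
      exact hc _ _ ih
  induction l with
  | nil =>
    rw [List.map_nil, List.prod_nil, mul_one, T_eta]
    exact W.smul_mem _ hη
  | cons m l ih =>
    rw [List.map_cons, List.prod_cons, ← mul_assoc]
    by_cases m1 : m = lo i
    · rw [m1, (hcRels k).t_l, mul_assoc, map_mul]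
      exact hc _ _ ih
    by_cases m2 : m = hi i
    · rw [m2, (hcRels k).t_h', sub_mul, add_mul, mul_assoc, map_sub, map_add, map_mul,
        map_mul _ (c k _), map_mul _ (c k _)]
      exact W.sub_mem (W.add_mem (hc _ _ ih) (hc _ _ (hw l))) (hc _ _ (hw l))
    · rw [(hcRels k).t_c i m m1 m2, mul_assoc, map_mul]
      exact hc _ _ ih

theorem span_cD_eta (α : Composition n) :
    Submodule.span k (Set.range fun D => (Stilde k α).ρ (cD k D) (eta k α)) = ⊤ := by
  set W := Submodule.span k (Set.range fun D => (Stilde k α).ρ (cD k D) (eta k α)) with hW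
  have hη : eta k α ∈ W := Submodule.subset_span ⟨∅, by simp [cD]⟩
  have hc : ∀ j, ∀ w ∈ W, (Stilde k α).ρ (c k j) w ∈ W := by
    intro j w hw
    induction hw using Submodule.span_induction with
    | mem x hx =>
      obtain ⟨D, rfl⟩ := hx
      obtain ⟨D', r, h⟩ := c_mul_cD (k := k) j D
      change ((Stilde k α).ρ (c k j) * (Stilde k α).ρ (cD k D)) (eta k α) ∈ W
      rw [← map_mul, h, map_smul]
      exact W.smul_mem _ (Submodule.subset_span ⟨D', rfl⟩)
    | zero => rw [map_zero]; exact zero_mem _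
    | add y z _ _ hy hz => rw [map_add]; exact add_mem hy hz
    | smul r y _ hy => rw [map_smul]; exact W.smul_mem _ hy
  have hT : ∀ i, ∀ w ∈ W, (Stilde k α).ρ (T k i) w ∈ W := by
    intro i w hw
    induction hw using Submodule.span_induction with
    | mem x hx =>
      obtain ⟨D, rfl⟩ := hx
      change ((Stilde k α).ρ (T k i) * (Stilde k α).ρ (cD k D)) (eta k α) ∈ W
      rw [← map_mul]
      exact T_cD_eta_mem α hη hc i _
    | zero => rw [map_zero]; exact zero_mem _
    | add y z _ _ hy hz => rw [map_add]; exact add_mem hy hz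
    | smul r y _ hy => rw [map_smul]; exact W.smul_mem _ hy
  have h0 : W.mkQ = 0 := Stilde.hom_ext fun a => by
    simpa using stable_of_gens (Stilde k α).ρ hT hc a _ hη
  rw [← Submodule.ker_mkQ W, h0, LinearMap.ker_zero]

/-- The map from `S̃_α` to the Fock space. -/
def toFock (α : Composition n) : (Stilde k α).V →ₗ[k] Fock k n :=
  indLift (model k (desc α)) (vac k n) (fun i => by
    rw [model_T, tOp_vac, weight_eq]; split_ifs <;> simp)

theorem toFock_act_eta (α : Composition n) (a : HC k n) :
    toFock α ((Stilde k α).ρ a (eta k α)) = model k (desc α) a (vac k n) := by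
  change indLift (model k (desc α)) (vac k n) _ (Ind.mk (incl k n) (S k α) (a * 1) 1) = _
  rw [indLift_mk, mul_one, one_smul]

theorem toFock_eta (α : Composition n) : toFock α (eta k α) = vac k n := by
  simpa using toFock_act_eta α (1 : HC k n)

theorem toFock_act (α : Composition n) (a : HC k n) (v : (Stilde k α).V) :
    toFock α ((Stilde k α).ρ a v) = model k (desc α) a (toFock α v) := by
  have : toFock α ∘ₗ (Stilde k α).ρ a = model k (desc α) a ∘ₗ toFock α := by
    refine Stilde.hom_ext fun b => ?_
    rw [LinearMap.comp_apply, LinearMap.comp_apply, toFock_act_eta, ← Module.End.mul_apply,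
      ← Module.End.mul_apply, ← map_mul, ← map_mul, toFock_act_eta]
  exact LinearMap.congr_fun this v

theorem toFock_bijective (α : Composition n) : Function.Bijective (toFock (k := k) α) := by
  let g : Fock k n →ₗ[k] (Stilde k α).V :=
    (Pi.basisFun k (Finset (Fin n))).constr k fun D => (Stilde k α).ρ (cD k D) (eta k α)
  have hg : ∀ D, g (Pi.single D 1) = (Stilde k α).ρ (cD k D) (eta k α) := fun D => by
    rw [← Pi.basisFun_apply]; exact Module.Basis.constr_basis _ _ _ _
  have h1 : toFock α ∘ₗ g = LinearMap.id := by
    refine (Pi.basisFun k (Finset (Fin n))).ext fun D => ?_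
    rw [Pi.basisFun_apply, LinearMap.comp_apply, hg, toFock_act_eta, model_cD_vac]
    rfl
  have h2 : Function.Surjective g := by
    rw [← LinearMap.range_eq_top, eq_top_iff, ← span_cD_eta, Submodule.span_le]
    rintro _ ⟨D, rfl⟩
    exact ⟨_, hg D⟩
  have h3 : ∀ f, toFock α (g f) = f := fun f => LinearMap.congr_fun h1 f
  refine ⟨fun x y hxy => ?_, fun f => ⟨g f, h3 f⟩⟩
  obtain ⟨x, rfl⟩ := h2 x
  obtain ⟨y, rfl⟩ := h2 y
  rw [h3, h3] at hxy
  rw [hxy]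

variable (k) in
/-- `S̃_α` is the Fock space. -/
def fockEquiv (α : Composition n) : (Stilde k α).V ≃ₗ[k] Fock k n :=
  LinearEquiv.ofBijective (toFock α) (toFock_bijective α)

theorem fockEquiv_act (α : Composition n) (a : HC k n) (v : (Stilde k α).V) :
    fockEquiv k α ((Stilde k α).ρ a v) = model k (desc α) a (fockEquiv k α v) := toFock_act α a v

theorem fockEquiv_eta (α : Composition n) : fockEquiv k α (eta k α) = vac k n := toFock_eta α

variable (k) in
/-- The basis `c_D η_α` of `S̃_α`. -/
def cBasis (α : Composition n) : Module.Basis (Finset (Fin n)) k (Stilde k α).V :=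
  (Pi.basisFun k (Finset (Fin n))).map (fockEquiv k α).symm

theorem cBasis_apply (α : Composition n) (D : Finset (Fin n)) :
    cBasis k α D = (Stilde k α).ρ (cD k D) (eta k α) := by
  rw [cBasis, Module.Basis.map_apply, LinearEquiv.symm_apply_eq, fockEquiv_act, fockEquiv_eta,
    model_cD_vac, Pi.basisFun_apply]

theorem cBasis_coord (α : Composition n) (D : Finset (Fin n)) (v : (Stilde k α).V) :
    (cBasis k α).coord D v = fockEquiv k α v D := by
  simp [cBasis]

instance finite_Stilde (α : Composition n) : Module.Finite k (Stilde k α).V :=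
  Module.Finite.of_basis (cBasis k α)

theorem finrank_Stilde (α : Composition n) : Module.finrank k (Stilde k α).V = 2 ^ n := by
  rw [(fockEquiv k α).finrank_eq]
  simp

end Structure

section Homs

open scoped symmDiff

variable {k : Type u} [Field k] {n : ℕ}

variable (k) in
/-- The automorphism `a ↦ (-1)^{d |a|} a`. -/
def signTwist (d : ZMod 2) : HC k n →ₐ[k] HC k n := if d = 0 then AlgHom.id k _ else parity k n

theorem signTwist_of_mem {d p : ZMod 2} {a : HC k n} (ha : a ∈ grading k n p) :
    signTwist k d a = (-1 : k) ^ (d.val * p.val) • a := by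
  by_cases hd : d = 0
  · simp [signTwist, hd]
  · have : d = 1 := by revert hd; revert d; decide
    subst this
    rw [signTwist, if_neg hd, parity_of_mem ha, show (1 : ZMod 2).val = 1 from rfl, one_mul]

theorem signTwist_T (d : ZMod 2) (i : Fin (n - 1)) : signTwist k d (T k i) = T k i := by
  unfold signTwist; split_ifs <;> simp

theorem signTwist_signTwist (d : ZMod 2) (a : HC k n) : signTwist k d (signTwist k d a) = a := by
  have : (signTwist k d).comp (signTwist k d) = AlgHom.id k (HC k n) := by
    unfold signTwist
    split_ifs
    · rfl
    · exact hom_ext (by simp) (by simp)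
  exact DFunLike.congr_fun this a

variable [CharZero k]

theorem eta_mem (α : Composition n) : eta k α ∈ (Stilde k α).gr 0 := by
  change Ind.mk (incl k n) (S k α) 1 1 ∈ Submodule.span k
    {v | ∃ a ∈ grading k n 0, ∃ m : k, v = Ind.mk (incl k n) (S k α) a m}
  exact Submodule.subset_span ⟨1, one_mem_grading, 1, rfl⟩

/-- A homogeneous vector on which the `T_i` act as on `η_α` is the image of `η_α` under a
morphism. -/
theorem exists_hom {α : Composition n} (N : SuperModule (grading k n)) (d : ZMod 2) {u : N.V}
    (hu : u ∈ N.gr d) (h : ∀ i, N.ρ (T k i) u = weight k α i • u) :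
    ∃ F : (Stilde k α).V →ₗ[k] N.V, SuperModule.IsMor (Stilde k α) N d F ∧
      ∀ a, F ((Stilde k α).ρ a (eta k α)) = N.ρ (signTwist k d a) u := by
  let F : (Stilde k α).V →ₗ[k] N.V := indLift (N.ρ.comp (signTwist k d)) u
    (fun i => by rw [AlgHom.comp_apply, signTwist_T, h])
  have hF : ∀ a, F ((Stilde k α).ρ a (eta k α)) = N.ρ (signTwist k d a) u := by
    intro a
    change indLift _ u _ (Ind.mk (incl k n) (S k α) (a * 1) 1) = _
    rw [indLift_mk, mul_one, one_smul, AlgHom.comp_apply]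
  refine ⟨F, ⟨?_, ?_⟩, hF⟩
  · intro p v hv
    induction hv using Submodule.span_induction with
    | mem x hx =>
      obtain ⟨a, ha, m, rfl⟩ := hx
      rw [mk_eq_smul]
      refine (map_smul F m _).symm ▸ Submodule.smul_mem _ _ ?_
      rw [hF, signTwist_of_mem ha, map_smul, add_comm]
      exact Submodule.smul_mem _ _ (N.act_mem ha hu)
    | zero => exact (map_zero F).symm ▸ zero_mem _
    | add y z _ _ hy hz => exact (map_add F y z).symm ▸ add_mem hy hz
    | smul r y _ hy => exact (map_smul F r y).symm ▸ Submodule.smul_mem _ _ hy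
  · intro p a ha v
    have : F ∘ₗ (Stilde k α).ρ a = (-1 : k) ^ (d.val * p.val) • N.ρ a ∘ₗ F := by
      refine Stilde.hom_ext fun b => ?_
      rw [LinearMap.comp_apply, LinearMap.smul_apply, LinearMap.comp_apply, ← Module.End.mul_apply,
        ← map_mul, hF, hF, map_mul, map_mul, Module.End.mul_apply, signTwist_of_mem ha, map_smul]
      rfl
    exact LinearMap.congr_fun this v

theorem exists_iso {α : Composition n} (N : SuperModule (grading k n)) (d : ZMod 2) {u : N.V}
    (hu : u ∈ N.gr d) (h : ∀ i, N.ρ (T k i) u = weight k α i • u)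
    (hgen : ∀ x : N.V, ∃ a, N.ρ a u = x) (hdim : Module.finrank k N.V = 2 ^ n) :
    ∃ F : (Stilde k α).V ≃ₗ[k] N.V, SuperModule.IsMor (Stilde k α) N d F.toLinearMap ∧
      ∀ a, F ((Stilde k α).ρ a (eta k α)) = N.ρ (signTwist k d a) u := by
  obtain ⟨F, hF, hη⟩ := exists_hom N d hu h
  have hs : Function.Surjective F := by
    intro x
    obtain ⟨a, rfl⟩ := hgen x
    exact ⟨_, by rw [hη (signTwist k d a), signTwist_signTwist]⟩
  have : Module.Finite k N.V := Module.finite_of_finrank_pos (by rw [hdim]; positivity)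
  have hrank : Module.finrank k (Stilde k α).V = Module.finrank k N.V :=
    (finrank_Stilde α).trans hdim.symm
  have hi : Function.Injective F :=
    (LinearMap.injective_iff_surjective_of_finrank_eq_finrank hrank).mpr hs
  exact ⟨LinearEquiv.ofBijective F ⟨hi, hs⟩, hF, hη⟩

theorem eta_generates (α : Composition n) (x : (Stilde k α).V) :
    ∃ a, (Stilde k α).ρ a (eta k α) = x := by
  have hx : x ∈ Submodule.span k (Set.range fun D => (Stilde k α).ρ (cD k D) (eta k α)) := by
    rw [span_cD_eta]; trivial
  induction hx using Submodule.span_induction with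
  | mem x hx => obtain ⟨D, rfl⟩ := hx; exact ⟨_, rfl⟩
  | zero => exact ⟨0, by rw [map_zero, LinearMap.zero_apply]⟩
  | add y z _ _ hy hz =>
    obtain ⟨a, rfl⟩ := hy
    obtain ⟨b, rfl⟩ := hz
    exact ⟨a + b, by rw [map_add, LinearMap.add_apply]⟩
  | smul r y _ hy =>
    obtain ⟨a, rfl⟩ := hy
    exact ⟨r • a, by rw [map_smul, LinearMap.smul_apply]⟩

/-! ### Parity on the Fock space -/

variable (k) in
/-- The functions supported on the sets whose cardinality has a given parity. -/
def fockGr (p : ZMod 2) : Submodule k (Fock k n) where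
  carrier := {f | ∀ E, (E.card : ZMod 2) ≠ p → f E = 0}
  add_mem' hf hg E h := by rw [Pi.add_apply, hf E h, hg E h, add_zero]
  zero_mem' _ _ := rfl
  smul_mem' r f hf E h := by rw [Pi.smul_apply, hf E h, smul_zero]

omit [CharZero k]

theorem card_toggle (E : Finset (Fin n)) (j : Fin n) :
    ((E ∆ {j}).card : ZMod 2) = E.card + 1 := by
  by_cases h : j ∈ E
  · have : E ∆ {j} = E.erase j := by
      ext x
      simp only [Finset.mem_symmDiff, Finset.mem_singleton, Finset.mem_erase]
      by_cases hx : x = j <;> simp [hx, h]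
    rw [this, ← Finset.card_erase_add_one h, Nat.cast_succ, add_assoc,
      show (1 : ZMod 2) + 1 = 0 by decide, add_zero]
  · have : E ∆ {j} = insert j E := by
      ext x
      simp only [Finset.mem_symmDiff, Finset.mem_singleton, Finset.mem_insert]
      by_cases hx : x = j <;> simp [hx, h]
    rw [this, Finset.card_insert_of_notMem h, Nat.cast_succ]

theorem aOp_mem_fockGr {p : ZMod 2} {f : Fock k n} (hf : f ∈ fockGr k p) (j : Fin n) :
    aOp k j f ∈ fockGr k (p + 1) := by
  intro E hE
  rw [aOp_apply, hf]
  · simp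
  · rw [card_toggle]
    rintro rfl
    apply hE
    rw [add_assoc, show (1 : ZMod 2) + 1 = 0 by decide, add_zero]

theorem sOp_mem_fockGr {p : ZMod 2} {f : Fock k n} (hf : f ∈ fockGr k p) (j : Fin n) :
    sOp k j f ∈ fockGr k p := by
  intro E hE
  rw [sOp_apply, hf E hE, mul_zero]

theorem tOp_mem_fockGr {p : ZMod 2} {f : Fock k n} (hf : f ∈ fockGr k p)
    (d : Finset (Fin (n - 1))) (i : Fin (n - 1)) : tOp k d i f ∈ fockGr k p := by
  have haa : ∀ g ∈ fockGr k (n := n) p, aOp k (lo i) (aOp k (hi i) g) ∈ fockGr k p := by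
    intro g hg
    have := aOp_mem_fockGr (aOp_mem_fockGr hg (hi i)) (lo i)
    rwa [add_assoc, show (1 : ZMod 2) + 1 = 0 by decide, add_zero] at this
  have hs : ∀ j, f - sOp k j f ∈ fockGr k p := fun j => sub_mem hf (sOp_mem_fockGr hf j)
  by_cases h : i ∈ d
  · rw [tOp_apply_of_mem h]
    exact add_mem (neg_mem hf) (Submodule.smul_mem _ _ (sub_mem (hs _) (haa _ (hs _))))
  · rw [tOp_apply_of_notMem h]
    exact neg_mem (Submodule.smul_mem _ _ (add_mem (hs _) (haa _ (hs _))))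

variable [CharZero k]

theorem model_mem_fockGr {p : ZMod 2} {a : HC k n} (ha : a ∈ grading k n p)
    (d : Finset (Fin (n - 1))) : model k d a (vac k n) ∈ fockGr k p := by
  induction ha using Submodule.span_induction with
  | mem x hx =>
    obtain ⟨w, rfl, rfl⟩ := hx
    induction w with
    | nil =>
      intro E hE
      have : E ≠ ∅ := by rintro rfl; simp at hE
      simp [vac, this]
    | cons x w ih =>
      rw [List.map_cons, List.prod_cons, map_mul, Module.End.mul_apply]
      cases x with
      | inl i => simpa using tOp_mem_fockGr ih d i
      | inr j => simpa [List.countP_cons] using aOp_mem_fockGr ih j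
  | zero => rw [map_zero]; exact zero_mem _
  | add y z _ _ hy hz => rw [map_add]; exact add_mem hy hz
  | smul r y _ hy => rw [map_smul]; exact Submodule.smul_mem _ _ hy

theorem fockEquiv_mem_fockGr {α : Composition n} {p : ZMod 2} {v : (Stilde k α).V}
    (hv : v ∈ (Stilde k α).gr p) : fockEquiv k α v ∈ fockGr k p := by
  induction hv using Submodule.span_induction with
  | mem x hx =>
    obtain ⟨a, ha, m, rfl⟩ := hx
    rw [mk_eq_smul]
    refine (map_smul (fockEquiv k α) m _).symm ▸ Submodule.smul_mem _ _ ?_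
    rw [fockEquiv_act, fockEquiv_eta]
    exact model_mem_fockGr ha _
  | zero => exact (map_zero (fockEquiv k α)).symm ▸ zero_mem _
  | add y z _ _ hy hz => exact (map_add (fockEquiv k α) y z).symm ▸ add_mem hy hz
  | smul r y _ hy => exact (map_smul (fockEquiv k α) r y).symm ▸ Submodule.smul_mem _ _ hy

/-! ### The pairings -/

theorem exists_model_apply_ne_zero (d : Finset (Fin (n - 1))) {f : Fock k n} (hf : f ≠ 0)
    (E₀ : Finset (Fin n)) : ∃ a, model k d a f E₀ ≠ 0 := by
  obtain ⟨E, hE⟩ := Function.ne_iff.mp hf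
  have key : ∀ F : Finset (Fin n), ∃ a, model k d a f (E ∆ F) ≠ 0 := by
    intro F
    induction F using Finset.induction_on with
    | empty =>
      refine ⟨1, ?_⟩
      rw [← Finset.bot_eq_empty, symmDiff_bot, map_one]
      exact hE
    | insert j F hj ih =>
      obtain ⟨a, ha⟩ := ih
      refine ⟨c k j * a, ?_⟩
      have e : E ∆ (insert j F) ∆ {j} = E ∆ F := by
        rw [symmDiff_assoc]
        congr 1
        ext x
        simp only [Finset.mem_symmDiff, Finset.mem_singleton, Finset.mem_insert]
        by_cases hx : x = j <;> simp [hx, hj]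
      rw [map_mul, Module.End.mul_apply, model_c, aOp_apply, e]
      refine neg_ne_zero.mpr (mul_ne_zero ?_ (mul_ne_zero ?_ ha))
      · exact left_ne_zero_of_mul_eq_one (occSign_mul_self k _ _)
      · exact left_ne_zero_of_mul_eq_one (jwSign_mul_self k _ _)
  have := key (E ∆ E₀)
  rwa [← symmDiff_assoc, symmDiff_self, bot_symmDiff] at this

/-- Each vector of the dual basis generates the twisted dual of `S̃_α`. -/
theorem dual_generates {α : Composition n} (ν : HC k n ≃ₐ[k] (HC k n)ᵐᵒᵖ)
    (hν : ∀ i, ∀ a ∈ grading k n i, (ν a).unop ∈ grading k n i) (E : Finset (Fin n))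
    (x : ((Stilde k α).dualTwist ν hν).V) :
    ∃ a, ((Stilde k α).dualTwist ν hν).ρ a ((cBasis k α).coord E) = x := by
  let G : HC k n →ₗ[k] Module.Dual k (Stilde k α).V :=
    (LinearMap.applyₗ ((cBasis k α).coord E)) ∘ₗ ((Stilde k α).dualTwist ν hν).ρ.toLinearMap
  have hG : ∀ a v, G a v = (cBasis k α).coord E ((Stilde k α).ρ (ν a).unop v) := fun _ _ => rfl
  suffices h : LinearMap.range G = ⊤ by
    obtain ⟨a, ha⟩ := LinearMap.range_eq_top.mp h x
    exact ⟨a, ha⟩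
  have h0 : (LinearMap.range G).dualCoannihilator = ⊥ := by
    rw [eq_bot_iff]
    intro v hv
    rw [Submodule.mem_dualCoannihilator] at hv
    rw [Submodule.mem_bot]
    by_contra hne
    obtain ⟨a, ha⟩ := exists_model_apply_ne_zero (desc α)
      ((map_ne_zero_iff _ (fockEquiv k α).injective).mpr hne) E
    apply ha
    have := hv _ ⟨ν.symm (MulOpposite.op a), rfl⟩
    rwa [hG, AlgEquiv.apply_symm_apply, MulOpposite.unop_op, cBasis_coord, fockEquiv_act] at this
  rw [← Subspace.dualCoannihilator_dualAnnihilator_eq (W := LinearMap.range G), h0,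
    Submodule.dualAnnihilator_bot]

end Homs

section ConjugateDescents

variable {n : ℕ}

theorem mem_desc {α : Composition n} {i : Fin (n - 1)} :
    i ∈ desc α ↔ (i : ℕ) + 1 ∈ descentSet α := by simp [desc]

theorem sizeUpTo_reverse (α : Composition n) (j : ℕ) :
    α.reverse.sizeUpTo j + α.sizeUpTo (α.length - j) = n := by
  change (α.blocks.reverse.take j).sum + (α.blocks.take (α.blocks.length - j)).sum = n
  rw [List.take_reverse, List.sum_reverse, add_comm, List.sum_take_add_sum_drop, α.blocks_sum]

theorem mem_descentSet_reverse {α : Composition n} {x y : ℕ} (hxy : x + y = n) :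
    x ∈ descentSet α.reverse ↔ y ∈ descentSet α := by
  have key : ∀ (β : Composition n) {x y : ℕ}, x + y = n → x ∈ descentSet β.reverse →
      y ∈ descentSet β := by
    intro β x y hxy h
    have hlen : β.reverse.length = β.length := by simp [Composition.length, Composition.reverse]
    simp only [descentSet, Finset.mem_image, Finset.mem_Ico, hlen] at h ⊢
    obtain ⟨j, ⟨h1, h2⟩, rfl⟩ := h
    have := sizeUpTo_reverse β j
    exact ⟨β.length - j, ⟨by omega, by omega⟩, by omega⟩
  refine ⟨key α hxy, fun h => ?_⟩
  apply key α.reverse ((add_comm _ _).trans hxy)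
  rwa [Composition.reverse_reverse]

theorem mem_descentSet_conj {α : Composition n} {x y : ℕ} (hx : 1 ≤ x) (hy : 1 ≤ y)
    (hxy : x + y = n) : x ∈ descentSet (conj α) ↔ y ∉ descentSet α := by
  rw [conj, mem_descentSet_complement, mem_descentSet_reverse hxy, Finset.mem_Icc]
  exact and_iff_right ⟨hx, by omega⟩

theorem mem_desc_conj {α : Composition n} {i : Fin (n - 1)} :
    i ∈ desc (conj α) ↔ i.rev ∉ desc α := by
  have hi := i.2
  have hr := Fin.val_rev i
  rw [mem_desc, mem_desc, mem_descentSet_conj (y := (i.rev : ℕ) + 1) (by omega) (by omega)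
    (by omega)]

theorem mem_peakSet_conj {α : Composition n} {x : ℕ} :
    x ∈ peakSet (conj α) ↔ x ∈ Finset.Icc 2 (n - 1) ∧ n + 1 - x ∈ peakSet α := by
  simp only [peakSet, Finset.mem_filter, Finset.mem_Icc]
  by_cases hx : 2 ≤ x ∧ x ≤ n - 1
  · rw [mem_descentSet_conj (y := n + 1 - x) (by omega) (by omega) (by omega),
      mem_descentSet_conj (y := n + 1 - x - 1) (by omega) (by omega) (by omega)]
    have : 2 ≤ n + 1 - x ∧ n + 1 - x ≤ n - 1 := by omega
    simp only [hx, this, true_and, not_not]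
    tauto
  · simp [hx]

theorem peakSet_conj_congr {α β : Composition n} (h : peakSet α = peakSet β) :
    peakSet (conj α) = peakSet (conj β) := by
  ext x
  rw [mem_peakSet_conj, mem_peakSet_conj, h]

end ConjugateDescents

section Isomorphisms

variable {k : Type u} [Field k] [CharZero k] {n : ℕ}

omit [CharZero k] in
theorem weight_conj (α : Composition n) (i : Fin (n - 1)) :
    weight k (conj α) i = -(weight k α i.rev + 1) := by
  rw [weight_eq, weight_eq]
  by_cases h : i.rev ∈ desc α
  · simp [h, mem_desc_conj]
  · simp [h, mem_desc_conj]

omit [CharZero k] in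
theorem sOp_single_univ (j : Fin n) :
    sOp k j (Pi.single Finset.univ 1) = -Pi.single Finset.univ 1 := by
  funext E
  rw [sOp_apply, Pi.neg_apply]
  by_cases h : E = Finset.univ
  · subst h; simp [occSign]
  · simp [h]

theorem phi_T_top (α : Composition n) (i : Fin (n - 1)) :
    (Stilde k α).ρ (phi k n (T k i)) ((Stilde k α).ρ (cD k Finset.univ) (eta k α)) =
      weight k (conj α) i • (Stilde k α).ρ (cD k Finset.univ) (eta k α) := by
  apply (fockEquiv k α).injective
  rw [map_smul, fockEquiv_act, fockEquiv_act, fockEquiv_eta, model_cD_vac, weight_eq,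
    show phi k n (T k i) = _ from phiHom_T i, map_add, map_mul, model_T, model_c, model_c,
    LinearMap.add_apply, Module.End.mul_apply]
  set f : Fock k n := Pi.single Finset.univ 1 with hf
  have hs : ∀ j, f - sOp k j f = (2 : k) • f := fun j => by rw [hf, sOp_single_univ, two_smul]; abel
  by_cases h : i.rev ∈ desc α
  · rw [tOp_apply_of_mem h, hs, map_smul, map_smul, if_neg (fun h' => mem_desc_conj.mp h' h)]
    module
  · rw [tOp_apply_of_notMem h, hs, map_smul, map_smul, if_pos (mem_desc_conj.mpr h)]
    module

theorem eta_top_mem (α : Composition n) :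
    (Stilde k α).ρ (cD k Finset.univ) (eta k α) ∈ (Stilde k α).gr (n : ZMod 2) := by
  have h := (Stilde k α).act_mem (cD_mem (k := k) (Finset.univ : Finset (Fin n))) (eta_mem α)
  rwa [add_zero, Finset.card_univ, Fintype.card_fin] at h

omit [CharZero k] in
theorem signTwist_cD (D : Finset (Fin n)) :
    signTwist k (n : ZMod 2) (cD k D) = (-1 : k) ^ (n * D.card) • cD k D := by
  rw [signTwist_of_mem (cD_mem D)]
  congr 1
  rw [ZMod.val_natCast, ZMod.val_natCast, neg_one_pow_eq_pow_mod_two,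
    neg_one_pow_eq_pow_mod_two (n := n * D.card), ← Nat.mul_mod]

theorem exists_iso_phi (α : Composition n) :
    ∃ F : (Stilde k (conj α)).V ≃ₗ[k] ((Stilde k α).twist (phi k n) (phi_even k n)).V,
      SuperModule.IsMor _ _ (n : ZMod 2) F.toLinearMap ∧
      ∀ D : Finset (Fin n), F ((Stilde k (conj α)).ρ (cD k D) (eta k (conj α))) =
        (-1 : k) ^ (n * D.card) •
          (Stilde k α).ρ (phi k n (cD k D)) ((Stilde k α).ρ (cD k Finset.univ) (eta k α)) := by
  obtain ⟨F, hF, hη⟩ := exists_iso (α := conj α) ((Stilde k α).twist (phi k n) (phi_even k n))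
    (n : ZMod 2) (u := (Stilde k α).ρ (cD k Finset.univ) (eta k α)) (eta_top_mem α)
    (fun i => phi_T_top α i) (fun x => by
      obtain ⟨a, rfl⟩ := eta_generates α x
      obtain ⟨e, he⟩ := isUnit_cD (k := k) (Finset.univ : Finset (Fin n))
      refine ⟨(phi k n).symm (a * ↑e⁻¹), ?_⟩
      change (Stilde k α).ρ (phi k n ((phi k n).symm (a * ↑e⁻¹)))
        ((Stilde k α).ρ (cD k Finset.univ) (eta k α)) = _
      rw [AlgEquiv.apply_symm_apply, ← Module.End.mul_apply, ← map_mul, ← he,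
        Units.inv_mul_cancel_right]) (finrank_Stilde α)
  refine ⟨F, hF, fun D => ?_⟩
  rw [hη, signTwist_cD, map_smul]
  rfl

theorem exists_iso_phi' (α : Composition n) :
    ∃ F : (Stilde k (conj α)).V ≃ₗ[k] ((Stilde k α).twist (phi' k n) (phi'_even k n)).V,
      SuperModule.IsMor _ _ 0 F.toLinearMap ∧
      ∀ D : Finset (Fin n), F ((Stilde k (conj α)).ρ (cD k D) (eta k (conj α))) =
        (Stilde k α).ρ (phi' k n (cD k D)) (eta k α) := by
  obtain ⟨F, hF, hη⟩ := exists_iso (α := conj α) ((Stilde k α).twist (phi' k n) (phi'_even k n))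
    0 (u := eta k α) (eta_mem α) (fun i => by
      change (Stilde k α).ρ (phi' k n (T k i)) (eta k α) = weight k (conj α) i • eta k α
      rw [show phi' k n (T k i) = _ from phiHom'_T i, map_neg, map_add, map_one,
        LinearMap.neg_apply, LinearMap.add_apply, T_eta, weight_conj, Module.End.one_apply,
        neg_smul, add_smul, one_smul]) (fun x => by
      obtain ⟨a, rfl⟩ := eta_generates α x
      refine ⟨(phi' k n).symm a, ?_⟩
      change (Stilde k α).ρ (phi' k n ((phi' k n).symm a)) (eta k α) = _
      rw [AlgEquiv.apply_symm_apply]) (finrank_Stilde α)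
  refine ⟨F, hF, fun D => ?_⟩
  rw [hη]
  rfl

theorem finrank_dual_Stilde {α : Composition n} (ν : HC k n ≃ₐ[k] (HC k n)ᵐᵒᵖ)
    (hν : ∀ i, ∀ a ∈ grading k n i, (ν a).unop ∈ grading k n i) :
    Module.finrank k ((Stilde k α).dualTwist ν hν).V = 2 ^ n :=
  (Subspace.dual_finrank_eq (V := (Stilde k α).V)).trans (finrank_Stilde α)

theorem coord_mem_dual {α : Composition n} (ν : HC k n ≃ₐ[k] (HC k n)ᵐᵒᵖ)
    (hν : ∀ i, ∀ a ∈ grading k n i, (ν a).unop ∈ grading k n i) (E : Finset (Fin n)) :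
    (cBasis k α).coord E ∈ ((Stilde k α).dualTwist ν hν).gr (E.card : ZMod 2) := by
  refine (Submodule.mem_dualAnnihilator _).mpr fun v hv => ?_
  rw [cBasis_coord]
  refine fockEquiv_mem_fockGr hv E ?_
  simp

omit [CharZero k] in
theorem aOp_aOp_sOp_hi (i : Fin (n - 1)) (f : Fock k n) :
    aOp k (lo i) (aOp k (hi i) (sOp k (hi i) f)) =
      -sOp k (hi i) (aOp k (lo i) (aOp k (hi i) f)) := by
  have e1 := LinearMap.congr_fun ((fermiRels k).s_a_self (hi i)) f
  have e2 := LinearMap.congr_fun ((fermiRels k).s_a (lo_ne_hi i).symm) (aOp k (hi i) f)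
  refine (congrArg (aOp k (lo i)) (neg_eq_iff_eq_neg.mpr e1).symm).trans ?_
  rw [map_neg]
  exact congrArg _ e2.symm

omit [CharZero k] in
theorem aOp_aOp_sOp_lo (i : Fin (n - 1)) (f : Fock k n) :
    aOp k (lo i) (aOp k (hi i) (sOp k (lo i) f)) =
      -sOp k (lo i) (aOp k (lo i) (aOp k (hi i) f)) := by
  have e1 := LinearMap.congr_fun ((fermiRels k).s_a (lo_ne_hi i)) f
  have e2 := LinearMap.congr_fun ((fermiRels k).s_a_self (lo i)) (aOp k (hi i) f)
  exact (congrArg (aOp k (lo i)) e1.symm).trans (neg_eq_iff_eq_neg.mpr e2).symm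

theorem psi_T_coord (α : Composition n) (i : Fin (n - 1)) :
    ((Stilde k α).dualTwist (psi k n) (psi_even k n)).ρ (T k i) ((cBasis k α).coord ∅) =
      weight k α i • (cBasis k α).coord ∅ := by
  refine LinearMap.ext fun v => ?_
  refine (SuperModule.dualTwist_apply _ _ _ _ _ _).trans ?_
  rw [show psi k n (T k i) = _ from psiHom_T i, MulOpposite.unop_op, LinearMap.smul_apply,
    cBasis_coord, cBasis_coord, fockEquiv_act, map_add, map_mul, model_T, model_c, model_c,
    LinearMap.add_apply, Module.End.mul_apply, weight_eq]
  generalize fockEquiv k α v = f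
  have hs : ∀ j (g : Fock k n), sOp k j g ∅ = g ∅ := fun j g => by simp [sOp_apply, occSign]
  by_cases h : i ∈ desc α
  · rw [tOp_apply_of_mem h, if_pos h, map_sub, map_sub, aOp_aOp_sOp_lo]
    simp only [Pi.add_apply, Pi.neg_apply, Pi.smul_apply, Pi.sub_apply, hs, smul_eq_mul]
    ring
  · rw [tOp_apply_of_notMem h, if_neg h, map_sub, map_sub, aOp_aOp_sOp_hi]
    simp only [Pi.add_apply, Pi.neg_apply, Pi.smul_apply, Pi.sub_apply, hs, smul_eq_mul]
    ring

theorem psi'_T_coord (α : Composition n) (i : Fin (n - 1)) :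
    ((Stilde k α).dualTwist (psi' k n) (psi'_even k n)).ρ (T k i)
        ((cBasis k α).coord Finset.univ) =
      weight k α i • (cBasis k α).coord Finset.univ := by
  refine LinearMap.ext fun v => ?_
  refine (SuperModule.dualTwist_apply _ _ _ _ _ _).trans ?_
  rw [show psi' k n (T k i) = _ from psiHom'_T i, MulOpposite.unop_op, LinearMap.smul_apply,
    cBasis_coord, cBasis_coord, fockEquiv_act, map_neg, map_add, map_one, model_T,
    LinearMap.neg_apply, LinearMap.add_apply, Module.End.one_apply, weight_eq]
  generalize fockEquiv k α v = f
  have hs : ∀ j (g : Fock k n), sOp k j g Finset.univ = -g Finset.univ :=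
    fun j g => by simp [sOp_apply, occSign]
  by_cases h : i ∈ desc α
  · rw [tOp_apply_of_mem h, if_pos h, map_sub, map_sub, aOp_aOp_sOp_lo]
    simp only [Pi.add_apply, Pi.neg_apply, Pi.smul_apply, Pi.sub_apply, hs, smul_eq_mul]
    ring
  · rw [tOp_apply_of_notMem h, if_neg h, map_sub, map_sub, aOp_aOp_sOp_hi]
    simp only [Pi.add_apply, Pi.neg_apply, Pi.smul_apply, Pi.sub_apply, hs, smul_eq_mul]
    ring

theorem exists_iso_psi (α : Composition n) :
    ∃ F : (Stilde k α).V ≃ₗ[k] ((Stilde k α).dualTwist (psi k n) (psi_even k n)).V,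
      SuperModule.IsMor _ _ 0 F.toLinearMap ∧
      ∀ D : Finset (Fin n), F ((Stilde k α).ρ (cD k D) (eta k α)) =
        ((Stilde k α).dualTwist (psi k n) (psi_even k n)).ρ (cD k D) ((cBasis k α).coord ∅) := by
  obtain ⟨F, hF, hη⟩ := exists_iso (α := α) ((Stilde k α).dualTwist (psi k n) (psi_even k n)) 0
    (u := (cBasis k α).coord ∅) (coord_mem_dual _ _ ∅) (psi_T_coord α)
    (dual_generates (psi k n) (psi_even k n) ∅) (finrank_dual_Stilde _ _)
  refine ⟨F, hF, fun D => ?_⟩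
  rw [hη]
  rfl

theorem exists_iso_psi' (α : Composition n) :
    ∃ F : (Stilde k α).V ≃ₗ[k] ((Stilde k α).dualTwist (psi' k n) (psi'_even k n)).V,
      SuperModule.IsMor _ _ (n : ZMod 2) F.toLinearMap ∧
      ∀ D : Finset (Fin n), F ((Stilde k α).ρ (cD k D) (eta k α)) =
        (-1 : k) ^ (n * D.card) • ((Stilde k α).dualTwist (psi' k n) (psi'_even k n)).ρ (cD k D)
          ((cBasis k α).coord Finset.univ) := by
  obtain ⟨F, hF, hη⟩ := exists_iso (α := α) ((Stilde k α).dualTwist (psi' k n) (psi'_even k n))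
    (n : ZMod 2) (u := (cBasis k α).coord Finset.univ)
    (by
      have h := coord_mem_dual (α := α) (psi' k n) (psi'_even k n) Finset.univ
      rw [Finset.card_univ, Fintype.card_fin] at h
      exact h)
    (psi'_T_coord α) (dual_generates (psi' k n) (psi'_even k n) Finset.univ)
    (finrank_dual_Stilde _ _)
  refine ⟨F, hF, fun D => ?_⟩
  rw [hη, signTwist_cD, map_smul]
  rfl

end Isomorphisms

section Socle

variable {k : Type u} [Field k] [CharZero k] {n : ℕ} {d : Finset (Fin (n - 1))}

/-- The positions `j` for which `c_j` may be moved past `η` by an endomorphism. -/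
def IsValley (d : Finset (Fin (n - 1))) (j : Fin n) : Prop :=
  ∀ i : Fin (n - 1), (i ∈ d → lo i ≠ j) ∧ (i ∉ d → hi i ≠ j)

theorem eq_zero_of_eq_neg {V : Type*} [AddCommGroup V] [Module k V] {v : V} (h : v = -v) :
    v = 0 := by
  have h2 : (2 : k) • v = 0 := by
    rw [two_smul]; nth_rewrite 2 [h]; exact add_neg_cancel v
  exact (smul_eq_zero.mp h2).resolve_left two_ne_zero

omit [CharZero k] in
theorem aOp_aOp_sq {i j : Fin n} (h : i ≠ j) (g : Fock k n) :
    aOp k i (aOp k j (aOp k i (aOp k j g))) = -g := by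
  have e := LinearMap.congr_fun ((fermiRels k).a_anti h.symm) (aOp k j g)
  have e1 : ∀ j (g : Fock k n), aOp k j (aOp k j g) = -g :=
    fun j g => LinearMap.congr_fun ((fermiRels k).a_sq j) g
  refine (congrArg (aOp k i) e).trans ?_
  change aOp k i (-aOp k i (aOp k j (aOp k j g))) = -g
  rw [map_neg, e1, e1]
  simp

theorem sOp_eq_of_tOp_eq_zero {i : Fin (n - 1)} (hi' : i ∉ d) {f : Fock k n}
    (h : tOp k d i f = 0) : sOp k (hi i) f = f := by
  rw [tOp_apply_of_notMem hi', neg_eq_zero, smul_eq_zero] at h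
  have h1 := h.resolve_left (by norm_num)
  have h2 := congrArg (fun g => aOp k (lo i) (aOp k (hi i) g)) h1
  simp only [map_add, map_zero, aOp_aOp_sq (lo_ne_hi i)] at h2
  refine (sub_eq_zero.mp (eq_zero_of_eq_neg (k := k) ?_)).symm
  exact (eq_neg_of_add_eq_zero_left h1).trans
    (congrArg Neg.neg ((eq_neg_of_add_eq_zero_left h2).trans (neg_neg _)))

theorem sOp_eq_of_tOp_eq_neg {i : Fin (n - 1)} (hi' : i ∈ d) {f : Fock k n}
    (h : tOp k d i f = -f) : sOp k (lo i) f = f := by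
  rw [tOp_apply_of_mem hi', add_eq_left, smul_eq_zero] at h
  have h1 := sub_eq_zero.mp (h.resolve_left (by norm_num))
  have h2 := congrArg (fun g => aOp k (lo i) (aOp k (hi i) g)) h1
  simp only [aOp_aOp_sq (lo_ne_hi i)] at h2
  refine (sub_eq_zero.mp (eq_zero_of_eq_neg (k := k) ?_)).symm
  exact h1.trans h2

theorem aOp_sub_ne_zero {f : Fock k n} (hf : f ≠ 0) {i j : Fin n} (hij : i ≠ j) :
    aOp k i f - aOp k j f ≠ 0 := by
  intro h
  have e1 : ∀ j (g : Fock k n), aOp k j (aOp k j g) = -g :=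
    fun j g => LinearMap.congr_fun ((fermiRels k).a_sq j) g
  have e2 : aOp k i (aOp k j f) = -aOp k j (aOp k i f) :=
    LinearMap.congr_fun ((fermiRels k).a_anti hij) f
  have h1 := congrArg (aOp k i) h
  have h2 := congrArg (aOp k j) h
  rw [map_sub, map_zero, e1, e2] at h1
  rw [map_sub, map_zero, e1] at h2
  apply hf
  apply eq_zero_of_eq_neg (k := k)
  have h3 : -f + -f = 0 := by
    calc -f + -f = (-f - -aOp k j (aOp k i f)) - (aOp k j (aOp k i f) - -f) := by abel
      _ = 0 := by rw [h1, h2, sub_zero]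
  exact (neg_eq_of_add_eq_zero_left h3).symm ▸ (neg_neg f).symm

omit [CharZero k] in
theorem tOp_sOp_eq {i : Fin (n - 1)} {m : Fin n} (h1 : m ≠ lo i) (h2 : m ≠ hi i) {f : Fock k n}
    (h : sOp k m f = f) : sOp k m (tOp k d i f) = tOp k d i f := by
  have := LinearMap.congr_fun ((fermiRels k).t_s (k := k) (d := d) i m h1 h2) f
  exact this.symm.trans (congrArg (tOp k d i) h)

omit [CharZero k] in
theorem aOp_sOp_eq {j m : Fin n} (hmj : m ≠ j) {f : Fock k n}
    (h : sOp k m f = f) : sOp k m (aOp k j f) = aOp k j f := by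
  have := LinearMap.congr_fun ((fermiRels k).s_a hmj) f
  exact this.trans (congrArg (aOp k j) h)

theorem tOp_tOp (i : Fin (n - 1)) (f : Fock k n) : tOp k d i (tOp k d i f) = -tOp k d i f :=
  LinearMap.congr_fun ((fermiRels k).t_sq (k := k) (d := d) i) f

theorem tOp_aOp_lo (i : Fin (n - 1)) (f : Fock k n) :
    tOp k d i (aOp k (lo i) f) = aOp k (hi i) (tOp k d i f) :=
  LinearMap.congr_fun ((fermiRels k).t_lo (k := k) (d := d) i) f

theorem tOp_aOp_hi (i : Fin (n - 1)) (f : Fock k n) :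
    tOp k d i (aOp k (hi i) f) = aOp k (lo i) (tOp k d i f) + aOp k (lo i) f - aOp k (hi i) f := by
  have h : tOp k d i (aOp k (hi i) f) + aOp k (hi i) f = aOp k (lo i) (tOp k d i f + f) :=
    LinearMap.congr_fun ((fermiRels k).t_hi (k := k) (d := d) i) f
  rw [← map_add, ← h, add_sub_cancel_right]

variable {W : Submodule k (Fock k n)}

theorem ascent_step (hT : ∀ i, ∀ w ∈ W, tOp k d i w ∈ W) (ha : ∀ j, ∀ w ∈ W, aOp k j w ∈ W)
    {i : Fin (n - 1)} (hi' : i ∉ d) {f : Fock k n} (hf : f ∈ W) (h0 : f ≠ 0) :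
    ∃ f' ∈ W, f' ≠ 0 ∧ sOp k (hi i) f' = f' ∧
      ∀ m, m ≠ lo i → m ≠ hi i → sOp k m f = f → sOp k m f' = f' := by
  by_cases h : tOp k d i f + f = 0
  · refine ⟨tOp k d i (aOp k (lo i) f) + aOp k (lo i) f, W.add_mem (hT _ _ (ha _ _ hf)) (ha _ _ hf),
      ?_, sOp_eq_of_tOp_eq_zero hi' (by rw [map_add, tOp_tOp, neg_add_cancel]), ?_⟩
    · rw [tOp_aOp_lo, eq_neg_of_add_eq_zero_left h, map_neg, neg_add_eq_sub]
      exact aOp_sub_ne_zero h0 (lo_ne_hi i)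
    · intro m h1 h2 hm
      have := aOp_sOp_eq h1 hm
      rw [map_add, tOp_sOp_eq h1 h2 this, this]
  · refine ⟨_, W.add_mem (hT _ _ hf) hf, h,
      sOp_eq_of_tOp_eq_zero hi' (by rw [map_add, tOp_tOp, neg_add_cancel]), ?_⟩
    intro m h1 h2 hm
    rw [map_add, tOp_sOp_eq h1 h2 hm, hm]

theorem descent_step (hT : ∀ i, ∀ w ∈ W, tOp k d i w ∈ W) (ha : ∀ j, ∀ w ∈ W, aOp k j w ∈ W)
    {i : Fin (n - 1)} (hi' : i ∈ d) {f : Fock k n} (hf : f ∈ W) (h0 : f ≠ 0) :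
    ∃ f' ∈ W, f' ≠ 0 ∧ sOp k (lo i) f' = f' ∧
      ∀ m, m ≠ lo i → m ≠ hi i → sOp k m f = f → sOp k m f' = f' := by
  by_cases h : tOp k d i f = 0
  · refine ⟨tOp k d i (aOp k (hi i) f), hT _ _ (ha _ _ hf), ?_,
      sOp_eq_of_tOp_eq_neg hi' (tOp_tOp _ _), ?_⟩
    · rw [tOp_aOp_hi, h, map_zero, zero_add]
      exact aOp_sub_ne_zero h0 (lo_ne_hi i)
    · intro m h1 h2 hm
      exact tOp_sOp_eq h1 h2 (aOp_sOp_eq h2 hm)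
  · exact ⟨_, hT _ _ hf, h, sOp_eq_of_tOp_eq_neg hi' (tOp_tOp _ _),
      fun m h1 h2 hm => tOp_sOp_eq h1 h2 hm⟩

omit [CharZero k] in
theorem sOp_sOp (j : Fin n) (f : Fock k n) : sOp k j (sOp k j f) = f :=
  LinearMap.congr_fun ((fermiRels k).s_sq j) f

omit [CharZero k] in
theorem aOp_bOp_self (j : Fin n) (f : Fock k n) : aOp k j (bOp k j f) = -sOp k j f := by
  have h : bOp k j (bOp k j f) = f := LinearMap.congr_fun ((fermiRels k).b_sq j) f
  change -(sOp k j (bOp k j (bOp k j f))) = _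
  rw [h]

omit [CharZero k] in
theorem valley_step (ha : ∀ j, ∀ w ∈ W, aOp k j w ∈ W) {j : Fin n}
    (hb : ∀ w ∈ W, bOp k j w ∈ W) {f : Fock k n} (hf : f ∈ W) (h0 : f ≠ 0) :
    ∃ f' ∈ W, f' ≠ 0 ∧ sOp k j f' = f' ∧ ∀ m, m ≠ j → sOp k m f = f → sOp k m f' = f' := by
  by_cases h : f + sOp k j f = 0
  · refine ⟨bOp k j f, hb _ hf, ?_, ?_, ?_⟩
    · intro hz
      have := aOp_bOp_self j f
      rw [hz, map_zero, zero_eq_neg] at this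
      rw [this, add_zero] at h
      exact h0 h
    · refine (LinearMap.congr_fun ((fermiRels k).s_b_self j) f).trans ?_
      change -(bOp k j (sOp k j f)) = _
      rw [← map_neg, ← eq_neg_of_add_eq_zero_left h]
    · intro m hmj hm
      exact (LinearMap.congr_fun ((fermiRels k).s_b m j hmj) f).trans (congrArg (bOp k j) hm)
  · refine ⟨_, W.add_mem hf ?_, h, by rw [map_add, sOp_sOp, add_comm], ?_⟩
    · have := W.neg_mem (ha j _ (hb _ hf))
      rwa [aOp_bOp_self, neg_neg] at this
    · intro m _ hm
      have : sOp k m (sOp k j f) = sOp k j (sOp k m f) :=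
        LinearMap.congr_fun ((fermiRels k).s_comm m j) f
      rw [map_add, this, hm]

/-- A nonzero subspace stable under left multiplications, the `T_i` and the valley endomorphisms
contains the vacuum. -/
theorem vac_mem (hT : ∀ i, ∀ w ∈ W, tOp k d i w ∈ W) (ha : ∀ j, ∀ w ∈ W, aOp k j w ∈ W)
    (hb : ∀ j, IsValley d j → ∀ w ∈ W, bOp k j w ∈ W) (hW : W ≠ ⊥) : vac k n ∈ W := by
  have ascents : ∀ t : ℕ, ∃ f ∈ W, f ≠ 0 ∧
      ∀ i : Fin (n - 1), i ∉ d → n - 1 - t ≤ i → sOp k (hi i) f = f := by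
    intro t
    induction t with
    | zero =>
      obtain ⟨f, hf, h0⟩ := W.ne_bot_iff.mp hW
      exact ⟨f, hf, h0, fun i _ h => by omega⟩
    | succ t ih =>
      obtain ⟨f, hf, h0, h⟩ := ih
      by_cases ht : t < n - 1
      · let i₀ : Fin (n - 1) := ⟨n - 1 - (t + 1), by omega⟩
        have hi₀ : (i₀ : ℕ) = n - 1 - (t + 1) := rfl
        by_cases hd : i₀ ∈ d
        · refine ⟨f, hf, h0, fun i hi' hti => h i hi' ?_⟩
          have : (i : ℕ) ≠ i₀ := fun e => hi' (Fin.ext e ▸ hd)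
          omega
        · obtain ⟨f', hf', h0', hs, hm⟩ := ascent_step hT ha hd hf h0
          refine ⟨f', hf', h0', fun i hi' hti => ?_⟩
          by_cases e : i = i₀
          · rw [e]; exact hs
          · have : (i : ℕ) ≠ i₀ := fun e' => e (Fin.ext e')
            refine hm _ ?_ ?_ (h i hi' (by omega)) <;> simp only [lo, hi, ne_eq, Fin.ext_iff] <;>
              omega
      · exact ⟨f, hf, h0, fun i hi' _ => h i hi' (by omega)⟩
  have descents : ∀ t : ℕ, ∃ f ∈ W, f ≠ 0 ∧ (∀ i : Fin (n - 1), i ∉ d → sOp k (hi i) f = f) ∧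
      ∀ i : Fin (n - 1), i ∈ d → (i : ℕ) < t → sOp k (lo i) f = f := by
    intro t
    induction t with
    | zero =>
      obtain ⟨f, hf, h0, h⟩ := ascents (n - 1)
      exact ⟨f, hf, h0, fun i hi' => h i hi' (by omega), fun i _ h => by omega⟩
    | succ t ih =>
      obtain ⟨f, hf, h0, h, h'⟩ := ih
      by_cases ht : ∃ i₀ ∈ d, (i₀ : ℕ) = t
      · obtain ⟨i₀, hd, hi₀⟩ := ht
        obtain ⟨f', hf', h0', hs, hm⟩ := descent_step hT ha hd hf h0
        refine ⟨f', hf', h0', fun i hi' => ?_, fun i hi' hti => ?_⟩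
        · by_cases e : hi i = lo i₀
          · rw [e]; exact hs
          · refine hm _ e ?_ (h i hi')
            intro e'
            apply hi'
            have : i = i₀ := by
              simp only [hi, Fin.ext_iff] at e' ⊢
              omega
            rwa [this]
        · by_cases e : i = i₀
          · rw [e]; exact hs
          · have : (i : ℕ) ≠ i₀ := fun e' => e (Fin.ext e')
            refine hm _ ?_ ?_ (h' i hi' (by omega)) <;> simp only [lo, hi, ne_eq, Fin.ext_iff] <;>
              omega
      · refine ⟨f, hf, h0, h, fun i hi' hti => h' i hi' ?_⟩
        have : (i : ℕ) ≠ t := fun e => ht ⟨i, hi', e⟩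
        omega
  have valleys : ∀ t : ℕ, ∃ f ∈ W, f ≠ 0 ∧ (∀ j, ¬ IsValley d j → sOp k j f = f) ∧
      ∀ j : Fin n, (j : ℕ) < t → sOp k j f = f := by
    intro t
    induction t with
    | zero =>
      obtain ⟨f, hf, h0, h, h'⟩ := descents (n - 1)
      refine ⟨f, hf, h0, fun j hj => ?_, fun j h => by omega⟩
      simp only [IsValley, not_forall] at hj
      obtain ⟨i, hi'⟩ := hj
      by_cases hd : i ∈ d
      · have : lo i = j := by by_contra hne; exact hi' ⟨fun _ => hne, fun h => (h hd).elim⟩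
        rw [← this]; exact h' i hd i.2
      · have : hi i = j := by by_contra hne; exact hi' ⟨fun h => (hd h).elim, fun _ => hne⟩
        rw [← this]; exact h i hd
    | succ t ih =>
      obtain ⟨f, hf, h0, h, h'⟩ := ih
      by_cases ht : ∃ j₀ : Fin n, IsValley d j₀ ∧ (j₀ : ℕ) = t
      · obtain ⟨j₀, hd, hj₀⟩ := ht
        obtain ⟨f', hf', h0', hs, hm⟩ := valley_step ha (hb j₀ hd) hf h0
        refine ⟨f', hf', h0', fun j hj => hm j (fun e => hj (e ▸ hd)) (h j hj), fun j hjt => ?_⟩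
        by_cases e : j = j₀
        · rw [e]; exact hs
        · have : (j : ℕ) ≠ j₀ := fun e' => e (Fin.ext e')
          exact hm j e (h' j (by omega))
      · refine ⟨f, hf, h0, h, fun j hjt => ?_⟩
        by_cases hv : IsValley d j
        · have : (j : ℕ) ≠ t := fun e => ht ⟨j, hv, e⟩
          exact h' j (by omega)
        · exact h j hv
  obtain ⟨f, hf, h0, -, h⟩ := valleys n
  have hE : ∀ E : Finset (Fin n), E ≠ ∅ → f E = 0 := by
    intro E hE
    obtain ⟨j, hj⟩ := Finset.nonempty_iff_ne_empty.mpr hE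
    have := congrFun (h j j.2) E
    rw [sOp_apply, occSign, if_pos hj, neg_one_mul] at this
    exact eq_zero_of_eq_neg (k := k) this.symm
  have hvac : f = f ∅ • vac k n := by
    funext E
    by_cases e : E = ∅
    · subst e; simp [vac]
    · simp [hE E e, vac, e]
  have h1 : f ∅ ≠ 0 := by
    intro hz
    rw [hz, zero_smul] at hvac
    exact h0 hvac
  have : vac k n = (f ∅)⁻¹ • f := by
    nth_rewrite 2 [hvac]
    rw [smul_smul, inv_mul_cancel₀ h1, one_smul]
  rw [this]
  exact W.smul_mem _ hf

theorem exists_endo {α : Composition n} {j : Fin n} (hj : IsValley (desc α) j) :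
    ∃ g : (Stilde k α).V →ₗ[k] (Stilde k α).V, SuperModule.IsMor (Stilde k α) (Stilde k α) 1 g ∧
      ∀ x, fockEquiv k α (g x) = bOp k j (fockEquiv k α x) := by
  have hbv : aOp k j (vac k n) = bOp k j (vac k n) := by
    have h1 : sOp k j (bOp k j (vac k n)) = -bOp k j (sOp k j (vac k n)) :=
      LinearMap.congr_fun ((fermiRels k).s_b_self j) (vac k n)
    change -(sOp k j (bOp k j (vac k n))) = _
    rw [h1, sOp_vac, neg_neg]
  obtain ⟨g, hg, hη⟩ := exists_hom (α := α) (Stilde k α) 1 (u := (Stilde k α).ρ (c k j) (eta k α))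
    (by simpa using (Stilde k α).act_mem (c_mem j) (eta_mem α)) (fun i => by
      apply (fockEquiv k α).injective
      rw [map_smul, fockEquiv_act, fockEquiv_act, fockEquiv_eta, model_c, model_T, hbv, weight_eq]
      have h1 : tOp k (desc α) i (bOp k j (vac k n)) = bOp k j (tOp k (desc α) i (vac k n)) :=
        LinearMap.congr_fun ((fermiRels k).t_b i j (hj i).1 (hj i).2) (vac k n)
      rw [h1, tOp_vac]
      split_ifs <;> simp)
  refine ⟨g, hg, fun x => ?_⟩
  have key : (fockEquiv k α).toLinearMap ∘ₗ g = bOp k j ∘ₗ (fockEquiv k α).toLinearMap := by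
    refine (cBasis k α).ext fun D => ?_
    rw [cBasis_apply, cD]
    generalize D.sort (· ≤ ·) = l
    change fockEquiv k α (g ((Stilde k α).ρ (l.map (c k)).prod (eta k α))) =
      bOp k j (fockEquiv k α ((Stilde k α).ρ (l.map (c k)).prod (eta k α)))
    induction l with
    | nil =>
      rw [List.map_nil, List.prod_nil, hη, map_one, map_one, Module.End.one_apply,
        Module.End.one_apply, fockEquiv_act, fockEquiv_eta, model_c, hbv]
    | cons m l ih =>
      rw [List.map_cons, List.prod_cons, map_mul, Module.End.mul_apply]
      generalize (Stilde k α).ρ (l.map (c k)).prod (eta k α) = y at ih ⊢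
      rw [hg.map_act 1 _ (c_mem m), map_smul, fockEquiv_act, ih, fockEquiv_act, model_c]
      have h1 : ∀ y, bOp k j (aOp k m y) = -aOp k m (bOp k j y) :=
        LinearMap.congr_fun ((fermiRels k).b_a j m)
      rw [h1, show (1 : ZMod 2).val = 1 from rfl]
      simp
  exact LinearMap.congr_fun key x

/-- A nonzero submodule of `S̃_α` stable under the odd endomorphisms is everything. -/
theorem eq_top_of_stable {α : Composition n} {W : Submodule k (Stilde k α).V}
    (hW : ∀ a, ∀ w ∈ W, (Stilde k α).ρ a w ∈ W)
    (hend : ∀ g, SuperModule.IsMor (Stilde k α) (Stilde k α) 1 g → ∀ w ∈ W, g w ∈ W)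
    (hne : W ≠ ⊥) : W = ⊤ := by
  have hv : vac k n ∈ W.map (fockEquiv k α).toLinearMap := by
    refine vac_mem (d := desc α) ?_ ?_ ?_ ?_
    · rintro i _ ⟨w, hw, rfl⟩
      refine ⟨_, hW (T k i) w hw, ?_⟩
      exact (fockEquiv_act α _ w).trans (by rw [model_T]; rfl)
    · rintro j _ ⟨w, hw, rfl⟩
      refine ⟨_, hW (c k j) w hw, ?_⟩
      exact (fockEquiv_act α _ w).trans (by rw [model_c]; rfl)
    · rintro j hj _ ⟨w, hw, rfl⟩
      obtain ⟨g, hg, h⟩ := exists_endo (k := k) hj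
      exact ⟨g w, hend g hg w hw, h w⟩
    · obtain ⟨w, hw, h0⟩ := W.ne_bot_iff.mp hne
      exact Submodule.ne_bot_iff _ |>.mpr ⟨_, ⟨w, hw, rfl⟩,
        (map_ne_zero_iff _ (fockEquiv k α).injective).mpr h0⟩
  obtain ⟨w, hw, hwe⟩ := hv
  have : w = eta k α := (fockEquiv k α).injective (hwe.trans (fockEquiv_eta α).symm)
  subst this
  rw [eq_top_iff]
  intro x _
  obtain ⟨a, rfl⟩ := eta_generates α x
  exact hW a _ hw

end Socle

/-! ### Morphisms of supermodules -/

section Generalities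

variable {k : Type u} [Field k] {A : Type u} [Ring A] [Algebra k A] {𝒜 : ZMod 2 → Submodule k A}

namespace SuperModule

theorem isCompl_gr (M : SuperModule 𝒜) (p : ZMod 2) : IsCompl (M.gr p) (M.gr (p + 1)) := by
  have h : p = 0 ∨ p = 1 := by revert p; decide
  rcases h with rfl | rfl
  · exact M.isCompl
  · rw [show (1 : ZMod 2) + 1 = 0 by decide]
    exact M.isCompl.symm

theorem sign_add (d e i : ZMod 2) :
    (-1 : k) ^ ((e + d).val * i.val) = (-1) ^ (d.val * i.val) * (-1) ^ (e.val * i.val) := by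
  rw [← pow_add, neg_one_pow_eq_pow_mod_two,
    neg_one_pow_eq_pow_mod_two (n := d.val * i.val + e.val * i.val)]
  congr 1
  revert d e i
  decide

theorem sign_pow_mul_self (m : ℕ) : (-1 : k) ^ m * (-1) ^ m = 1 := by
  rw [← mul_pow]; simp

theorem add_add_cancel_two (d j : ZMod 2) : d + (d + j) = j := by revert d j; decide

theorem IsMor.id (M : SuperModule 𝒜) : IsMor M M 0 LinearMap.id where
  map_gr j v hv := by simpa using hv
  map_act i a ha v := by simp

theorem IsMor.comp {M N Q : SuperModule 𝒜} {d e : ZMod 2} {f : M.V →ₗ[k] N.V} {g : N.V →ₗ[k] Q.V}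
    (hg : IsMor N Q e g) (hf : IsMor M N d f) : IsMor M Q (e + d) (g ∘ₗ f) where
  map_gr j v hv := by
    rw [add_assoc]
    exact hg.map_gr _ _ (hf.map_gr _ _ hv)
  map_act i a ha v := by
    rw [LinearMap.comp_apply, hf.map_act i a ha, map_smul, hg.map_act i a ha, smul_smul,
      ← sign_add, LinearMap.comp_apply]

theorem IsMor.symm {M N : SuperModule 𝒜} {d : ZMod 2} {F : M.V ≃ₗ[k] N.V}
    (hF : IsMor M N d F.toLinearMap) : IsMor N M d F.symm.toLinearMap where
  map_gr j v hv := by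
    have hw : F.symm v ∈ M.gr (d + j) ⊔ M.gr (d + j + 1) := by
      rw [(M.isCompl_gr (d + j)).sup_eq_top]; trivial
    obtain ⟨x, hx, y, hy, hxy⟩ := Submodule.mem_sup.mp hw
    have h1 := hF.map_gr _ _ hx
    have h2 := hF.map_gr _ _ hy
    rw [add_add_cancel_two] at h1
    rw [add_assoc, add_add_cancel_two] at h2
    have h3 : F.toLinearMap y = v - F.toLinearMap x := by
      rw [eq_sub_iff_add_eq, add_comm, ← map_add, hxy]
      exact F.apply_symm_apply v
    have h4 : F y = 0 := (Submodule.disjoint_def.mp (N.isCompl_gr j).disjoint) _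
      (h3 ▸ sub_mem hv h1) h2
    rw [LinearEquiv.map_eq_zero_iff] at h4
    rw [h4, add_zero] at hxy
    exact hxy ▸ hx
  map_act i a ha v := by
    apply F.injective
    have h := hF.map_act i a ha (F.symm v)
    simp only [LinearEquiv.coe_coe, LinearEquiv.apply_symm_apply, map_smul] at h ⊢
    rw [h, smul_smul, sign_pow_mul_self, one_smul]

theorem Iso.symm {M N : SuperModule 𝒜} (h : M.Iso N) : N.Iso M := by
  obtain ⟨d, F, hF⟩ := h
  exact ⟨d, F.symm, hF.symm⟩

theorem Iso.trans {M N Q : SuperModule 𝒜} (h : M.Iso N) (h' : N.Iso Q) : M.Iso Q := by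
  obtain ⟨d, F, hF⟩ := h
  obtain ⟨e, G, hG⟩ := h'
  exact ⟨e + d, F.trans G, hG.comp hF⟩

/-- The transpose of a morphism. -/
theorem IsMor.dualMap {M N : SuperModule 𝒜} {d : ZMod 2} {f : M.V →ₗ[k] N.V}
    (hf : IsMor M N d f) (ν : A ≃ₐ[k] Aᵐᵒᵖ) (hν : ∀ i, ∀ a ∈ 𝒜 i, (ν a).unop ∈ 𝒜 i) :
    IsMor (N.dualTwist ν hν) (M.dualTwist ν hν) d f.dualMap where
  map_gr j g hg := by
    refine (Submodule.mem_dualAnnihilator _).mpr fun v hv => ?_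
    refine (Submodule.mem_dualAnnihilator _).mp hg _ ?_
    have := hf.map_gr _ _ hv
    rwa [add_assoc, add_add_cancel_two] at this
  map_act i a ha := by
    have key : ∀ (g : Module.Dual k N.V) (v : M.V), g (N.ρ (ν a).unop (f v)) =
        (-1 : k) ^ (d.val * i.val) * g (f (M.ρ (ν a).unop v)) := fun g v => by
      rw [hf.map_act i _ (hν i a ha), map_smul, smul_eq_mul, ← mul_assoc, sign_pow_mul_self, one_mul]
    exact fun g => LinearMap.ext fun v => key g v

theorem IsMor.twist {M N : SuperModule 𝒜} {d : ZMod 2} {f : M.V →ₗ[k] N.V}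
    (hf : IsMor M N d f) (ν : A ≃ₐ[k] A) (hν : ∀ i, ∀ a ∈ 𝒜 i, ν a ∈ 𝒜 i) :
    IsMor (M.twist ν hν) (N.twist ν hν) d f where
  map_gr := hf.map_gr
  map_act i a ha v := hf.map_act i (ν a) (hν i a ha) v

theorem IsSimple.twist {M : SuperModule 𝒜} (hM : M.IsSimple) (ν : A ≃ₐ[k] A)
    (hν : ∀ i, ∀ a ∈ 𝒜 i, ν a ∈ 𝒜 i) : (M.twist ν hν).IsSimple := by
  refine ⟨hM.1, fun W hW => hM.2 W ⟨fun a w hw => ?_, hW.graded⟩⟩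
  have h : M.ρ (ν (ν.symm a)) w ∈ W := hW.act_mem (ν.symm a) w hw
  rwa [AlgEquiv.apply_symm_apply] at h

theorem IsMor.ker_isSub (h𝒜 : 𝒜 0 ⊔ 𝒜 1 = ⊤) {M N : SuperModule 𝒜} {d : ZMod 2}
    {f : M.V →ₗ[k] N.V} (hf : IsMor M N d f) : M.IsSub (LinearMap.ker f) where
  act_mem a w hw := by
    have ha : a ∈ 𝒜 0 ⊔ 𝒜 1 := by rw [h𝒜]; trivial
    obtain ⟨b, hb, c, hc, rfl⟩ := Submodule.mem_sup.mp ha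
    rw [LinearMap.mem_ker] at hw ⊢
    rw [map_add, LinearMap.add_apply, map_add, hf.map_act 0 b hb, hf.map_act 1 c hc, hw]
    simp
  graded v hv := by
    have hw : v ∈ M.gr 0 ⊔ M.gr 1 := by rw [M.isCompl.sup_eq_top]; trivial
    obtain ⟨x, hx, y, hy, rfl⟩ := Submodule.mem_sup.mp hw
    rw [LinearMap.mem_ker, map_add] at hv
    have h1 := hf.map_gr _ _ hx
    have h2 := hf.map_gr _ _ hy
    rw [add_zero] at h1
    have e := eq_neg_of_add_eq_zero_left hv
    have h3 : f x = 0 := (Submodule.disjoint_def.mp (N.isCompl_gr d).disjoint) _ h1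
      (e ▸ neg_mem h2)
    rw [h3, zero_add] at hv
    exact Submodule.add_mem_sup ⟨h3, hx⟩ ⟨hv, hy⟩

theorem IsMor.injective_of_simple (h𝒜 : 𝒜 0 ⊔ 𝒜 1 = ⊤) {M N : SuperModule 𝒜} {d : ZMod 2}
    {f : M.V →ₗ[k] N.V} (hf : IsMor M N d f) (hM : M.IsSimple) (h0 : f ≠ 0) :
    Function.Injective f := by
  rcases hM.2 _ (hf.ker_isSub h𝒜) with h | h
  · exact LinearMap.ker_eq_bot.mp h
  · exact (h0 (LinearMap.ker_eq_top.mp h)).elim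

/-- A super submodule, as a supermodule. -/
def sub (M : SuperModule 𝒜) (W : Submodule k M.V) (hW : M.IsSub W) : SuperModule 𝒜 where
  V := W
  ρ := AlgHom.ofLinearMap
    { toFun := fun a => (M.ρ a).restrict (hW.act_mem a)
      map_add' := fun a b => by ext; simp
      map_smul' := fun r a => by ext; simp }
    (by ext; simp) (fun a b => by ext; simp)
  gr p := (M.gr p).comap W.subtype
  isCompl := by
    refine ⟨Submodule.disjoint_def.mpr fun x h0 h1 => ?_, codisjoint_iff.mpr (eq_top_iff.mpr ?_)⟩
    · exact Subtype.ext (Submodule.disjoint_def.mp M.isCompl.disjoint _ h0 h1)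
    · intro x _
      obtain ⟨y, hy, z, hz, hyz⟩ := Submodule.mem_sup.mp (hW.graded x.2)
      have : x = ⟨y, hy.1⟩ + ⟨z, hz.1⟩ := Subtype.ext hyz.symm
      rw [this]
      exact Submodule.add_mem_sup hy.2 hz.2
  act_mem ha hv := M.act_mem ha hv

theorem sub_isMor (M : SuperModule 𝒜) (W : Submodule k M.V) (hW : M.IsSub W) :
    IsMor (M.sub W hW) M 0 W.subtype where
  map_gr j v hv := by rw [zero_add]; exact hv
  map_act i a ha v := by
    rw [ZMod.val_zero, zero_mul, pow_zero, one_smul]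
    rfl

theorem exists_simple_sub (M : SuperModule 𝒜) [Module.Finite k M.V] [Nontrivial M.V] :
    ∃ (L : SuperModule 𝒜) (f : L.V →ₗ[k] M.V), L.IsSimple ∧ IsMor L M 0 f ∧
      Function.Injective f := by
  have htop : M.IsSub ⊤ := ⟨fun _ _ _ => trivial, by
    rw [top_inf_eq, top_inf_eq, M.isCompl.sup_eq_top]⟩
  obtain ⟨W, ⟨hW, hne⟩, hmin⟩ := (wellFounded_lt (α := Submodule k M.V)).has_min
    {W | M.IsSub W ∧ W ≠ ⊥} ⟨⊤, htop, top_ne_bot⟩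
  refine ⟨M.sub W hW, W.subtype, ⟨?_, fun (U : Submodule k W) hU => ?_⟩, M.sub_isMor W hW, W.injective_subtype⟩
  · exact Submodule.nontrivial_iff_ne_bot.mpr hne
  · have hsub : M.IsSub (U.map W.subtype) := by
      constructor
      · rintro a _ ⟨w, hw, rfl⟩
        exact ⟨_, hU.act_mem a w hw, rfl⟩
      · rintro _ ⟨w, hw, rfl⟩
        obtain ⟨y, hy, z, hz, hyz⟩ := Submodule.mem_sup.mp (hU.graded hw)
        rw [show W.subtype w = W.subtype y + W.subtype z from congrArg W.subtype hyz.symm]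
        exact Submodule.add_mem_sup ⟨⟨y, hy.1, rfl⟩, hy.2⟩ ⟨⟨z, hz.1, rfl⟩, hz.2⟩
    by_cases h : U.map W.subtype = ⊥
    · left
      refine eq_bot_iff.mpr fun x hx => ?_
      have : W.subtype x ∈ U.map W.subtype := ⟨x, hx, rfl⟩
      rw [h] at this
      exact Subtype.ext this
    · right
      have hle : U.map W.subtype ≤ W := Submodule.map_subtype_le W U
      have heq : U.map W.subtype = W := by
        by_contra hne'
        exact hmin _ ⟨hsub, h⟩ (lt_of_le_of_ne hle hne')
      refine eq_top_iff.mpr fun (x : W) _ => ?_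
      have hx : (x : M.V) ∈ U.map W.subtype := by rw [heq]; exact x.2
      obtain ⟨y, hy, hyx⟩ := hx
      rwa [← Subtype.ext hyx]

end SuperModule

end Generalities

/-! ### The simple supermodules -/

section Simples

open SuperModule

variable {k : Type u} [Field k] [CharZero k] {n : ℕ}

theorem exists_endo_ne {α : Composition n} {L N : SuperModule (grading k n)} (hL : Nontrivial L.V)
    {d : ZMod 2} {f : L.V →ₗ[k] (Stilde k α).V} (hf : IsMor L (Stilde k α) d f)
    (hinj : Function.Injective f) {q : (Stilde k α).V →ₗ[k] N.V} (hq : q ≠ 0) :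
    ∃ (p : ZMod 2) (g : (Stilde k α).V →ₗ[k] (Stilde k α).V),
      IsMor (Stilde k α) (Stilde k α) p g ∧ q ∘ₗ g ∘ₗ f ≠ 0 := by
  by_contra! hcon
  let U : Submodule k (Stilde k α).V := Submodule.span k
    {x | ∃ (p : ZMod 2) (g : (Stilde k α).V →ₗ[k] (Stilde k α).V) (l : L.V),
      IsMor (Stilde k α) (Stilde k α) p g ∧ x = g (f l)}
  have hU : U = ⊤ := by
    refine eq_top_of_stable ?_ ?_ ?_
    · intro a w hw
      have hom : ∀ i, ∀ a ∈ grading k n i, (Stilde k α).ρ a w ∈ U := by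
        intro i a ha
        induction hw using Submodule.span_induction with
        | mem x hx =>
          obtain ⟨p, g, l, hg, rfl⟩ := hx
          have h1 := (hg.comp hf).map_act i a ha l
          rw [LinearMap.comp_apply, LinearMap.comp_apply] at h1
          have h2 : (Stilde k α).ρ a (g (f l)) =
              (-1 : k) ^ ((p + d).val * i.val) • g (f (L.ρ a l)) := by
            rw [h1, smul_smul, sign_pow_mul_self, one_smul]
          rw [h2]
          exact U.smul_mem _ (Submodule.subset_span ⟨p, g, _, hg, rfl⟩)
        | zero => rw [map_zero]; exact zero_mem _
        | add y z _ _ hy hz => rw [map_add]; exact add_mem hy hz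
        | smul r y _ hy => rw [map_smul]; exact U.smul_mem _ hy
      have ha : a ∈ grading k n 0 ⊔ grading k n 1 := by rw [grading_sup]; trivial
      obtain ⟨b, hb, c, hc, rfl⟩ := Submodule.mem_sup.mp ha
      rw [map_add, LinearMap.add_apply]
      exact add_mem (hom 0 b hb) (hom 1 c hc)
    · intro h hh w hw
      induction hw using Submodule.span_induction with
      | mem x hx =>
        obtain ⟨p, g, l, hg, rfl⟩ := hx
        exact Submodule.subset_span ⟨1 + p, h ∘ₗ g, l, hh.comp hg, rfl⟩
      | zero => rw [map_zero]; exact zero_mem _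
      | add y z _ _ hy hz => rw [map_add]; exact add_mem hy hz
      | smul r y _ hy => rw [map_smul]; exact U.smul_mem _ hy
    · obtain ⟨l, hl⟩ := exists_ne (0 : L.V)
      exact U.ne_bot_iff.mpr ⟨f l, Submodule.subset_span ⟨0, LinearMap.id, l, IsMor.id _, rfl⟩,
        (map_ne_zero_iff f hinj).mpr hl⟩
  apply hq
  refine LinearMap.ker_eq_top.mp (eq_top_iff.mpr (hU ▸ Submodule.span_le.mpr ?_))
  rintro _ ⟨p, g, l, hg, rfl⟩
  exact LinearMap.congr_fun (hcon p g hg) l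

theorem finite_of_injective {α : Composition n} {L : SuperModule (grading k n)}
    {f : L.V →ₗ[k] (Stilde k α).V} (hinj : Function.Injective f) : Module.Finite k L.V :=
  FiniteDimensional.of_injective f hinj

theorem exists_injective_to_dual {α : Composition n} {L L' : SuperModule (grading k n)}
    (hL : L.IsSimple) (hL' : Nontrivial L'.V) {d d' : ZMod 2} {f : L.V →ₗ[k] (Stilde k α).V}
    (hf : IsMor L (Stilde k α) d f) (hinj : Function.Injective f)
    {f' : L'.V →ₗ[k] (Stilde k α).V} (hf' : IsMor L' (Stilde k α) d' f')
    (hinj' : Function.Injective f') (ν : HC k n ≃ₐ[k] (HC k n)ᵐᵒᵖ)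
    (hν : ∀ i, ∀ a ∈ grading k n i, (ν a).unop ∈ grading k n i) {e : ZMod 2}
    {F : (Stilde k α).V ≃ₗ[k] ((Stilde k α).dualTwist ν hν).V}
    (hF : IsMor (Stilde k α) ((Stilde k α).dualTwist ν hν) e F.toLinearMap) :
    ∃ (p : ZMod 2) (h : L.V →ₗ[k] (L'.dualTwist ν hν).V),
      IsMor L (L'.dualTwist ν hν) p h ∧ Function.Injective h := by
  have hr := (hf'.dualMap ν hν).comp hF
  have hq : (f'.dualMap : _ →ₗ[k] (L'.dualTwist ν hν).V) ∘ₗ F.toLinearMap ≠ 0 := by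
    intro h0
    obtain ⟨l, hl⟩ := exists_ne (0 : L'.V)
    apply hl
    rw [← Module.forall_dual_apply_eq_zero_iff k]
    intro g
    obtain ⟨g', rfl⟩ := LinearMap.dualMap_surjective_of_injective hinj' g
    obtain ⟨x, rfl⟩ := F.surjective g'
    exact LinearMap.congr_fun (LinearMap.congr_fun h0 x) l
  obtain ⟨p, g, hg, hne⟩ := exists_endo_ne (N := L'.dualTwist ν hν) hL.1 hf hinj hq
  have hm := hr.comp (hg.comp hf)
  exact ⟨_, _, hm, hm.injective_of_simple grading_sup hL hne⟩

theorem iso_dual {α : Composition n} {L L' : SuperModule (grading k n)}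
    (hL : L.IsSimple) (hL' : L'.IsSimple) {d d' : ZMod 2} {f : L.V →ₗ[k] (Stilde k α).V}
    (hf : IsMor L (Stilde k α) d f) (hinj : Function.Injective f)
    {f' : L'.V →ₗ[k] (Stilde k α).V} (hf' : IsMor L' (Stilde k α) d' f')
    (hinj' : Function.Injective f') (ν : HC k n ≃ₐ[k] (HC k n)ᵐᵒᵖ)
    (hν : ∀ i, ∀ a ∈ grading k n i, (ν a).unop ∈ grading k n i) {e : ZMod 2}
    {F : (Stilde k α).V ≃ₗ[k] ((Stilde k α).dualTwist ν hν).V}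
    (hF : IsMor (Stilde k α) ((Stilde k α).dualTwist ν hν) e F.toLinearMap) :
    L.Iso (L'.dualTwist ν hν) := by
  have fL : Module.Finite k L.V := finite_of_injective hinj
  have fL' : Module.Finite k L'.V := finite_of_injective hinj'
  have fD : Module.Finite k (L.dualTwist ν hν).V :=
    inferInstanceAs (Module.Finite k (Module.Dual k L.V))
  have fD' : Module.Finite k (L'.dualTwist ν hν).V :=
    inferInstanceAs (Module.Finite k (Module.Dual k L'.V))
  have r : Module.finrank k (L.dualTwist ν hν).V = Module.finrank k L.V :=
    Subspace.dual_finrank_eq (V := L.V)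
  have r' : Module.finrank k (L'.dualTwist ν hν).V = Module.finrank k L'.V :=
    Subspace.dual_finrank_eq (V := L'.V)
  obtain ⟨p, h, hh, hi⟩ := exists_injective_to_dual hL hL'.1 hf hinj hf' hinj' ν hν hF
  obtain ⟨p', h', -, hi'⟩ := exists_injective_to_dual hL' hL.1 hf' hinj' hf hinj ν hν hF
  have l1 := LinearMap.finrank_le_finrank_of_injective hi
  have l2 := LinearMap.finrank_le_finrank_of_injective hi'
  have e : Module.finrank k L.V = Module.finrank k (L'.dualTwist ν hν).V := by omega
  exact ⟨p, LinearEquiv.ofBijective h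
    ⟨hi, (LinearMap.injective_iff_surjective_of_finrank_eq_finrank e).mp hi⟩, hh⟩

end Simples

/-! ### Compositions with the same peak set -/

section Peaks

variable {n : ℕ}

theorem desc_ofDescents (s : Finset (Fin (n - 1))) : desc (ofDescents s) = s := by
  ext i
  rw [mem_desc, mem_descentSet_ofDescents]

theorem mem_descentSet_iff {α : Composition n} {x : ℕ} :
    x ∈ descentSet α ↔ ∃ i ∈ desc α, (i : ℕ) + 1 = x := by
  constructor
  · intro h
    have hx := Finset.mem_Icc.mp (descentSet_subset α h)
    refine ⟨⟨x - 1, by omega⟩, mem_desc.mpr ?_, Nat.sub_add_cancel hx.1⟩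
    rwa [Nat.sub_add_cancel hx.1]
  · rintro ⟨i, hi, rfl⟩
    exact mem_desc.mp hi

/-- The composition with descent set `P`. -/
def ofPeaks (n : ℕ) (P : Finset ℕ) : Composition n :=
  ofDescents (Finset.univ.filter fun i : Fin (n - 1) => (i : ℕ) + 1 ∈ P)

theorem peakSet_ofPeaks {P : Finset ℕ} (hP : IsPeakSet n P) : peakSet (ofPeaks n P) = P := by
  have h : ∀ x, x ∈ descentSet (ofPeaks n P) ↔ x ∈ P := by
    intro x
    rw [mem_descentSet_iff, ofPeaks, desc_ofDescents]
    constructor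
    · rintro ⟨i, hi, rfl⟩
      exact (Finset.mem_filter.mp hi).2
    · intro hx
      have := Finset.mem_Icc.mp (hP.1 hx)
      refine ⟨⟨x - 1, by omega⟩, Finset.mem_filter.mpr ⟨Finset.mem_univ _, ?_⟩,
        Nat.sub_add_cancel (by omega)⟩
      rwa [Nat.sub_add_cancel (by omega)]
  ext x
  simp only [peakSet, Finset.mem_filter, h]
  exact ⟨fun h => h.2.2, fun hx => ⟨hP.1 hx, hP.2 x hx, hx⟩⟩

variable {k : Type u} [Field k] [CharZero k]

theorem Stilde_iso_of_desc_eq {α β : Composition n} (h : desc α = desc β) :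
    (Stilde k α).Iso (Stilde k β) := by
  obtain ⟨F, hF, -⟩ := exists_iso (α := α) (Stilde k β) 0 (eta_mem β)
    (fun i => by rw [T_eta, weight_eq, weight_eq, h]) (eta_generates β) (finrank_Stilde β)
  exact ⟨0, F, hF⟩

/-- Moving a valley by one step to the left does not change `S̃`. -/
theorem Stilde_iso_of_erase {α β : Composition n} {i : Fin (n - 1)} (hi' : i ∈ desc β)
    (hα : desc α = (desc β).erase i) (hl : ∀ j, hi j = lo i → j ∈ desc β)
    (hr : ∀ j, lo j = hi i → j ∉ desc β) : (Stilde k β).Iso (Stilde k α) := by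
  have hd : ∀ j, j ∈ desc α ↔ j ≠ i ∧ j ∈ desc β := fun j => by rw [hα, Finset.mem_erase]
  obtain ⟨F, hF, -⟩ := exists_iso (α := β) (Stilde k α) 1
    (u := (Stilde k α).ρ (c k (lo i) - c k (hi i)) (eta k α)) (by
      have := (Stilde k α).act_mem (sub_mem (c_mem (k := k) (lo i)) (c_mem (hi i))) (eta_mem α)
      rwa [add_zero] at this)
    (fun j => by
      apply (fockEquiv k α).injective
      rw [map_smul, fockEquiv_act, fockEquiv_act, fockEquiv_eta, map_sub, model_c, model_c, model_T,
        LinearMap.sub_apply, map_sub, weight_eq]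
      have comm : ∀ m, m ≠ lo j → m ≠ hi j → tOp k (desc α) j (aOp k m (vac k n)) =
          aOp k m (tOp k (desc α) j (vac k n)) := fun m h1 h2 =>
        LinearMap.congr_fun ((fermiRels k).t_a j m h1 h2) (vac k n)
      by_cases e1 : j = i
      · subst e1
        rw [tOp_aOp_lo, tOp_aOp_hi, tOp_vac, if_neg (fun h => ((hd _).mp h).1 rfl), if_pos hi']
        simp
      have hd' : j ∈ desc α ↔ j ∈ desc β := by rw [hd]; exact and_iff_right e1
      have e1' : (j : ℕ) ≠ i := fun h => e1 (Fin.ext h)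
      by_cases e2 : hi j = lo i
      · have hj := hl j e2
        have q : lo j ≠ hi i ∧ hi j ≠ hi i := by
          simp only [lo, hi, ne_eq, Fin.ext_iff] at e2 ⊢; omega
        rw [← e2, tOp_aOp_hi, comm (hi i) q.1.symm q.2.symm, tOp_vac, if_pos (hd'.mpr hj),
          if_pos hj]
        simp only [map_neg]
        module
      by_cases e3 : lo j = hi i
      · have hj := hr j e3
        have q : lo i ≠ lo j ∧ lo i ≠ hi j := by
          simp only [lo, hi, ne_eq, Fin.ext_iff] at e3 ⊢; omega
        rw [← e3, tOp_aOp_lo, comm (lo i) q.1 q.2, tOp_vac, if_neg (fun h => hj (hd'.mp h)),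
          if_neg hj]
        simp
      · have q : lo i ≠ lo j ∧ hi i ≠ hi j := by
          simp only [lo, hi, ne_eq, Fin.ext_iff]; omega
        rw [comm (lo i) q.1 (Ne.symm e2), comm (hi i) (Ne.symm e3) q.2, tOp_vac]
        by_cases hj : j ∈ desc β
        · rw [if_pos (hd'.mpr hj), if_pos hj]
          simp only [map_neg]
          module
        · rw [if_neg (fun h => hj (hd'.mp h)), if_neg hj]
          simp)
    (fun x => by
      obtain ⟨a, rfl⟩ := eta_generates α x
      have hsq : (c k (lo i) - c k (hi i)) * (c k (lo i) - c k (hi i)) = (-2 : k) • 1 := by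
        rw [sub_mul, mul_sub, mul_sub, (hcRels k).c_sq, (hcRels k).c_sq,
          (hcRels k).c_anti _ _ (lo_ne_hi i)]
        module
      refine ⟨a * ((-2 : k)⁻¹ • (c k (lo i) - c k (hi i))), ?_⟩
      rw [← Module.End.mul_apply, ← map_mul, mul_assoc, smul_mul_assoc, hsq, smul_smul,
        inv_mul_cancel₀ (by norm_num), one_smul, mul_one]) (finrank_Stilde α)
  exact ⟨1, F, hF⟩

theorem Stilde_iso_ofPeaks (m : ℕ) (α : Composition n) (hm : (desc α).card = m) :
    (Stilde k α).Iso (Stilde k (ofPeaks n (peakSet α))) := by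
  induction m generalizing α with
  | zero =>
    apply Stilde_iso_of_desc_eq
    rw [Finset.card_eq_zero] at hm
    rw [ofPeaks, desc_ofDescents, hm, eq_comm, Finset.filter_eq_empty_iff]
    intro i _ hi'
    have := (Finset.mem_filter.mp hi').2.2
    rw [← mem_desc, hm] at this
    exact Finset.notMem_empty _ this
  | succ m ih =>
    by_cases hs : ((desc α).filter fun i : Fin (n - 1) => (i : ℕ) + 1 ∉ peakSet α).Nonempty
    · set s := (desc α).filter fun i : Fin (n - 1) => (i : ℕ) + 1 ∉ peakSet α with hsdef
      set i := s.max' hs with hidef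
      have his : i ∈ s := s.max'_mem hs
      have hid : i ∈ desc α := (Finset.mem_filter.mp his).1
      have hip : (i : ℕ) + 1 ∉ peakSet α := (Finset.mem_filter.mp his).2
      have hl : ∀ j, hi j = lo i → j ∈ desc α := by
        intro j hj
        simp only [lo, hi, Fin.ext_iff] at hj
        by_contra hjd
        apply hip
        have := i.2
        refine Finset.mem_filter.mpr ⟨Finset.mem_Icc.mpr ⟨by omega, by omega⟩, ?_, mem_desc.mp hid⟩
        rw [Nat.add_sub_cancel, ← hj]
        exact fun h => hjd (mem_desc.mpr h)
      have hr : ∀ j, lo j = hi i → j ∉ desc α := by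
        intro j hj hjd
        simp only [lo, hi, Fin.ext_iff] at hj
        have hjs : j ∈ s := by
          refine Finset.mem_filter.mpr ⟨hjd, fun h => (Finset.mem_filter.mp h).2.1 ?_⟩
          rw [Nat.add_sub_cancel, hj]
          exact mem_desc.mp hid
        have : j ≤ i := s.le_max' j hjs
        have : (j : ℕ) ≤ i := this
        omega
      let β : Composition n := ofDescents ((desc α).erase i)
      have hβ : desc β = (desc α).erase i := desc_ofDescents _
      have hDβ : ∀ x, x ∈ descentSet β ↔ x ≠ (i : ℕ) + 1 ∧ x ∈ descentSet α := by
        intro x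
        rw [mem_descentSet_iff, mem_descentSet_iff, hβ]
        constructor
        · rintro ⟨j, hj, rfl⟩
          rw [Finset.mem_erase] at hj
          refine ⟨fun h => hj.1 (Fin.ext (by omega)), j, hj.2, rfl⟩
        · rintro ⟨hne, j, hj, rfl⟩
          exact ⟨j, Finset.mem_erase.mpr ⟨fun h => hne (by rw [h]), hj⟩, rfl⟩
      have hP : peakSet β = peakSet α := by
        ext x
        simp only [peakSet, Finset.mem_filter, Finset.mem_Icc] at hip ⊢
        rw [hDβ, hDβ]
        constructor
        · rintro ⟨hx, h1, h2, h3⟩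
          refine ⟨hx, fun h => ?_, h3⟩
          by_cases e : x - 1 = (i : ℕ) + 1
          · obtain ⟨j, hj, hjx⟩ := mem_descentSet_iff.mp h3
            exact hr j (by simp only [lo, hi, Fin.ext_iff]; omega) hj
          · exact h1 ⟨e, h⟩
        · rintro ⟨hx, h1, h2⟩
          refine ⟨hx, fun h => h1 h.2, ?_, h2⟩
          rintro rfl
          exact hip ⟨hx, h1, h2⟩
      have h1 := Stilde_iso_of_erase (k := k) hid hβ hl hr
      have h2 := ih β (by rw [hβ, Finset.card_erase_of_mem hid, hm, Nat.add_sub_cancel])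
      rw [hP] at h2
      exact h1.trans h2
    · apply Stilde_iso_of_desc_eq
      rw [ofPeaks, desc_ofDescents]
      ext i
      simp only [Finset.mem_filter, Finset.mem_univ, true_and]
      constructor
      · intro h
        by_contra hc
        exact hs ⟨i, Finset.mem_filter.mpr ⟨h, hc⟩⟩
      · intro h
        exact mem_desc.mpr (Finset.mem_filter.mp h).2.2

theorem Stilde_iso_of_peakSet_eq {α β : Composition n} (h : peakSet α = peakSet β) :
    (Stilde k α).Iso (Stilde k β) := by
  have h1 := Stilde_iso_ofPeaks (k := k) _ α rfl
  rw [h] at h1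
  exact h1.trans (Stilde_iso_ofPeaks _ β rfl).symm

/-! ### The supermodules `HClS_P` -/

theorem exists_isHClS {P : Finset ℕ} (hP : IsPeakSet n P) :
    ∃ L : SuperModule (grading k n), IsHClS P L := by
  have : Nontrivial (Stilde k (ofPeaks n P)).V := Module.nontrivial_of_finrank_pos (R := k)
    (by rw [finrank_Stilde]; positivity)
  obtain ⟨L, f, hL, hf, hinj⟩ := (Stilde k (ofPeaks n P)).exists_simple_sub
  exact ⟨L, hL, _, peakSet_ofPeaks hP, 0, f, hf, hinj⟩

theorem IsHClS.iso {P : Finset ℕ} {L L' : SuperModule (grading k n)} (hL : IsHClS P L)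
    (hL' : IsHClS P L') : L.Iso L' := by
  obtain ⟨hs, α, hα, d, f, hf, hinj⟩ := hL
  obtain ⟨hs', β, hβ, d', f', hf', hinj'⟩ := hL'
  obtain ⟨e, G, hG⟩ := Stilde_iso_of_peakSet_eq (k := k) (hα.trans hβ.symm)
  obtain ⟨F, hF, -⟩ := exists_iso_psi (k := k) β
  have h1 := iso_dual hs hs' (hG.comp hf) (G.injective.comp hinj) hf' hinj' _ _ hF
  have h2 := iso_dual hs' hs' hf' hinj' hf' hinj' _ _ hF
  exact h1.trans h2.symm

theorem IsHClS.twist {P : Finset ℕ} {L : SuperModule (grading k n)} (hL : IsHClS P L)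
    (ν : HC k n ≃ₐ[k] HC k n) (hν : ∀ i, ∀ a ∈ grading k n i, ν a ∈ grading k n i)
    (hiso : ∀ α : Composition n, (Stilde k (conj α)).Iso ((Stilde k α).twist ν hν))
    {α : Composition n} (hα : peakSet α = P) : IsHClS (peakSet (conj α)) (L.twist ν hν) := by
  obtain ⟨hs, β, hβ, d, f, hf, hinj⟩ := hL
  obtain ⟨e, G, hG⟩ := (hiso β).symm
  exact ⟨hs.twist ν hν, conj β, peakSet_conj_congr (hβ.trans hα.symm), e + d, _,
    hG.comp (hf.twist ν hν), G.injective.comp hinj⟩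

theorem IsHClS.dual_iso {P : Finset ℕ} {L : SuperModule (grading k n)} (hL : IsHClS P L)
    (ν : HC k n ≃ₐ[k] (HC k n)ᵐᵒᵖ) (hν : ∀ i, ∀ a ∈ grading k n i, (ν a).unop ∈ grading k n i)
    (hiso : ∀ α : Composition n, (Stilde k α).Iso ((Stilde k α).dualTwist ν hν)) :
    (L.dualTwist ν hν).Iso L := by
  obtain ⟨hs, β, hβ, d, f, hf, hinj⟩ := hL
  obtain ⟨e, F, hF⟩ := hiso β
  exact (iso_dual hs hs hf hinj hf hinj ν hν hF).symm

end Peaks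

end HCl

end


theorem proposition3p3p7 {k : Type u} [Field k] [IsAlgClosed k] [CharZero k] (n : ℕ)
    (hn : 1 ≤ n) :
    -- for each peak set `P`, the simple supermodule `HClS_P` exists and is unique up to isomorphism
    (∀ P : Finset ℕ, IsPeakSet n P →
      (∃ L : SuperModule (grading k n), IsHClS P L) ∧
      ∀ L L' : SuperModule (grading k n), IsHClS P L → IsHClS P L' → L.Iso L') ∧
    -- (1)
    (∀ α : Composition n,
      (∃ F : (Stilde k (conj α)).V ≃ₗ[k] ((Stilde k α).twist (phi k n) (phi_even k n)).V,
        SuperModule.IsMor _ _ (n : ZMod 2) F.toLinearMap ∧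
        ∀ D : Finset (Fin n), F ((Stilde k (conj α)).ρ (cD k D) (eta k (conj α))) =
          (-1 : k) ^ (n * D.card) •
            (Stilde k α).ρ (phi k n (cD k D)) ((Stilde k α).ρ (cD k Finset.univ) (eta k α))) ∧
      ∀ L L' : SuperModule (grading k n), IsHClS (peakSet α) L → IsHClS (peakSet (conj α)) L' →
        (L.twist (phi k n) (phi_even k n)).Iso L') ∧
    -- (2)
    (∀ α : Composition n,
      (∃ F : (Stilde k (conj α)).V ≃ₗ[k] ((Stilde k α).twist (phi' k n) (phi'_even k n)).V,
        SuperModule.IsMor _ _ 0 F.toLinearMap ∧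
        ∀ D : Finset (Fin n), F ((Stilde k (conj α)).ρ (cD k D) (eta k (conj α))) =
          (Stilde k α).ρ (phi' k n (cD k D)) (eta k α)) ∧
      ∀ L L' : SuperModule (grading k n), IsHClS (peakSet α) L → IsHClS (peakSet (conj α)) L' →
        (L.twist (phi' k n) (phi'_even k n)).Iso L') ∧
    -- (3) and (4): the isomorphisms for `S̃_α`
    (∀ α : Composition n, ∃ b : Module.Basis (Finset (Fin n)) k (Stilde k α).V,
      (∀ D : Finset (Fin n), b D = (Stilde k α).ρ (cD k D) (eta k α)) ∧
      (∃ F : (Stilde k α).V ≃ₗ[k] ((Stilde k α).dualTwist (psi k n) (psi_even k n)).V,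
        SuperModule.IsMor _ _ 0 F.toLinearMap ∧
        ∀ D : Finset (Fin n), F ((Stilde k α).ρ (cD k D) (eta k α)) =
          ((Stilde k α).dualTwist (psi k n) (psi_even k n)).ρ (cD k D) (b.coord ∅)) ∧
      (∃ F : (Stilde k α).V ≃ₗ[k] ((Stilde k α).dualTwist (psi' k n) (psi'_even k n)).V,
        SuperModule.IsMor _ _ (n : ZMod 2) F.toLinearMap ∧
        ∀ D : Finset (Fin n), F ((Stilde k α).ρ (cD k D) (eta k α)) =
          (-1 : k) ^ (n * D.card) •
            ((Stilde k α).dualTwist (psi' k n) (psi'_even k n)).ρ (cD k D)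
              (b.coord Finset.univ))) ∧
    -- (3) and (4): the consequences for `HClS_P`
    (∀ P : Finset ℕ, IsPeakSet n P → ∀ L : SuperModule (grading k n), IsHClS P L →
      (L.dualTwist (psi k n) (psi_even k n)).Iso L ∧
      (L.dualTwist (psi' k n) (psi'_even k n)).Iso L) := by
  refine ⟨fun P hP => ⟨exists_isHClS hP, fun L L' hL hL' => hL.iso hL'⟩, fun α => ?_, fun α => ?_,
    fun α => ?_, fun P _ L hL => ⟨?_, ?_⟩⟩
  · refine ⟨exists_iso_phi α, fun L L' hL hL' => ?_⟩
    refine (hL.twist _ _ (fun β => ?_) rfl).iso hL'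
    obtain ⟨F, hF, -⟩ := exists_iso_phi (k := k) β
    exact ⟨_, F, hF⟩
  · refine ⟨exists_iso_phi' α, fun L L' hL hL' => ?_⟩
    refine (hL.twist _ _ (fun β => ?_) rfl).iso hL'
    obtain ⟨F, hF, -⟩ := exists_iso_phi' (k := k) β
    exact ⟨_, F, hF⟩
  · exact ⟨cBasis k α, cBasis_apply α, exists_iso_psi α, exists_iso_psi' α⟩
  · refine hL.dual_iso _ _ fun β => ?_
    obtain ⟨F, hF, -⟩ := exists_iso_psi (k := k) β
    exact ⟨_, F, hF⟩
  · refine hL.dual_iso _ _ fun β => ?_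
    obtain ⟨F, hF, -⟩ := exists_iso_psi' (k := k) β
    exact ⟨_, F, hF⟩
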